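/- Let $c\in(-\tfrac14,\tfrac34)$ and $\nu:=\sqrt{c+\tfrac14}\in(0,1)$. Let $A$ be the operator on the real space $L^2(-1,1)$ whose domain $D(A)$ is the set of all $f=f_r+f_s$ such that * $f_r\in H^2(-1,1)$ and $f_r(0)=f_r'(0)=0$; * $f_s(x)=c_1^+|x|^{\nu+1/2}+c_2^+|x|^{-\nu+1/2}$ for $x>0$ and $f_s(x)=c_1^-|x|^{\nu+1/2}+c_2^-|x|^{-\nu+1/2}$ for $x<0$, with real coefficients $c_1^\pm,c_2^\pm$; * $f(-1)=f(1)=0$; * (transmission conditions) $c_1^-+c_2^-+c_1^++c_2^+=0$ and $(\nu+\tfrac12)c_1^-+(-\nu+\tfrac12)c_2^-=(\nu+\tfrac12)c_1^++(-\nu+\tfrac12)c_2^+$; and $Af:=-\partial_{xx}f+\frac{c}{x^2}f$ on $(-1,0)\cup(0,1)$. For $f^0\in L^2(-1,1)$ let $t\mapsto e^{-tA}f^0$ be the unique function in $C^0([0,\infty),L^2(-1,1))\cap C^0((0,\infty),D(A))\cap C^1((0,\infty),L^2(-1,1))$ with $f'(t)+Af(t)=0$ for $t>0$ and $f(0)=f^0$.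 Let $T>0$ and let $\omega$ be a nonempty open subset of $(-1,1)$. Then the equation $$\partial_t f-\partial_{xx}f+\frac{c}{x^2}f=u(t,x)\chi_\omega(x)\ \text{ on }(0,T)\times(-1,1),\qquad f(t,-1)=f(t,1)=0,\qquad f(0,\cdot)=f^0,$$ is approximately controllable from $\omega$ in time $T$: for all $f^0,f^T\in L^2(-1,1)$ and every $\varepsilon>0$ there is $u\in L^2((0,T)\times\omega)$ such that the mild solution $$f(t)=e^{-tA}f^0+\int_0^t e^{-(t-\tau)A}\big(u(\tau,\cdot)\chi_\omega\big)\,d\tau,\qquad t\in[0,T],$$ satisfies $\|f(T)-f^T\|_{L^2(-1,1)}\le\varepsilon$. -/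

import Mathlib

open MeasureTheory Set

noncomputable section

namespace SingularHeat

/-- Lebesgue measure on the interval `(-1, 1)`. -/
abbrev μI : Measure ℝ := volume.restrict (Ioo (-1 : ℝ) 1)

/-- The real Hilbert space `L²(-1, 1)`. -/
abbrev L2I : Type := Lp ℝ 2 μI

/-- `g` is the weak derivative of `f` on `(-1, 1)` (used for locally integrable `f`, `g`). -/
def IsWeakDeriv (f g : ℝ → ℝ) : Prop :=
  ∀ φ : ℝ → ℝ, ContDiff ℝ ((⊤ : ℕ∞) : WithTop ℕ∞) φ → HasCompactSupport φ → tsupport φ ⊆ Ioo (-1 : ℝ) 1 →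
    ∫ x in Ioo (-1 : ℝ) 1, f x * deriv φ x = -∫ x in Ioo (-1 : ℝ) 1, g x * φ x

/-- `f` is the `C¹([-1, 1])` representative of an element of `H²(-1, 1)` with `f(0) = f'(0) = 0`;
`f₁` is (the continuous representative of) its first weak derivative and `f₂ ∈ L²(-1, 1)` its
second weak derivative. -/
structure IsRegularPart (f f₁ f₂ : ℝ → ℝ) : Prop where
  continuousOn : ContinuousOn f (Icc (-1) 1)
  continuousOn_deriv : ContinuousOn f₁ (Icc (-1) 1)
  memLp : MemLp f₂ 2 μI
  weakDeriv : IsWeakDeriv f f₁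
  weakDeriv₂ : IsWeakDeriv f₁ f₂
  apply_zero : f 0 = 0
  deriv_zero : f₁ 0 = 0

/-- The exponent `ν ≥ 0` with `c = ν² - 1/4`. -/
def nu (c : ℝ) : ℝ := Real.sqrt (c + 1 / 4)

/-- The singular function equal to `p₁ |x|^(ν+1/2) + p₂ |x|^(-ν+1/2)` for `x > 0` and to
`m₁ |x|^(ν+1/2) + m₂ |x|^(-ν+1/2)` for `x < 0` (the value at `0` plays no role). -/
def singularPart (ν m₁ m₂ p₁ p₂ : ℝ) (x : ℝ) : ℝ :=
  if 0 < x then p₁ * |x| ^ (ν + 1 / 2) + p₂ * |x| ^ (-ν + 1 / 2)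
  else if x < 0 then m₁ * |x| ^ (ν + 1 / 2) + m₂ * |x| ^ (-ν + 1 / 2)
  else 0

/-- The graph of the operator `A = -∂ₓₓ + c / x²` on `L²(-1, 1)`: `f ∈ D(A)` and `A f = h`.
The domain consists of the sums `f = f_r + f_s` of a regular and a singular part that vanish at
`±1` and satisfy the two transmission conditions. As `f_s` is smooth off `0`, the second
derivative of `f` on `(-1, 0) ∪ (0, 1)` is `f_r'' + f_s''`. -/
def OpGraph (c : ℝ) (f h : L2I) : Prop :=
  ∃ (r r₁ r₂ : ℝ → ℝ) (m₁ m₂ p₁ p₂ : ℝ),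
    IsRegularPart r r₁ r₂ ∧
    r (-1) + singularPart (nu c) m₁ m₂ p₁ p₂ (-1) = 0 ∧
    r 1 + singularPart (nu c) m₁ m₂ p₁ p₂ 1 = 0 ∧
    m₁ + m₂ + p₁ + p₂ = 0 ∧
    (nu c + 1 / 2) * m₁ + (-nu c + 1 / 2) * m₂ = (nu c + 1 / 2) * p₁ + (-nu c + 1 / 2) * p₂ ∧
    (∀ᵐ x ∂μI, f x = r x + singularPart (nu c) m₁ m₂ p₁ p₂ x) ∧
    (∀ᵐ x ∂μI, h x = -(r₂ x + iteratedDeriv 2 (singularPart (nu c) m₁ m₂ p₁ p₂) x)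
      + c / x ^ 2 * (r x + singularPart (nu c) m₁ m₂ p₁ p₂ x))

/-- `f ∈ C⁰([0, ∞), L²) ∩ C⁰((0, ∞), D(A)) ∩ C¹((0, ∞), L²)` solves `f' + A f = 0`,
`f(0) = f⁰`; here `D(A)` carries the graph norm, and `h t = A (f t)`. -/
def IsHomogeneousSolution (c : ℝ) (f0 : L2I) (f : ℝ → L2I) : Prop :=
  ContinuousOn f (Ici 0) ∧ f 0 = f0 ∧
    ∃ h : ℝ → L2I, ContinuousOn h (Ioi 0) ∧
      ∀ t : ℝ, 0 < t → OpGraph c (f t) (h t) ∧ HasDerivAt f (-h t) t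

/-- `S t`, for `t ≥ 0`, is the semigroup `e^{-tA}`: each orbit is the solution of the homogeneous
problem. The values at `t < 0` are irrelevant. -/
def IsHeatSemigroup (c : ℝ) (S : ℝ → L2I →L[ℝ] L2I) : Prop :=
  ∀ f0 : L2I, IsHomogeneousSolution c f0 (fun t => S t f0)

/-- `f` is, on `[0, T]`, the mild solution of `f' + A f = v`, `f(0) = f⁰`,
with `v ∈ L¹((0, T); L²(-1, 1))`. -/
def IsMildSolution (c T : ℝ) (f0 : L2I) (v f : ℝ → L2I) : Prop :=
  IntervalIntegrable v volume 0 T ∧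
    ∃ S : ℝ → L2I →L[ℝ] L2I, IsHeatSemigroup c S ∧
      ∀ t ∈ Icc 0 T, f t = S t f0 + ∫ τ in (0 : ℝ)..t, S (t - τ) (v τ)

open Classical in
/-- The source term `t ↦ u(t, ·) χ_ω`, as an `L²(-1, 1)`-valued function. The slice lies in
`L²(-1, 1)` for almost every `t ∈ (0, T)` when `u ∈ L²((0, T) × ω)`; on the exceptional null set
the value is irrelevant. -/
def controlSource (ω : Set ℝ) (u : ℝ → ℝ → ℝ) (t : ℝ) : L2I :=
  if hu : MemLp (ω.indicator (u t)) 2 μI then hu.toLp (ω.indicator (u t)) else 0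

/-- Approximate controllability from `ω` in time `T`: for all `f⁰, f^T ∈ L²(-1, 1)` and `ε > 0`
there is `u ∈ L²((0, T) × ω)` such that the mild solution exists and satisfies
`‖f(T) - f^T‖ ≤ ε`. -/
def ApproximatelyControllable (c T : ℝ) (ω : Set ℝ) : Prop :=
  ∀ (f0 fT : L2I) (ε : ℝ), 0 < ε →
    ∃ u : ℝ → ℝ → ℝ,
      MemLp (Function.uncurry u) 2 (volume.restrict (Ioo 0 T ×ˢ ω)) ∧
      (∃ f : ℝ → L2I, IsMildSolution c T f0 (controlSource ω u) f) ∧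
      ∀ f : ℝ → L2I, IsMildSolution c T f0 (controlSource ω u) f → ‖f T - fT‖ ≤ ε

end SingularHeat

end

/-! Approximate controllability is dual to unique continuation. The states reachable from 0 form a
subspace, which is dense as soon as only g = 0 is orthogonal to it. Testing such a g against
controls θ(t) w(x) gives ⟨e^{-sA}(χ_ω w), g⟩ = 0 for every w and every s in (0, T). In an eigenbasis
of A this pairing is a generalized Dirichlet series in s, with absolutely summable coefficients and
exponents bounded below. It extends analytically, and the coefficients at each exponent sum to zero
(`dirichlet_coeff_eq_zero`). So the projection of g on each eigenspace vanishes on ω, and only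
eigenfunctions remain to be treated (`eq_zero_of_orbit`); multiplicities play no role.

An eigenfunction that vanishes on ω vanishes on the whole side of 0 where some nonzero point of ω
lies, by uniqueness for the ODE. Its two singular coefficients there are then zero. The two
transmission conditions determine the coefficients on one side from those on the other, so these
vanish too; a solution without singular part is zero, by uniqueness from the singular point. Both
uniqueness statements come from one Gronwall estimate for an energy adapted to the indicial
exponents ±ν + 1/2 (`HalfSol.hasDerivAt_energy`), and ν < 1 is what makes the second one work.

The spectral side has three ingredients. A is symmetric, because the boundary form at 0 is the
Wronskian of the singular profiles and the transmission conditions cancel its two sides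
(`inner_graph`). A has a compact inverse modulo an explicit kernel vector: the equation is solved on
each half by variation of constants, with Hardy's inequality for the second derivative, and one odd
singular function repairs the boundary values (`exists_hasCompactInverse`). The spectrum is bounded
below, because by Hardy's inequality the form is nonnegative where the four singular coefficients
vanish, so at most four eigenvalues are negative (`exists_lower_bound`). The semigroup is then
diagonal, and every semigroup satisfying the definition agrees with it at nonnegative times. -/

noncomputable section

namespace SingularHeat

/-! ### Spectral theorem for symmetric relations with compact inverse modulo a kernel vector -/

section Spectral

open Module.End
open scoped InnerProductSpace

universe u

variable {H : Type u} [NormedAddCommGroup H] [InnerProductSpace ℝ H]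

/-- The eigenvectors of a compact symmetric operator contain a Hilbert basis. -/
theorem exists_hilbertBasis_eigenvectors [CompleteSpace H] {R : H →L[ℝ] H}
    (hR : IsCompactOperator R) (hs : R.IsSymmetric) :
    ∃ (ι : Type u) (b : HilbertBasis ι ℝ H) (m : ι → ℝ), ∀ i, R (b i) = m i • b i := by
  have hclosed (μ : ℝ) : IsClosed (eigenspace (R : Module.End ℝ H) μ : Set H) := by
    have : (eigenspace (R : Module.End ℝ H) μ : Set H) = {x | R x = μ • x} := by
      ext x; simp
    rw [this]
    exact isClosed_eq R.continuous (continuous_const_smul μ)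
  have (μ : ℝ) : CompleteSpace (eigenspace (R : Module.End ℝ H) μ) :=
    (hclosed μ).completeSpace_coe
  choose w b hb using fun μ : ℝ => exists_hilbertBasis ℝ (eigenspace (R : Module.End ℝ H) μ)
  have hon : Orthonormal ℝ fun a : Σ μ, w μ => ((b a.1 a.2 : eigenspace (R : Module.End ℝ H) a.1) : H) :=
    hs.orthogonalFamily_eigenspaces.orthonormal_sigma_orthonormal fun μ => (b μ).orthonormal
  refine ⟨Σ μ, w μ, HilbertBasis.mkOfOrthogonalEqBot hon ?_, fun a => a.1, fun a => ?_⟩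
  · rw [eq_bot_iff, ← R.orthogonalComplement_iSup_eigenspaces_eq_bot hR hs,
      ← Submodule.iInf_orthogonal]
    intro v hv
    simp only [Submodule.mem_iInf]
    intro μ x hx
    -- A vector orthogonal to all chosen basis vectors is orthogonal to each eigenspace: expand an
    -- element of it in the eigenspace's own basis and pair termwise.
    have h1 := ((b μ).hasSum_repr ⟨x, hx⟩).mapL
      ((innerSL ℝ v).comp (eigenspace (R : Module.End ℝ H) μ).subtypeL)
    have h2 : ∀ i, ((innerSL ℝ v).comp (eigenspace (R : Module.End ℝ H) μ).subtypeL)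
        ((b μ).repr ⟨x, hx⟩ i • b μ i) = 0 := by
      intro i
      have := hv _ (Submodule.subset_span ⟨⟨μ, i⟩, rfl⟩)
      rw [real_inner_comm] at this
      simp [this]
    simp_rw [h2] at h1
    have := h1.unique hasSum_zero
    rw [real_inner_comm]
    simpa using this
  · rw [HilbertBasis.coe_mkOfOrthogonalEqBot]
    exact mem_eigenspace_iff.1 (b a.1 a.2).2

/-- A symmetric linear relation whose inverse is compact modulo the kernel vector `φ`. -/
structure HasCompactInverse (G : Submodule ℝ (H × H)) (φ : H) : Prop where
  symm : ∀ {f h g k : H}, (f, h) ∈ G → (g, k) ∈ G → ⟪h, g⟫_ℝ = ⟪f, k⟫_ℝ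
  ker : (φ, (0 : H)) ∈ G
  eq_zero : ∀ {h : H}, ((0 : H), h) ∈ G → h = 0
  inv : ∃ K : Set H, IsCompact K ∧ ∀ h, ‖h‖ ≤ 1 → ⟪φ, h⟫_ℝ = 0 → ∃ f ∈ K, (f, h) ∈ G

namespace HasCompactInverse

variable {G : Submodule ℝ (H × H)} {φ : H}

theorem exists_mem (hG : HasCompactInverse G φ) {h : H} (hh : ⟪φ, h⟫_ℝ = 0) :
    ∃ f, (f, h) ∈ G := by
  obtain ⟨K, -, hK⟩ := hG.inv
  by_cases h0 : h = 0
  · subst h0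
    exact ⟨0, G.zero_mem⟩
  have hn : ‖h‖ ≠ 0 := norm_ne_zero_iff.2 h0
  obtain ⟨f, -, hf⟩ := hK (‖h‖⁻¹ • h) (by simp [norm_smul, hn]) (by simp [inner_smul_right, hh])
  refine ⟨‖h‖ • f, ?_⟩
  have := G.smul_mem ‖h‖ hf
  rwa [Prod.smul_mk, smul_smul, mul_inv_cancel₀ hn, one_smul] at this

/-- A vector f orthogonal to φ lies in the range, say f = A g, so ‖f‖² = ⟨f, A g⟩ = ⟨A f, g⟩ = 0.
Hence the kernel is exactly the line of φ, and solutions orthogonal to φ are unique; this is what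
makes `inverse` linear. -/
theorem eq_zero_of_ker (hG : HasCompactInverse G φ) {f : H} (hf : (f, (0 : H)) ∈ G)
    (hφ : ⟪φ, f⟫_ℝ = 0) : f = 0 := by
  obtain ⟨g, hg⟩ := hG.exists_mem hφ
  have := hG.symm hf hg
  rw [inner_zero_left] at this
  exact inner_self_eq_zero.1 this.symm

theorem exists_solution (hG : HasCompactInverse G φ) (h : H) :
    ∃ f, (f, (ℝ ∙ φ)ᗮ.starProjection h) ∈ G ∧ ⟪φ, f⟫_ℝ = 0 := by
  have h1 : ∀ x, ⟪φ, (ℝ ∙ φ)ᗮ.starProjection x⟫_ℝ = 0 := fun x =>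
    Submodule.mem_orthogonal_singleton_iff_inner_right.1 (Submodule.starProjection_apply_mem _ _)
  obtain ⟨f, hf⟩ := hG.exists_mem (h1 h)
  refine ⟨(ℝ ∙ φ)ᗮ.starProjection f, ?_, h1 f⟩
  obtain ⟨a, ha⟩ := Submodule.mem_span_singleton.1
    (Submodule.starProjection_apply_mem (ℝ ∙ φ) f)
  have h2 : (ℝ ∙ φ)ᗮ.starProjection f = f - a • φ := by
    rw [ha, Submodule.starProjection_orthogonal]; simp
  rw [h2]
  have := G.sub_mem hf (G.smul_mem a hG.ker)
  simpa using this

/-- The inverse of the relation on the orthogonal complement of the kernel, extended by zero. -/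
def inverse (hG : HasCompactInverse G φ) : H →ₗ[ℝ] H where
  toFun h := (hG.exists_solution h).choose
  map_add' x y := by
    obtain ⟨h1, h1'⟩ := (hG.exists_solution x).choose_spec
    obtain ⟨h2, h2'⟩ := (hG.exists_solution y).choose_spec
    obtain ⟨h3, h3'⟩ := (hG.exists_solution (x + y)).choose_spec
    refine sub_eq_zero.1 (hG.eq_zero_of_ker ?_ ?_)
    · have := G.sub_mem h3 (G.add_mem h1 h2)
      rwa [Prod.mk_add_mk, Prod.mk_sub_mk, sub_eq_zero.2 (map_add _ x y)] at this
    · rw [inner_sub_right, inner_add_right, h1', h2', h3']; simp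
  map_smul' a x := by
    obtain ⟨h1, h1'⟩ := (hG.exists_solution x).choose_spec
    obtain ⟨h3, h3'⟩ := (hG.exists_solution (a • x)).choose_spec
    refine sub_eq_zero.1 (hG.eq_zero_of_ker ?_ ?_)
    · have := G.sub_mem h3 (G.smul_mem a h1)
      simpa using this
    · rw [inner_sub_right, RingHom.id_apply, inner_smul_right, h1', h3']; simp

theorem inverse_mem (hG : HasCompactInverse G φ) (h : H) :
    (hG.inverse h, (ℝ ∙ φ)ᗮ.starProjection h) ∈ G :=
  (hG.exists_solution h).choose_spec.1

theorem inner_inverse (hG : HasCompactInverse G φ) (h : H) : ⟪φ, hG.inverse h⟫_ℝ = 0 :=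
  (hG.exists_solution h).choose_spec.2

theorem starProjection_of_inner_eq_zero {x : H} (hx : ⟪φ, x⟫_ℝ = 0) :
    (ℝ ∙ φ)ᗮ.starProjection x = x :=
  Submodule.starProjection_eq_self_iff.2 (Submodule.mem_orthogonal_singleton_iff_inner_right.2 hx)

theorem inverse_isSymmetric (hG : HasCompactInverse G φ) : hG.inverse.IsSymmetric := by
  intro x y
  have h1 := hG.symm (hG.inverse_mem x) (hG.inverse_mem y)
  rw [Submodule.inner_starProjection_left_eq_right,
    starProjection_of_inner_eq_zero (hG.inner_inverse y),
    ← Submodule.inner_starProjection_left_eq_right,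
    starProjection_of_inner_eq_zero (hG.inner_inverse x)] at h1
  exact h1.symm

/-- Two solutions of the same equation differ by a multiple of φ. So the inverse sends the unit ball
into the projection of K onto the complement of φ, whichever solution in K was offered. -/
theorem inverse_isCompactOperator (hG : HasCompactInverse G φ) :
    IsCompactOperator hG.inverse := by
  obtain ⟨K, hK, h⟩ := hG.inv
  refine ⟨(ℝ ∙ φ)ᗮ.starProjection '' K, hK.image (ContinuousLinearMap.continuous _),
    Filter.mem_of_superset (Metric.closedBall_mem_nhds 0 one_pos) fun x hx => ?_⟩
  have hφ : ⟪φ, (ℝ ∙ φ)ᗮ.starProjection x⟫_ℝ = 0 :=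
    Submodule.mem_orthogonal_singleton_iff_inner_right.1 (Submodule.starProjection_apply_mem _ _)
  obtain ⟨f, hfK, hf⟩ := h ((ℝ ∙ φ)ᗮ.starProjection x)
    ((Submodule.norm_starProjection_apply_le _ _).trans (by simpa using hx)) hφ
  refine ⟨f, hfK, ?_⟩
  obtain ⟨a, ha⟩ := Submodule.mem_span_singleton.1
    (Submodule.starProjection_apply_mem (ℝ ∙ φ) f)
  have h2 : (ℝ ∙ φ)ᗮ.starProjection f = f - a • φ := by
    rw [ha, Submodule.starProjection_orthogonal]; simp
  refine sub_eq_zero.1 (hG.eq_zero_of_ker ?_ ?_)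
  · rw [h2]
    have := G.sub_mem (G.sub_mem hf (G.smul_mem a hG.ker)) (hG.inverse_mem x)
    simpa using this
  · rw [inner_sub_right, hG.inner_inverse, sub_zero]
    exact Submodule.mem_orthogonal_singleton_iff_inner_right.1
      (Submodule.starProjection_apply_mem _ _)

/-- The relation has a Hilbert basis of eigenvectors. -/
theorem exists_eigenbasis [CompleteSpace H] (hG : HasCompactInverse G φ) :
    ∃ (ι : Type u) (b : HilbertBasis ι ℝ H) (l : ι → ℝ), ∀ i, (b i, l i • b i) ∈ G := by
  obtain ⟨ι, b, m, hm⟩ := exists_hilbertBasis_eigenvectors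
    (R := ContinuousLinearMap.mkOfIsCompactOperator hG.inverse_isCompactOperator)
    hG.inverse_isCompactOperator hG.inverse_isSymmetric
  -- The convention 0⁻¹ = 0 gives the right eigenvalue for m i = 0: the inverse annihilates only
  -- multiples of φ, which are in the kernel of the relation.
  refine ⟨ι, b, fun i => (m i)⁻¹, fun i => ?_⟩
  replace hm : hG.inverse (b i) = m i • b i := hm i
  have h1 := hG.inverse_mem (b i)
  have h2 := hG.inner_inverse (b i)
  rw [hm] at h1 h2
  rcases eq_or_ne (m i) 0 with h0 | h0
  · rw [h0, zero_smul] at h1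
    have h3 := hG.eq_zero h1
    simp only [h0, inv_zero, zero_smul]
    rw [Submodule.starProjection_apply_eq_zero_iff, Submodule.orthogonal_orthogonal] at h3
    obtain ⟨a, ha⟩ := Submodule.mem_span_singleton.1 h3
    rw [← ha]
    simpa using G.smul_mem a hG.ker
  · rw [inner_smul_right] at h2
    rw [starProjection_of_inner_eq_zero ((mul_eq_zero.1 h2).resolve_left h0)] at h1
    have := G.smul_mem (m i)⁻¹ h1
    simpa [smul_smul, inv_mul_cancel₀ h0] using this

/-- The relation is determined by its action on the coefficients in an eigenbasis. -/
theorem mem_of_repr (hG : HasCompactInverse G φ) {ι : Type*} {b : HilbertBasis ι ℝ H} {l : ι → ℝ}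
    (hb : ∀ i, (b i, l i • b i) ∈ G) {x y : H} (hxy : ∀ i, ⟪b i, y⟫_ℝ = l i * ⟪b i, x⟫_ℝ) :
    (x, y) ∈ G := by
  -- Each basis vector is orthogonal to φ or has eigenvalue 0. Hence y is orthogonal to φ and has a
  -- preimage f.
  have hφ : ∀ i, l i * ⟪b i, φ⟫_ℝ = 0 := fun i => by
    have := hG.symm (hb i) hG.ker
    rwa [inner_zero_right, real_inner_smul_left] at this
  have hy : ⟪φ, y⟫_ℝ = 0 := by
    rw [← b.tsum_inner_mul_inner φ y]
    refine (tsum_congr fun i => ?_).trans tsum_zero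
    rw [hxy, real_inner_comm]
    linear_combination ⟪b i, x⟫_ℝ * hφ i
  obtain ⟨f, hf⟩ := hG.exists_mem hy
  have hz : ∀ i, l i * ⟪b i, f - x⟫_ℝ = 0 := fun i => by
    have := hG.symm (hb i) hf
    rw [real_inner_smul_left, hxy] at this
    rw [inner_sub_right]
    linear_combination this
  -- A vector orthogonal to φ lies in the range, so by symmetry it has no component along
  -- eigenvectors of eigenvalue 0. The coefficients of f - x live only there, so f - x is orthogonal
  -- to everything orthogonal to φ.
  have hker : ∀ v, ⟪φ, v⟫_ℝ = 0 → ∀ i, l i = 0 → ⟪b i, v⟫_ℝ = 0 := fun v hv i hi => by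
    obtain ⟨g, hg⟩ := hG.exists_mem hv
    rw [← hG.symm (hb i) hg, hi, zero_smul, inner_zero_left]
  have hmem : f - x ∈ (ℝ ∙ φ) := by
    rw [← Submodule.orthogonal_orthogonal (ℝ ∙ φ)]
    intro v hv
    rw [Submodule.mem_orthogonal_singleton_iff_inner_right] at hv
    rw [← b.tsum_inner_mul_inner v]
    refine (tsum_congr fun i => ?_).trans tsum_zero
    rcases mul_eq_zero.1 (hz i) with h | h
    · rw [real_inner_comm, hker v hv i h, zero_mul]
    · rw [h, mul_zero]
  obtain ⟨a, ha⟩ := Submodule.mem_span_singleton.1 hmem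
  have := G.sub_mem hf (G.smul_mem a hG.ker)
  rw [Prod.smul_mk, ha] at this
  simpa using this

end HasCompactInverse

end Spectral

/-! ### Uniqueness for generalized Dirichlet series -/

section Dirichlet

open Filter Topology

/-- A generalized Dirichlet series with nonnegative exponents that vanishes on `(0, T)` vanishes on
the whole half-line. -/
theorem dirichlet_eq_zero {ι : Type*} {β l : ι → ℝ} (hβ : Summable β) (hl : ∀ i, 0 ≤ l i)
    {T : ℝ} (hT : 0 < T) (h : ∀ s ∈ Ioo 0 T, ∑' i, β i * Real.exp (-(l i * s)) = 0) {s : ℝ}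
    (hs : 0 < s) : ∑' i, β i * Real.exp (-(l i * s)) = 0 := by
  set U : Set ℂ := {z | 0 < z.re}
  have hU : IsOpen U := isOpen_lt continuous_const Complex.continuous_re
  set F : ℂ → ℂ := fun z => ∑' i, (β i : ℂ) * Complex.exp (-(l i * z)) with hF
  have hd : DifferentiableOn ℂ F U := by
    refine Complex.differentiableOn_tsum_of_summable_norm hβ.abs (fun i => by fun_prop) hU ?_
    intro i w hw
    rw [norm_mul, Complex.norm_exp]
    have : Real.exp (-(l i * w : ℂ)).re ≤ 1 := by
      rw [Real.exp_le_one_iff]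
      have := mul_nonneg (hl i) (le_of_lt (show 0 < w.re from hw))
      simpa using this
    simpa using mul_le_mul_of_nonneg_left this (abs_nonneg (β i))
  have hreal : ∀ t : ℝ, F t = ((∑' i, β i * Real.exp (-(l i * t)) : ℝ) : ℂ) := by
    intro t
    rw [Complex.ofReal_tsum]
    simp [hF]
  have ha : AnalyticOnNhd ℂ F U := hd.analyticOnNhd hU
  have hpre : IsPreconnected U := (convex_halfSpace_re_gt 0).isPreconnected
  -- The zeros on the real segment (0, T) accumulate at T/2, inside the half-plane of holomorphy, so
  -- the identity theorem applies.
  have hfreq : ∃ᶠ z in 𝓝[≠] ((T / 2 : ℝ) : ℂ), F z = 0 := by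
    have h1 : Tendsto (fun t : ℝ => (t : ℂ)) (𝓝[≠] (T / 2)) (𝓝[≠] ((T / 2 : ℝ) : ℂ)) := by
      refine tendsto_nhdsWithin_of_tendsto_nhds_of_eventually_within _
        ((Complex.continuous_ofReal.tendsto _).mono_left nhdsWithin_le_nhds) ?_
      filter_upwards [self_mem_nhdsWithin] with t ht
      exact fun h => ht (Complex.ofReal_injective h)
    refine h1.frequently (Eventually.frequently ?_)
    filter_upwards [nhdsWithin_le_nhds (Ioo_mem_nhds (half_pos hT) (half_lt_self hT))] with t ht
    rw [hreal, h t ht, Complex.ofReal_zero]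
  have := ha.eqOn_zero_of_preconnected_of_frequently_eq_zero hpre
    (show ((T / 2 : ℝ) : ℂ) ∈ U by simpa [U] using hT) hfreq
    (show ((s : ℝ) : ℂ) ∈ U by simpa [U] using hs)
  rw [hreal, Pi.zero_apply] at this
  exact_mod_cast this

/-- The coefficients belonging to one exponent of a vanishing generalized Dirichlet series sum to
zero. -/
theorem dirichlet_coeff_eq_zero {ι : Type*} {β l : ι → ℝ} (hβ : Summable β) {m : ℝ}
    (hl : ∀ i, -m ≤ l i) {T : ℝ} (hT : 0 < T)
    (h : ∀ s ∈ Ioo 0 T, ∑' i, β i * Real.exp (-(l i * s)) = 0) (v : ℝ) :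
    ∑' i, (if l i = v then β i else 0) = 0 := by
  -- Shifting the exponents by m makes them nonnegative; sampling at s = k + 1 then gives the
  -- vanishing of all positive moments in yᵢ = exp(-(lᵢ + m)) ∈ (0, 1].
  have hy : ∀ k : ℕ, ∑' i, β i * Real.exp (-(l i + m)) ^ (k + 1) = 0 := by
    intro k
    have := dirichlet_eq_zero (l := fun i => l i + m) hβ (fun i => by linarith [hl i]) hT
      (fun s hs => ?_) (s := (k + 1 : ℕ)) (by positivity)
    · rw [← this]
      refine tsum_congr fun i => ?_
      rw [← Real.exp_nat_mul]
      congr 2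
      ring
    · have e : ∀ i, β i * Real.exp (-((l i + m) * s))
          = Real.exp (-(m * s)) * (β i * Real.exp (-(l i * s))) := fun i => by
        rw [show -((l i + m) * s) = -(m * s) + -(l i * s) by ring, Real.exp_add]; ring
      simp_rw [e, tsum_mul_left, h s hs, mul_zero]
  have hy0 : ∀ i, 0 < Real.exp (-(l i + m)) := fun i => Real.exp_pos _
  have hy1 : ∀ i, Real.exp (-(l i + m)) ≤ 1 := fun i => by
    rw [Real.exp_le_one_iff]; linarith [hl i]
  have hpoly : ∀ p : Polynomial ℝ, p.coeff 0 = 0 →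
      ∑' i, β i * p.eval (Real.exp (-(l i + m))) = 0 := by
    intro p hp
    have e : ∀ i, β i * p.eval (Real.exp (-(l i + m))) = ∑ j ∈ Finset.range p.natDegree,
        p.coeff (j + 1) * (β i * Real.exp (-(l i + m)) ^ (j + 1)) := fun i => by
      rw [Polynomial.eval_eq_sum_range, Finset.sum_range_succ', hp, zero_mul, add_zero,
        Finset.mul_sum]
      exact Finset.sum_congr rfl fun j _ => by ring
    simp_rw [e]
    rw [Summable.tsum_finsetSum]
    · exact Finset.sum_eq_zero fun j _ => by rw [tsum_mul_left, hy, mul_zero]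
    · intro j _
      refine Summable.mul_left _ (hβ.abs.of_norm_bounded fun i => ?_)
      rw [norm_mul, Real.norm_eq_abs, Real.norm_of_nonneg (pow_nonneg (hy0 i).le _)]
      exact mul_le_of_le_one_right (abs_nonneg _) (pow_le_one₀ (hy0 i).le (hy1 i))
  rcases lt_or_ge v (-m) with hv | hv
  · refine (tsum_congr fun i => ?_).trans tsum_zero
    rw [if_neg (by linarith [hl i])]
  set y := Real.exp (-(v + m)) with hyd
  have y0 : 0 < y := Real.exp_pos _
  have y1 : y ≤ 1 := by rw [hyd, Real.exp_le_one_iff]; linarith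
  -- Polynomials that isolate yᵢ = y: (1 - (Y - y)²)^k tends to 1 at Y = y and to 0 elsewhere on (0,
  -- 1], while the subtracted constant, which tends to 0, removes the constant term that the moments
  -- do not control. All are bounded by 2 there.
  have hlim : Tendsto (fun k : ℕ => ∑' i, β i * ((1 - (Real.exp (-(l i + m)) - y) ^ 2) ^ k
      - (1 - y ^ 2) ^ k)) atTop (𝓝 (∑' i, (if l i = v then β i else 0))) := by
    have c1 : 0 ≤ 1 - y ^ 2 := by nlinarith
    refine tendsto_tsum_of_dominated_convergence (bound := fun i => |β i| * 2)
      (hβ.abs.mul_right 2) (fun i => ?_) (Eventually.of_forall fun k i => ?_)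
    · have t2 : Tendsto (fun k : ℕ => (1 - y ^ 2) ^ k) atTop (𝓝 0) :=
        tendsto_pow_atTop_nhds_zero_of_lt_one c1 (by nlinarith)
      by_cases hi : l i = v
      · rw [if_pos hi, hi, ← hyd]
        simpa using (tendsto_const_nhds (x := β i)).mul ((tendsto_const_nhds (x := (1 : ℝ))).sub t2)
      · rw [if_neg hi]
        have hne : Real.exp (-(l i + m)) - y ≠ 0 := by
          rw [sub_ne_zero, hyd, Ne, Real.exp_eq_exp]
          intro h; exact hi (by linarith)
        have t1 : Tendsto (fun k : ℕ => (1 - (Real.exp (-(l i + m)) - y) ^ 2) ^ k) atTop (𝓝 0) := by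
          refine tendsto_pow_atTop_nhds_zero_of_lt_one ?_ ?_
          · nlinarith [hy0 i, hy1 i]
          · have := sq_pos_of_ne_zero hne
            linarith
        simpa using (tendsto_const_nhds (x := β i)).mul (t1.sub t2)
    · have c2 : 0 ≤ 1 - (Real.exp (-(l i + m)) - y) ^ 2 := by nlinarith [hy0 i, hy1 i]
      rw [norm_mul, Real.norm_eq_abs, Real.norm_eq_abs]
      refine mul_le_mul_of_nonneg_left ?_ (abs_nonneg _)
      have a1 := pow_nonneg c2 k
      have a2 := pow_nonneg c1 k
      have a3 : (1 - (Real.exp (-(l i + m)) - y) ^ 2) ^ k ≤ 1 :=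
        pow_le_one₀ c2 (by nlinarith [sq_nonneg (Real.exp (-(l i + m)) - y)])
      have a4 : (1 - y ^ 2) ^ k ≤ 1 := pow_le_one₀ c1 (by nlinarith)
      rw [abs_le]; constructor <;> linarith
  have hzero : ∀ k : ℕ, ∑' i, β i * ((1 - (Real.exp (-(l i + m)) - y) ^ 2) ^ k
      - (1 - y ^ 2) ^ k) = 0 := by
    intro k
    have := hpoly ((1 - (Polynomial.X - Polynomial.C y) ^ 2) ^ k - Polynomial.C ((1 - y ^ 2) ^ k))
      (by rw [Polynomial.coeff_zero_eq_eval_zero]; simp)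
    simpa using this
  simp_rw [hzero] at hlim
  exact tendsto_nhds_unique hlim tendsto_const_nhds |>.trans rfl

end Dirichlet

/-! ### Diagonal operators in a Hilbert basis -/

section Diagonal

open Filter Topology
open scoped InnerProductSpace

variable {H ι : Type*} [NormedAddCommGroup H] [InnerProductSpace ℝ H] (b : HilbertBasis ι ℝ H)

theorem hasSum_sq_inner (x : H) : HasSum (fun i => ⟪b i, x⟫_ℝ ^ 2) (‖x‖ ^ 2) := by
  have := b.hasSum_inner_mul_inner x x
  rw [real_inner_self_eq_norm_sq] at this
  refine this.congr_fun fun i => ?_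
  rw [real_inner_comm x, sq]

theorem ext_inner_hilbertBasis {x y : H} (h : ∀ i, ⟪b i, x⟫_ℝ = ⟪b i, y⟫_ℝ) : x = y := by
  rw [← sub_eq_zero, ← norm_eq_zero, ← sq_eq_zero_iff]
  refine (hasSum_sq_inner b (x - y)).unique ?_
  simp_rw [inner_sub_right, h, sub_self]
  simp

theorem exists_inner_eq {a : ι → ℝ} (ha : Summable fun i => a i ^ 2) :
    ∃ y : H, ∀ i, ⟪b i, y⟫_ℝ = a i := by
  have hm : Memℓp a 2 := by
    refine memℓp_gen ?_
    simpa using ha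
  refine ⟨b.repr.symm ⟨a, hm⟩, fun i => ?_⟩
  rw [← b.repr_apply_apply]
  simp

/-- Bounded multipliers of the coefficients are bounded operators. -/
theorem exists_diagonal {a : ι → ℝ} {C : ℝ} (ha : ∀ i, |a i| ≤ C) :
    ∃ D : H →L[ℝ] H, ∀ x i, ⟪b i, D x⟫_ℝ = a i * ⟪b i, x⟫_ℝ := by
  have hle : ∀ x i, (a i * ⟪b i, x⟫_ℝ) ^ 2 ≤ C ^ 2 * ⟪b i, x⟫_ℝ ^ 2 := fun x i => by
    rw [mul_pow, ← sq_abs (a i)]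
    gcongr
    exact ha i
  have hex : ∀ x : H, ∃ y : H, ∀ i, ⟪b i, y⟫_ℝ = a i * ⟪b i, x⟫_ℝ := fun x =>
    exists_inner_eq b <| ((hasSum_sq_inner b x).summable.mul_left (C ^ 2)).of_nonneg_of_le
      (fun i => sq_nonneg _) (hle x)
  choose D hD using hex
  -- Only an actual index forces C to be nonnegative, as the operator bound requires.
  rcases isEmpty_or_nonempty ι with hι | ⟨⟨i₀⟩⟩
  · exact ⟨0, fun x i => isEmptyElim i⟩
  have hC : 0 ≤ C := (abs_nonneg _).trans (ha i₀)
  refine ⟨LinearMap.mkContinuous ⟨⟨D, fun x y => ?_⟩, fun r x => ?_⟩ C fun x => ?_, hD⟩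
  · refine ext_inner_hilbertBasis b fun i => ?_
    rw [inner_add_right, hD, hD, hD, inner_add_right, mul_add]
  · refine ext_inner_hilbertBasis b fun i => ?_
    simp only [RingHom.id_apply, real_inner_smul_right, hD]
    ring
  · refine abs_le_of_sq_le_sq' ?_ (mul_nonneg hC (norm_nonneg _)) |>.2
    rw [mul_pow]
    refine hasSum_le (fun i => ?_) (hasSum_sq_inner b (D x))
      ((hasSum_sq_inner b x).mul_left (C ^ 2))
    rw [hD]
    exact hle x i

/-- Dominated convergence in coefficients. -/
theorem tendsto_of_inner {β : Type*} {F : Filter β} {y : β → H} {y₀ x : H} {C : ℝ}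
    (hC : ∀ᶠ t in F, ∀ i, |⟪b i, y t⟫_ℝ - ⟪b i, y₀⟫_ℝ| ≤ C * |⟪b i, x⟫_ℝ|)
    (hy : ∀ i, Tendsto (fun t => ⟪b i, y t⟫_ℝ) F (𝓝 ⟪b i, y₀⟫_ℝ)) : Tendsto y F (𝓝 y₀) := by
  rw [tendsto_iff_norm_sub_tendsto_zero]
  have key : Tendsto (fun t => ∑' i, ⟪b i, y t - y₀⟫_ℝ ^ 2) F (𝓝 (∑' _ : ι, (0 : ℝ))) := by
    refine tendsto_tsum_of_dominated_convergence (bound := fun i => C ^ 2 * ⟪b i, x⟫_ℝ ^ 2)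
      ((hasSum_sq_inner b x).summable.mul_left _) (fun i => ?_) ?_
    · have := ((hy i).sub_const ⟪b i, y₀⟫_ℝ).pow 2
      simpa [inner_sub_right] using this
    · filter_upwards [hC] with t ht i
      rw [Real.norm_of_nonneg (sq_nonneg _), inner_sub_right, ← sq_abs (⟪b i, y t⟫_ℝ - _),
        ← sq_abs ⟪b i, x⟫_ℝ, ← mul_pow]
      gcongr
      exact ht i
  simp_rw [(hasSum_sq_inner b _).tsum_eq, tsum_zero] at key
  have := key.sqrt
  simpa using this

end Diagonal

/-! ### The diagonal semigroup and its orbits -/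

section Semigroup

open Filter Topology
open scoped InnerProductSpace

variable {H ι : Type*} [NormedAddCommGroup H] [InnerProductSpace ℝ H] (b : HilbertBasis ι ℝ H)

/-- The bound does not depend on l: for l ≥ 0 it is y e^{-y} ≤ 1 together with s ≥ t/2, and for l <
0 it is |l| ≤ m together with s ≤ 2t. This parabolic smoothing dominates all coefficients at once
when an orbit is differentiated at a positive time. -/
theorem abs_mul_exp_le {l m t s : ℝ} (hl : -m ≤ l) (hm : 0 ≤ m) (ht : 0 < t)
    (hs : s ∈ Icc (t / 2) (2 * t)) :
    |l * Real.exp (-(l * s))| ≤ 2 / t + m * Real.exp (2 * m * t) := by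
  have hs0 : 0 < s := by linarith [hs.1]
  have p1 : 0 ≤ 2 / t := by positivity
  have p2 : 0 ≤ m * Real.exp (2 * m * t) := by positivity
  rw [abs_mul, abs_of_pos (Real.exp_pos _)]
  rcases le_or_gt 0 l with h | h
  · rw [abs_of_nonneg h]
    have h1 : l * s * Real.exp (-(l * s)) ≤ 1 := by
      have := Real.add_one_le_exp (l * s)
      rw [Real.exp_neg, ← div_eq_mul_inv, div_le_one (Real.exp_pos _)]
      linarith
    have h2 : l * Real.exp (-(l * s)) ≤ 2 / t := by
      rw [le_div_iff₀ ht]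
      have h3 : 0 ≤ l * Real.exp (-(l * s)) := by positivity
      nlinarith [hs.1]
    linarith
  · have h1 : |l| ≤ m := by rw [abs_of_neg h]; linarith
    have h2 : Real.exp (-(l * s)) ≤ Real.exp (2 * m * t) := by
      rw [Real.exp_le_exp]
      nlinarith [hs.2]
    have : |l| * Real.exp (-(l * s)) ≤ m * Real.exp (2 * m * t) :=
      mul_le_mul h1 h2 (Real.exp_pos _).le hm
    linarith

theorem abs_exp_sub_le {l m t s : ℝ} (hl : -m ≤ l) (hm : 0 ≤ m) (ht : 0 < t)
    (hs : s ∈ Icc (t / 2) (2 * t)) :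
    |Real.exp (-(l * s)) - Real.exp (-(l * t))| ≤
      (2 / t + m * Real.exp (2 * m * t)) * |s - t| := by
  have := (convex_Icc (t / 2) (2 * t)).norm_image_sub_le_of_norm_hasDerivWithin_le
    (f := fun s => Real.exp (-(l * s))) (f' := fun s => -(l * Real.exp (-(l * s))))
    (C := 2 / t + m * Real.exp (2 * m * t)) (x := t) (y := s)
    (fun x _ => ?_) (fun x hx => ?_) ⟨by linarith, by linarith⟩ hs
  · simpa using this
  · have h := ((hasDerivAt_id x).const_mul l).neg.exp
    refine (h.congr_deriv ?_).hasDerivWithinAt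
    simp [mul_comm]
  · rw [norm_neg]
    exact abs_mul_exp_le hl hm ht hx

variable {l : ι → ℝ} {m : ℝ}

/-- The semigroup with coefficients `exp (-l i * t)`; it is only used for `0 ≤ t`. -/
theorem exists_diagonal_semigroup (hl : ∀ i, -m ≤ l i) :
    ∃ S : ℝ → H →L[ℝ] H, ∀ t, 0 ≤ t → ∀ x i, ⟪b i, S t x⟫_ℝ = Real.exp (-(l i * t)) * ⟪b i, x⟫_ℝ := by
  have : ∀ t : ℝ, ∃ D : H →L[ℝ] H, 0 ≤ t →
      ∀ x i, ⟪b i, D x⟫_ℝ = Real.exp (-(l i * t)) * ⟪b i, x⟫_ℝ := by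
    intro t
    by_cases ht : 0 ≤ t
    · obtain ⟨D, hD⟩ := exists_diagonal b (a := fun i => Real.exp (-(l i * t)))
        (C := Real.exp (m * t)) (fun i => by
          rw [abs_of_pos (Real.exp_pos _), Real.exp_le_exp]
          nlinarith [hl i])
      exact ⟨D, fun _ => hD⟩
    · exact ⟨0, fun h => absurd h ht⟩
  choose S hS using this
  exact ⟨S, hS⟩

variable {S : ℝ → H →L[ℝ] H}

theorem continuousOn_diagonal_semigroup (hl : ∀ i, -m ≤ l i) (hm : 0 ≤ m)
    (hS : ∀ t, 0 ≤ t → ∀ x i, ⟪b i, S t x⟫_ℝ = Real.exp (-(l i * t)) * ⟪b i, x⟫_ℝ) (x : H) :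
    ContinuousOn (fun t => S t x) (Ici 0) := by
  intro t ht
  have hb : ∀ s ∈ Icc 0 (t + 1), ∀ i, Real.exp (-(l i * s)) ≤ Real.exp (m * (t + 1)) := by
    intro s hs i
    rw [Real.exp_le_exp]
    nlinarith [hl i, hs.1, hs.2]
  refine tendsto_of_inner b (x := x) (C := 2 * Real.exp (m * (t + 1))) ?_ fun i => ?_
  · filter_upwards [self_mem_nhdsWithin, nhdsWithin_le_nhds (Iio_mem_nhds (lt_add_one t))]
      with s hs hs' i
    rw [hS s hs, hS t ht, ← sub_mul, abs_mul]
    refine mul_le_mul_of_nonneg_right ?_ (abs_nonneg _)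
    have h1 := hb s ⟨hs, le_of_lt hs'⟩ i
    have h2 := hb t ⟨ht, by linarith⟩ i
    have h3 := Real.exp_pos (-(l i * s))
    have h4 := Real.exp_pos (-(l i * t))
    rw [abs_le]; constructor <;> linarith
  · rw [hS t ht]
    have : Tendsto (fun s => Real.exp (-(l i * s)) * ⟪b i, x⟫_ℝ) (𝓝[Ici 0] t)
        (𝓝 (Real.exp (-(l i * t)) * ⟪b i, x⟫_ℝ)) :=
      (Continuous.tendsto (by fun_prop) t).mono_left nhdsWithin_le_nhds
    refine this.congr' ?_
    filter_upwards [self_mem_nhdsWithin] with s hs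
    rw [hS s hs]

/-- The orbits of the diagonal semigroup are differentiable at positive times. -/
theorem exists_generator_diagonal_semigroup (hl : ∀ i, -m ≤ l i) (hm : 0 ≤ m)
    (hS : ∀ t, 0 ≤ t → ∀ x i, ⟪b i, S t x⟫_ℝ = Real.exp (-(l i * t)) * ⟪b i, x⟫_ℝ) (x : H) :
    ∃ h : ℝ → H, ContinuousOn h (Ioi 0) ∧ ∀ t, 0 < t →
      (∀ i, ⟪b i, h t⟫_ℝ = l i * ⟪b i, S t x⟫_ℝ) ∧ HasDerivAt (fun t => S t x) (-h t) t := by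
  -- At t > 0 the multipliers l e^{-lt} are bounded, so A e^{-tA} is a bounded diagonal operator.
  have hex : ∀ t : ℝ, ∃ y : H, 0 < t → ∀ i, ⟪b i, y⟫_ℝ = l i * Real.exp (-(l i * t)) * ⟪b i, x⟫_ℝ := by
    intro t
    by_cases ht : 0 < t
    · obtain ⟨D, hD⟩ := exists_diagonal b (a := fun i => l i * Real.exp (-(l i * t)))
        (fun i => abs_mul_exp_le (hl i) hm ht ⟨by linarith, by linarith⟩)
      exact ⟨D x, fun _ => hD x⟩
    · exact ⟨0, fun h => absurd h ht⟩
  choose h hh using hex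
  have hnear : ∀ t : ℝ, 0 < t → ∀ᶠ s in 𝓝 t, s ∈ Icc (t / 2) (2 * t) := fun t ht =>
    Icc_mem_nhds (by linarith) (by linarith)
  refine ⟨h, fun t ht => ContinuousAt.continuousWithinAt ?_, fun t ht => ⟨fun i => ?_, ?_⟩⟩
  · have ht : 0 < t := ht
    refine tendsto_of_inner b (x := x) (C := 2 * (2 / t + m * Real.exp (2 * m * t))) ?_ fun i => ?_
    · filter_upwards [hnear t ht] with s hs i
      rw [hh s (by linarith [hs.1]), hh t ht, ← sub_mul, abs_mul]
      refine mul_le_mul_of_nonneg_right ?_ (abs_nonneg _)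
      have h1 := abs_mul_exp_le (hl i) hm ht hs
      have h2 := abs_mul_exp_le (hl i) hm ht (s := t) ⟨by linarith, by linarith⟩
      exact (abs_sub _ _).trans (by linarith)
    · rw [hh t ht]
      have : Tendsto (fun s => l i * Real.exp (-(l i * s)) * ⟪b i, x⟫_ℝ) (𝓝 t)
          (𝓝 (l i * Real.exp (-(l i * t)) * ⟪b i, x⟫_ℝ)) :=
        Continuous.tendsto (by fun_prop) t
      refine this.congr' ?_
      filter_upwards [hnear t ht] with s hs
      rw [hh s (by linarith [hs.1])]
  · rw [hh t ht, hS t ht.le]; ring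
  -- Dominated convergence of the difference quotients: the mean value bound `abs_exp_sub_le` is
  -- uniform in i.
  · rw [hasDerivAt_iff_tendsto_slope]
    refine tendsto_of_inner b (x := x) (C := 2 * (2 / t + m * Real.exp (2 * m * t))) ?_ fun i => ?_
    · filter_upwards [nhdsWithin_le_nhds (hnear t ht), self_mem_nhdsWithin] with s hs hst i
      have hst : s - t ≠ 0 := sub_ne_zero.2 hst
      rw [slope, vsub_eq_sub, inner_smul_right, inner_sub_right, hS s (by linarith [hs.1]),
        hS t ht.le, inner_neg_right, hh t ht, ← sub_mul, ← mul_assoc,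
        sub_neg_eq_add, ← add_mul, abs_mul]
      refine mul_le_mul_of_nonneg_right ?_ (abs_nonneg _)
      have h1 : |(s - t)⁻¹ * (Real.exp (-(l i * s)) - Real.exp (-(l i * t)))|
          ≤ 2 / t + m * Real.exp (2 * m * t) := by
        rw [abs_mul, abs_inv, inv_mul_le_iff₀ (abs_pos.2 hst), mul_comm |s - t|]
        exact abs_exp_sub_le (hl i) hm ht hs
      have h2 := abs_mul_exp_le (hl i) hm ht (s := t) ⟨by linarith, by linarith⟩
      exact (abs_add_le _ _).trans (by linarith)
    · have hd : HasDerivAt (fun s => Real.exp (-(l i * s)) * ⟪b i, x⟫_ℝ) ⟪b i, -h t⟫_ℝ t := by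
        have h1 := (((hasDerivAt_id t).const_mul (l i)).neg.exp).mul_const ⟪b i, x⟫_ℝ
        refine h1.congr_deriv ?_
        rw [inner_neg_right, hh t ht]
        simp only [Pi.neg_apply, id]
        ring
      refine (hasDerivAt_iff_tendsto_slope.1 hd).congr' ?_
      filter_upwards [nhdsWithin_le_nhds (hnear t ht)] with s hs
      rw [slope, slope, vsub_eq_sub, vsub_eq_sub, inner_smul_right, inner_sub_right,
        hS s (by linarith [hs.1]), hS t ht.le, smul_eq_mul]

/-- A solution of `f' = -h` with `⟪e, h⟫ = l ⟪e, f⟫` has the coefficient `exp (-l t) ⟪e, f 0⟫`. -/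
theorem inner_eq_exp_mul {f h : ℝ → H} {e : H} {v : ℝ} (hf : ContinuousOn f (Ici 0))
    (hd : ∀ t, 0 < t → HasDerivAt f (-h t) t) (he : ∀ t, 0 < t → ⟪e, h t⟫_ℝ = v * ⟪e, f t⟫_ℝ)
    {t : ℝ} (ht : 0 ≤ t) : ⟪e, f t⟫_ℝ = Real.exp (-(v * t)) * ⟪e, f 0⟫_ℝ := by
  have hc : ContinuousOn (fun t => Real.exp (v * t) * ⟪e, f t⟫_ℝ) (Ici 0) :=
    (by fun_prop : Continuous fun t => Real.exp (v * t)).continuousOn.mul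
      (continuousOn_const.inner hf)
  -- Multiplying the coefficient by exp(v t) gives a function with zero derivative on (0, ∞),
  -- continuous at 0, hence constant.
  have hder : ∀ t, 0 < t → HasDerivAt (fun t => Real.exp (v * t) * ⟪e, f t⟫_ℝ) 0 t := by
    intro t ht
    have h1 : HasDerivAt (fun t => ⟪e, f t⟫_ℝ) ⟪e, -h t⟫_ℝ t :=
      (innerSL ℝ e).hasFDerivAt.comp_hasDerivAt t (hd t ht)
    have h2 := (((hasDerivAt_id t).const_mul v).exp).mul h1
    refine h2.congr_deriv ?_
    rw [inner_neg_right, he t ht]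
    simp; ring
  have h1 := (monotoneOn_of_deriv_nonneg (convex_Ici 0) hc
    (fun s hs => (hder s (by simpa using hs)).differentiableAt.differentiableWithinAt)
    (fun s hs => (hder s (by simpa using hs)).deriv.ge)) self_mem_Ici ht ht
  have h2 := (antitoneOn_of_deriv_nonpos (convex_Ici 0) hc
    (fun s hs => (hder s (by simpa using hs)).differentiableAt.differentiableWithinAt)
    (fun s hs => (hder s (by simpa using hs)).deriv.le)) self_mem_Ici ht ht
  have h3 := le_antisymm h1 h2
  simp only [mul_zero, Real.exp_zero, one_mul] at h3
  rw [h3, ← mul_assoc, ← Real.exp_add]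
  simp

/-- Unique continuation of eigenvectors through `Q` implies unique continuation of orbits. -/
theorem eq_zero_of_orbit {G : Submodule ℝ (H × H)} {φ : H} (hG : HasCompactInverse G φ)
    (hb : ∀ i, (b i, l i • b i) ∈ G) (hl : ∀ i, -m ≤ l i)
    (hS : ∀ t, 0 ≤ t → ∀ x i, ⟪b i, S t x⟫_ℝ = Real.exp (-(l i * t)) * ⟪b i, x⟫_ℝ)
    {Q : H → H} (huc : ∀ (v : ℝ) (x : H), (x, v • x) ∈ G → (∀ w, ⟪Q w, x⟫_ℝ = 0) → x = 0)
    {T : ℝ} (hT : 0 < T) {g : H} (hg : ∀ w, ∀ s ∈ Ioo 0 T, ⟪S s (Q w), g⟫_ℝ = 0) : g = 0 := by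
  refine ext_inner_hilbertBasis b fun j => ?_
  rw [inner_zero_right]
  -- D is the projection onto the eigenspace of l j, so D g is an eigenvector (or zero) to which
  -- unique continuation applies.
  obtain ⟨D, hD⟩ := exists_diagonal b (a := fun i => if l i = l j then (1 : ℝ) else 0) (C := 1)
    (fun i => by split_ifs <;> simp)
  have h0 : D g = 0 := by
    refine huc (l j) (D g) (hG.mem_of_repr hb fun i => ?_) fun w => ?_
    · rw [real_inner_smul_right, hD]
      split_ifs with h
      · rw [h]
      · simp
    -- The pairing of the orbit of Q w with g is a Dirichlet series whose total coefficient at the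
    -- exponent l j is ⟨Q w, D g⟩.
    · have h1 := dirichlet_coeff_eq_zero (β := fun i => ⟪Q w, b i⟫_ℝ * ⟪b i, g⟫_ℝ)
        (b.summable_inner_mul_inner (Q w) g) hl hT (fun s hs => ?_) (l j)
      · rw [← b.tsum_inner_mul_inner, ← h1]
        refine tsum_congr fun i => ?_
        rw [hD]
        split_ifs <;> simp
      · rw [← hg w s hs, ← b.tsum_inner_mul_inner]
        refine tsum_congr fun i => ?_
        rw [real_inner_comm (b i) (S s (Q w)), hS s hs.1.le, real_inner_comm (b i) (Q w)]
        ring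
  have := hD g j
  rw [h0, inner_zero_right, if_pos rfl, one_mul] at this
  exact this.symm

end Semigroup

/-! ### Weak derivatives as primitives -/

section WeakDerivative

open Filter Topology

/-- The fundamental theorem of calculus for an absolutely continuous function whose derivative is
known almost everywhere. -/
theorem integral_eq_sub_of_ae_hasDerivAt {f g : ℝ → ℝ} {a b : ℝ}
    (hf : AbsolutelyContinuousOnInterval f a b)
    (hg : ∀ᵐ x, x ∈ uIoc a b → HasDerivAt f (g x) x) : ∫ x in a..b, g x = f b - f a := by
  rw [← hf.integral_deriv_eq_sub]
  refine intervalIntegral.integral_congr_ae ?_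
  filter_upwards [hg] with x hx hxab
  exact (hx hxab).deriv.symm

theorem eq_zero_of_tsupport_subset {φ : ℝ → ℝ} {s : Set ℝ} (h : tsupport φ ⊆ s) {x : ℝ}
    (hx : x ∉ s) : φ x = 0 :=
  image_eq_zero_of_notMem_tsupport fun hx' => hx (h hx')

theorem integral_Ioo_eq_interval (f : ℝ → ℝ) :
    ∫ x in Ioo (-1 : ℝ) 1, f x = ∫ x in (-1 : ℝ)..1, f x := by
  rw [intervalIntegral.integral_of_le (by norm_num), integral_Ioc_eq_integral_Ioo]

/-- A primitive of an integrable function has it as its weak derivative. -/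
theorem isWeakDeriv_primitive {f g : ℝ → ℝ} (hg : IntervalIntegrable g volume (-1) 1) (a : ℝ)
    (hf : ∀ x ∈ Icc (-1 : ℝ) 1, f x = a + ∫ s in (0 : ℝ)..x, g s) : IsWeakDeriv f g := by
  intro φ hφ hc hs
  have hP : AbsolutelyContinuousOnInterval (fun x => ∫ s in (0 : ℝ)..x, g s) (-1) 1 :=
    hg.absolutelyContinuousOnInterval_intervalIntegral (by rw [uIcc_of_le] <;> norm_num)
  have hφ1 : ContDiff ℝ 1 φ := hφ.of_le (by exact_mod_cast le_top)
  have hφac : AbsolutelyContinuousOnInterval φ (-1) 1 :=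
    hφ1.contDiffOn.absolutelyContinuousOnInterval
  have z1 : φ 1 = 0 := eq_zero_of_tsupport_subset hs (by simp)
  have z2 : φ (-1) = 0 := eq_zero_of_tsupport_subset hs (by simp)
  have hd : Continuous (deriv φ) := hφ1.continuous_deriv le_rfl
  have key := hP.integral_mul_deriv_eq_deriv_mul hφac
  rw [z1, z2, mul_zero, mul_zero, sub_zero, zero_sub] at key
  have key2 : ∫ x in (-1 : ℝ)..1, deriv φ x = 0 := by
    rw [hφac.integral_deriv_eq_sub, z1, z2, sub_zero]
  rw [integral_Ioo_eq_interval, integral_Ioo_eq_interval]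
  have e1 : ∫ x in (-1 : ℝ)..1, f x * deriv φ x
      = ∫ x in (-1 : ℝ)..1, (a * deriv φ x + (∫ s in (0 : ℝ)..x, g s) * deriv φ x) := by
    refine intervalIntegral.integral_congr fun x hx => ?_
    rw [uIcc_of_le (by norm_num)] at hx
    simp only [hf x hx, add_mul]
  have e2 : ∫ x in (-1 : ℝ)..1, deriv (fun x => ∫ s in (0 : ℝ)..x, g s) x * φ x
      = ∫ x in (-1 : ℝ)..1, g x * φ x := by
    refine intervalIntegral.integral_congr_ae ?_
    filter_upwards [hg.ae_hasDerivAt_integral] with x hx hx'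
    rw [(hx (uIoc_subset_uIcc hx') 0 (by rw [uIcc_of_le] <;> norm_num)).deriv]
  rw [e1, intervalIntegral.integral_add, intervalIntegral.integral_const_mul, key2, key, e2]
  · simp
  · exact (hd.intervalIntegrable _ _).const_mul _
  · exact (hd.intervalIntegrable _ _).continuousOn_mul hP.continuousOn

/-- A test function of zero mean is the derivative of a test function. -/
theorem exists_test_primitive {χ : ℝ → ℝ} (hχ : ContDiff ℝ ((⊤ : ℕ∞) : WithTop ℕ∞) χ)
    (hc : HasCompactSupport χ) (hs : tsupport χ ⊆ Ioo (-1 : ℝ) 1)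
    (h0 : ∫ x in (-1 : ℝ)..1, χ x = 0) :
    ∃ ψ : ℝ → ℝ, ContDiff ℝ ((⊤ : ℕ∞) : WithTop ℕ∞) ψ ∧ HasCompactSupport ψ ∧
      tsupport ψ ⊆ Ioo (-1 : ℝ) 1 ∧ deriv ψ = χ := by
  set ψ : ℝ → ℝ := fun x => ∫ s in (-1 : ℝ)..x, χ s with hψ
  have hd : ∀ x, HasDerivAt ψ (χ x) x := fun x =>
    hχ.continuous.integral_hasStrictDerivAt (-1) x |>.hasDerivAt
  have hder : deriv ψ = χ := funext fun x => (hd x).deriv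
  obtain ⟨a, ha, b, hb, hab⟩ : ∃ a > (-1 : ℝ), ∃ b < (1 : ℝ), tsupport χ ⊆ Icc a b := by
    rcases (tsupport χ).eq_empty_or_nonempty with he | hne
    · exact ⟨0, by norm_num, 0, by norm_num, by simp [he]⟩
    · obtain ⟨a, ha, ha'⟩ := hc.isCompact.exists_isLeast hne
      obtain ⟨b, hb, hb'⟩ := hc.isCompact.exists_isGreatest hne
      exact ⟨a, (hs ha).1, b, (hs hb).2, fun x hx => ⟨ha' hx, hb' hx⟩⟩
  have hz : ∀ x, x ∉ Icc a b → χ x = 0 := fun x hx => eq_zero_of_tsupport_subset hab hx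
  have hψz : ∀ x, x ∉ Icc a b → ψ x = 0 := by
    intro x hx
    rcases lt_or_ge x a with h | h
    · rw [hψ]
      refine (intervalIntegral.integral_congr (g := fun _ => 0) fun s hs' => hz s ?_).trans (by simp)
      intro hs''
      rcases hs' with ⟨_, h2⟩
      rcases le_max_iff.1 h2 with h3 | h3 <;> linarith [hs''.1]
    · have hxb : b < x := by
        by_contra h'
        exact hx ⟨h, not_lt.1 h'⟩
      have : ∫ s in x..1, χ s = 0 := by
        refine (intervalIntegral.integral_congr (g := fun _ => 0) fun s hs' => hz s ?_).trans (by simp)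
        intro hs''
        rcases hs' with ⟨h1, _⟩
        rcases min_le_iff.1 h1 with h3 | h3 <;> linarith [hs''.2]
      have h2 := intervalIntegral.integral_add_adjacent_intervals
        (hχ.continuous.intervalIntegrable (μ := volume) (-1) x)
        (hχ.continuous.intervalIntegrable (μ := volume) x 1)
      rw [this, h0, add_zero] at h2
      exact h2
  have hsub : tsupport ψ ⊆ Icc a b :=
    closure_minimal (fun x hx => by_contra fun h => hx (hψz x h)) isClosed_Icc
  refine ⟨ψ, ?_, HasCompactSupport.of_support_subset_isCompact isCompact_Icc
    (subset_closure.trans hsub), hsub.trans (Icc_subset_Ioo ha hb), hder⟩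
  rw [contDiff_infty_iff_deriv, hder]
  exact ⟨fun x => (hd x).differentiableAt, hχ⟩

/-- A continuous function whose weak derivative vanishes is constant. -/
theorem eq_const_of_isWeakDeriv_zero {F : ℝ → ℝ} (hF : ContinuousOn F (Icc (-1) 1))
    (h : IsWeakDeriv F 0) : ∀ x ∈ Icc (-1 : ℝ) 1, F x = F 0 := by
  let η : ContDiffBump (0 : ℝ) := ⟨1 / 4, 1 / 2, by norm_num, by norm_num⟩
  have hη : ContDiff ℝ ((⊤ : ℕ∞) : WithTop ℕ∞) (η.normed volume) := η.contDiff_normed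
  have hηs : tsupport (η.normed volume) ⊆ Ioo (-1 : ℝ) 1 := by
    rw [η.tsupport_normed_eq]
    intro x hx
    rw [Metric.mem_closedBall, dist_zero_right, Real.norm_eq_abs, abs_le] at hx
    have hr : η.rOut < 1 := (by norm_num : (1 / 2 : ℝ) < 1)
    exact ⟨by linarith [hx.1], by linarith [hx.2]⟩
  have hfull : ∀ φ : ℝ → ℝ, tsupport φ ⊆ Ioo (-1 : ℝ) 1 →
      ∫ x in Ioo (-1 : ℝ) 1, φ x = ∫ x, φ x := fun φ hφ =>
    setIntegral_eq_integral_of_forall_compl_eq_zero fun x hx => eq_zero_of_tsupport_subset hφ hx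
  have hη1 : ∫ x in (-1 : ℝ)..1, η.normed volume x = 1 := by
    rw [← integral_Ioo_eq_interval, hfull _ hηs, η.integral_normed]
  -- The weighted mean of F against the unit-mass bump is the candidate for the constant value.
  set k := ∫ x in (-1 : ℝ)..1, F x * η.normed volume x
  have hFi : ∀ φ : ℝ → ℝ, Continuous φ →
      IntervalIntegrable (fun x => F x * φ x) volume (-1) 1 := fun φ hφ => by
    refine ContinuousOn.intervalIntegrable ?_
    rw [uIcc_of_le (by norm_num)]
    exact hF.mul hφ.continuousOn
  have hae : ∀ᵐ x, x ∈ Ioo (-1 : ℝ) 1 → F x - k = 0 := by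
    refine isOpen_Ioo.ae_eq_zero_of_integral_contDiff_smul_eq_zero ?_ fun φ hφ hc hs => ?_
    · exact ((hF.sub continuousOn_const).mono Ioo_subset_Icc_self).locallyIntegrableOn
        measurableSet_Ioo
    · set M := ∫ x in (-1 : ℝ)..1, φ x with hM
      -- Subtracting M times the bump makes the test function have mean zero, hence a derivative of
      -- a test function, against which F integrates to zero.
      have hsub : tsupport (fun x => φ x - M * η.normed volume x) ⊆ Ioo (-1 : ℝ) 1 := by
        refine (tsupport_sub φ (fun x => M * η.normed volume x)).trans (union_subset hs ?_)
        exact (tsupport_mul_subset_right (f := fun _ => M)).trans hηs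
      obtain ⟨ψ, h1, h2, h3, h4⟩ := exists_test_primitive (χ := fun x => φ x - M * η.normed volume x)
        (hφ.sub (contDiff_const.mul hη))
        (hc.sub (η.hasCompactSupport_normed.mul_left)) hsub (by
          rw [intervalIntegral.integral_sub (hφ.continuous.intervalIntegrable _ _)
            ((hη.continuous.intervalIntegrable _ _).const_mul _),
            intervalIntegral.integral_const_mul, hη1, mul_one, hM, sub_self])
      have h5 := h ψ h1 h2 h3
      rw [h4, integral_Ioo_eq_interval] at h5
      simp only [Pi.zero_apply, zero_mul, integral_zero, neg_zero] at h5
      have e : ∫ x in (-1 : ℝ)..1, F x * (φ x - M * η.normed volume x)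
          = (∫ x in (-1 : ℝ)..1, F x * φ x) - M * k := by
        rw [← intervalIntegral.integral_const_mul, ← intervalIntegral.integral_sub
          (hFi _ hφ.continuous) ((hFi _ hη.continuous).const_mul _)]
        refine intervalIntegral.integral_congr fun x _ => ?_
        ring
      rw [e] at h5
      rw [← setIntegral_eq_integral_of_forall_compl_eq_zero (s := Ioo (-1 : ℝ) 1) fun x hx => by
        rw [eq_zero_of_tsupport_subset hs hx, zero_smul], integral_Ioo_eq_interval]
      have e' : ∫ x in (-1 : ℝ)..1, φ x • (F x - k) = (∫ x in (-1 : ℝ)..1, F x * φ x) - k * M := by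
        rw [hM, ← intervalIntegral.integral_const_mul, ← intervalIntegral.integral_sub
          (hFi _ hφ.continuous) ((hφ.continuous.intervalIntegrable _ _).const_mul _)]
        refine intervalIntegral.integral_congr fun x _ => ?_
        simp only [smul_eq_mul]
        ring
      rw [e', mul_comm k]
      exact h5
  have hIoo : EqOn F (fun _ => k) (Ioo (-1) 1) := by
    refine Measure.eqOn_open_of_ae_eq (μ := volume) ?_ isOpen_Ioo (hF.mono Ioo_subset_Icc_self)
      continuousOn_const
    rw [Filter.EventuallyEq, ae_restrict_iff' measurableSet_Ioo]
    filter_upwards [hae] with x hx hx'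
    exact sub_eq_zero.1 (hx hx')
  have hIcc : EqOn F (fun _ => k) (Icc (-1) 1) :=
    hIoo.of_subset_closure hF continuousOn_const Ioo_subset_Icc_self
      (by rw [closure_Ioo (by norm_num)])
  intro x hx
  rw [hIcc hx, hIcc (show (0 : ℝ) ∈ Icc (-1) 1 by norm_num)]

/-- A continuous function is a primitive of its integrable weak derivative. -/
theorem IsWeakDeriv.eq_primitive {f g : ℝ → ℝ} (hf : ContinuousOn f (Icc (-1) 1))
    (hg : IntervalIntegrable g volume (-1) 1) (h : IsWeakDeriv f g) :
    ∀ x ∈ Icc (-1 : ℝ) 1, f x = f 0 + ∫ s in (0 : ℝ)..x, g s := by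
  have hP : AbsolutelyContinuousOnInterval (fun x => ∫ s in (0 : ℝ)..x, g s) (-1) 1 :=
    hg.absolutelyContinuousOnInterval_intervalIntegral (by rw [uIcc_of_le] <;> norm_num)
  have hPc : ContinuousOn (fun x => ∫ s in (0 : ℝ)..x, g s) (Icc (-1) 1) := by
    have := hP.continuousOn
    rwa [uIcc_of_le (by norm_num)] at this
  have hw := isWeakDeriv_primitive hg 0 (f := fun x => ∫ s in (0 : ℝ)..x, g s) (by simp)
  have := eq_const_of_isWeakDeriv_zero (hf.sub hPc) (fun φ hφ hc hs => by
    have hd : Continuous (deriv φ) :=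
      (hφ.of_le (by exact_mod_cast le_top) : ContDiff ℝ 1 φ).continuous_deriv le_rfl
    have i1 : ∀ F : ℝ → ℝ, ContinuousOn F (Icc (-1) 1) →
        Integrable (fun x => F x * deriv φ x) (volume.restrict (Ioo (-1 : ℝ) 1)) := fun F hF =>
      ((hF.mul hd.continuousOn).integrableOn_Icc).mono_set Ioo_subset_Icc_self
    simp only [Pi.sub_apply, sub_mul]
    rw [integral_sub (i1 f hf) (i1 _ hPc), h φ hφ hc hs, hw φ hφ hc hs]
    simp)
  intro x hx
  have h1 := this x hx
  simp only [Pi.sub_apply, intervalIntegral.integral_same, sub_zero] at h1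
  linarith

end WeakDerivative

/-! ### The singular equation on (0, 1): Green's formula and Hardy's inequality -/

section HalfInterval

open Filter Topology Asymptotics

/-- Lebesgue measure on `(0, 1)`. -/
abbrev μH : Measure ℝ := volume.restrict (Ioo (0 : ℝ) 1)

/-- The singular profile on the half-line. -/
def profile (ν p₁ p₂ x : ℝ) : ℝ := p₁ * x ^ (ν + 1 / 2) + p₂ * x ^ (-ν + 1 / 2)

/-- The derivative of the singular profile. -/
def profileDeriv (ν p₁ p₂ x : ℝ) : ℝ :=
  p₁ * ((ν + 1 / 2) * x ^ (ν - 1 / 2)) + p₂ * ((-ν + 1 / 2) * x ^ (-ν - 1 / 2))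

theorem hasDerivAt_profile (ν p₁ p₂ : ℝ) {x : ℝ} (hx : 0 < x) :
    HasDerivAt (profile ν p₁ p₂) (profileDeriv ν p₁ p₂ x) x := by
  have h1 := (Real.hasDerivAt_rpow_const (p := ν + 1 / 2) (Or.inl hx.ne')).const_mul p₁
  have h2 := (Real.hasDerivAt_rpow_const (p := -ν + 1 / 2) (Or.inl hx.ne')).const_mul p₂
  refine (h1.add h2).congr_deriv ?_
  rw [profileDeriv, show ν + 1 / 2 - 1 = ν - 1 / 2 by ring,
    show -ν + 1 / 2 - 1 = -ν - 1 / 2 by ring]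

/-- Both exponents ±ν + 1/2 are roots of a(a - 1) = ν² - 1/4, so the profile solves the homogeneous
equation and contributes nothing to the right-hand side. -/
theorem hasDerivAt_profileDeriv (ν p₁ p₂ : ℝ) {x : ℝ} (hx : 0 < x) :
    HasDerivAt (profileDeriv ν p₁ p₂) ((ν ^ 2 - 1 / 4) / x ^ 2 * profile ν p₁ p₂ x) x := by
  have h1 := ((Real.hasDerivAt_rpow_const (p := ν - 1 / 2) (Or.inl hx.ne')).const_mul
    (ν + 1 / 2)).const_mul p₁
  have h2 := ((Real.hasDerivAt_rpow_const (p := -ν - 1 / 2) (Or.inl hx.ne')).const_mul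
    (-ν + 1 / 2)).const_mul p₂
  refine (h1.add h2).congr_deriv ?_
  have e1 : x ^ (ν + 1 / 2) = x ^ (ν - 1 / 2 - 1) * x ^ 2 := by
    rw [← Real.rpow_add_natCast hx.ne']; congr 1; push_cast; ring
  have e2 : x ^ (-ν + 1 / 2) = x ^ (-ν - 1 / 2 - 1) * x ^ 2 := by
    rw [← Real.rpow_add_natCast hx.ne']; congr 1; push_cast; ring
  rw [profile, e1, e2]
  have := hx.ne'
  field_simp
  ring

theorem contDiffOn_rpow (a : ℝ) {ε : ℝ} (hε : 0 < ε) :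
    ContDiffOn ℝ 1 (fun x : ℝ => x ^ a) (uIcc ε 1) :=
  contDiffOn_id.rpow_const_of_ne fun _ hx =>
    ((lt_min hε one_pos).trans_le hx.1).ne'

theorem ac_profile (ν p₁ p₂ : ℝ) {ε : ℝ} (hε : 0 < ε) :
    AbsolutelyContinuousOnInterval (profile ν p₁ p₂) ε 1 :=
  ((contDiffOn_const.mul (contDiffOn_rpow _ hε)).add
    (contDiffOn_const.mul (contDiffOn_rpow _ hε))).absolutelyContinuousOnInterval

theorem ac_profileDeriv (ν p₁ p₂ : ℝ) {ε : ℝ} (hε : 0 < ε) :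
    AbsolutelyContinuousOnInterval (profileDeriv ν p₁ p₂) ε 1 :=
  ((contDiffOn_const.mul (contDiffOn_const.mul (contDiffOn_rpow _ hε))).add
    (contDiffOn_const.mul (contDiffOn_const.mul (contDiffOn_rpow _ hε)))).absolutelyContinuousOnInterval

theorem isBigO_rpow_rpow {a b : ℝ} (h : b ≤ a) :
    (fun x : ℝ => x ^ a) =O[𝓝[>] 0] fun x : ℝ => x ^ b := by
  refine IsBigO.of_bound 1 ?_
  filter_upwards [Ioo_mem_nhdsGT one_pos] with x hx
  rw [one_mul, Real.norm_of_nonneg (Real.rpow_nonneg hx.1.le _),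
    Real.norm_of_nonneg (Real.rpow_nonneg hx.1.le _)]
  exact Real.rpow_le_rpow_of_exponent_ge hx.1 hx.2.le h

theorem IsBigO.mul_rpow {f g : ℝ → ℝ} {a b c : ℝ} (hf : f =O[𝓝[>] 0] fun x : ℝ => x ^ a)
    (hg : g =O[𝓝[>] 0] fun x : ℝ => x ^ b) (h : c ≤ a + b) :
    (fun x => f x * g x) =O[𝓝[>] 0] fun x : ℝ => x ^ c := by
  refine (hf.mul hg).trans (IsBigO.trans (EventuallyEq.isBigO ?_) (isBigO_rpow_rpow h))
  filter_upwards [self_mem_nhdsWithin] with x hx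
  rw [Real.rpow_add hx]

theorem tendsto_rpow_zero {a : ℝ} (ha : 0 < a) :
    Tendsto (fun x : ℝ => x ^ a) (𝓝[>] 0) (𝓝 0) := by
  have : Tendsto (fun x : ℝ => x ^ a) (𝓝 0) (𝓝 ((0 : ℝ) ^ a)) :=
    (Real.continuous_rpow_const ha.le).tendsto 0
  rw [Real.zero_rpow ha.ne'] at this
  exact this.mono_left nhdsWithin_le_nhds

theorem isBigO_profile {ν : ℝ} (hν : 0 < ν) (p₁ p₂ : ℝ) :
    profile ν p₁ p₂ =O[𝓝[>] 0] fun x : ℝ => x ^ (-ν + 1 / 2) :=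
  ((isBigO_rpow_rpow (by linarith)).const_mul_left p₁).add
    ((isBigO_refl _ _).const_mul_left p₂)

theorem isBigO_profileDeriv {ν : ℝ} (hν : 0 < ν) (p₁ p₂ : ℝ) :
    profileDeriv ν p₁ p₂ =O[𝓝[>] 0] fun x : ℝ => x ^ (-ν - 1 / 2) :=
  (((isBigO_rpow_rpow (by linarith)).const_mul_left _).const_mul_left p₁).add
    (((isBigO_refl _ _).const_mul_left _).const_mul_left p₂)

/-- `F` solves `-F'' + (ν² - 1/4) / x² F = h` on `(0, 1)`, vanishes at `1`, and has the singular
part with coefficients `p₁`, `p₂` at `0`; `F₁` is its derivative. -/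
structure HalfSol (ν p₁ p₂ : ℝ) (F F₁ h : ℝ → ℝ) : Prop where
  memLp : MemLp F 2 μH
  memLp_rhs : MemLp h 2 μH
  hasDerivAt : ∀ x ∈ Ioo (0 : ℝ) 1, HasDerivAt F (F₁ x) x
  ac : ∀ ε ∈ Ioo (0 : ℝ) 1, AbsolutelyContinuousOnInterval F ε 1
  ac_deriv : ∀ ε ∈ Ioo (0 : ℝ) 1, AbsolutelyContinuousOnInterval F₁ ε 1
  ae_hasDerivAt : ∀ᵐ x, x ∈ Ioo (0 : ℝ) 1 →
    HasDerivAt F₁ ((ν ^ 2 - 1 / 4) / x ^ 2 * F x - h x) x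
  isBigO : (fun x => F x - profile ν p₁ p₂ x) =O[𝓝[>] 0] fun x : ℝ => x ^ (3 / 2 : ℝ)
  isBigO_deriv : (fun x => F₁ x - profileDeriv ν p₁ p₂ x) =O[𝓝[>] 0] fun x : ℝ => x ^ (1 / 2 : ℝ)
  apply_one : F 1 = 0

namespace HalfSol

variable {ν p₁ p₂ q₁ q₂ : ℝ} {F F₁ h G G₁ k : ℝ → ℝ}

/-- The integral over `(0, 1)` is the limit of the integrals over `(ε, 1)`. -/
theorem tendsto_integral {f : ℝ → ℝ} (hf : Integrable f μH) :
    Tendsto (fun ε => ∫ x in ε..1, f x) (𝓝[>] 0) (𝓝 (∫ x, f x ∂μH)) := by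
  have hi : IntervalIntegrable f volume 0 1 := by
    rw [intervalIntegrable_iff_integrableOn_Ioo_of_le zero_le_one]
    exact hf
  have h1 : Tendsto (fun ε => ∫ x in ε..1, f x) (𝓝[>] 0) (𝓝 (∫ x in (0 : ℝ)..1, f x)) := by
    have hc := intervalIntegral.continuousOn_primitive_interval' hi
      (a := 1) (by simp)
    have h0 : Tendsto (fun ε => -∫ x in (1 : ℝ)..ε, f x) (𝓝[uIcc 0 1] 0)
        (𝓝 (-∫ x in (1 : ℝ)..0, f x)) := (hc 0 (by simp)).neg
    simp only [← intervalIntegral.integral_symm] at h0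
    rw [uIcc_of_le zero_le_one] at h0
    exact h0.mono_left (nhdsWithin_le_of_mem (Icc_mem_nhdsGT one_pos))
  rwa [intervalIntegral.integral_of_le zero_le_one, integral_Ioc_eq_integral_Ioo] at h1

theorem ae_uIoc {P : ℝ → Prop} (hP : ∀ᵐ x, x ∈ Ioo (0 : ℝ) 1 → P x) {ε : ℝ}
    (hε : ε ∈ Ioo (0 : ℝ) 1) : ∀ᵐ x, x ∈ uIoc ε 1 → P x := by
  filter_upwards [hP, Measure.ae_ne volume 1] with x hx hx1 hx2
  rw [uIoc_of_le hε.2.le] at hx2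
  exact hx ⟨hε.1.trans hx2.1, lt_of_le_of_ne hx2.2 hx1⟩

/-- Green's formula: the boundary form at the singularity. -/
theorem integral_wronskian (hν : 0 < ν) (hν1 : ν < 1) (hF : HalfSol ν p₁ p₂ F F₁ h)
    (hG : HalfSol ν q₁ q₂ G G₁ k) :
    ∫ x, (G x * h x - F x * k x) ∂μH = 2 * ν * (p₁ * q₂ - p₂ * q₁) := by
  have hInt : Integrable (fun x => G x * h x - F x * k x) μH :=
    (hG.memLp.integrable_mul hF.memLp_rhs).sub (hF.memLp.integrable_mul hG.memLp_rhs)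
  have hlim := tendsto_integral hInt
  -- The Wronskian has derivative G h - F k and vanishes at 1, so only its limit at 0 survives.
  set W : ℝ → ℝ := fun x => F x * G₁ x - F₁ x * G x with hW
  have h1 : ∀ᶠ ε in 𝓝[>] (0 : ℝ), ∫ x in ε..1, (G x * h x - F x * k x) = - W ε := by
    filter_upwards [Ioo_mem_nhdsGT one_pos] with ε hε
    have hac : AbsolutelyContinuousOnInterval W ε 1 :=
      ((hF.ac ε hε).mul (hG.ac_deriv ε hε)).sub ((hF.ac_deriv ε hε).mul (hG.ac ε hε))
    rw [integral_eq_sub_of_ae_hasDerivAt hac]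
    · simp [hW, hF.apply_one, hG.apply_one]
    · refine ae_uIoc ?_ hε
      filter_upwards [hF.ae_hasDerivAt, hG.ae_hasDerivAt] with x a1 a2 hx
      refine (((hF.hasDerivAt x hx).mul (a2 hx)).sub
        ((a1 hx).mul (hG.hasDerivAt x hx))).congr_deriv ?_
      ring
  have h2 : Tendsto (fun ε => - W ε) (𝓝[>] 0) (𝓝 (2 * ν * (p₁ * q₂ - p₂ * q₁))) := by
    -- The Wronskian of the two profiles is the exact constant. The six remaining terms contain a
    -- regular factor; the largest are O(x^{1-ν}), which tends to 0 because ν < 1.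
    have hO : (fun x => -W x - 2 * ν * (p₁ * q₂ - p₂ * q₁)) =O[𝓝[>] 0]
        fun x : ℝ => x ^ (1 - ν) := by
      have t1 := IsBigO.mul_rpow (c := 1 - ν) (isBigO_profile hν p₁ p₂) hG.isBigO_deriv
        (by linarith)
      have t2 := IsBigO.mul_rpow (c := 1 - ν) hF.isBigO (isBigO_profileDeriv hν q₁ q₂)
        (by linarith)
      have t3 := IsBigO.mul_rpow (c := 1 - ν) hF.isBigO hG.isBigO_deriv (by linarith)
      have t4 := IsBigO.mul_rpow (c := 1 - ν) (isBigO_profileDeriv hν p₁ p₂) hG.isBigO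
        (by linarith)
      have t5 := IsBigO.mul_rpow (c := 1 - ν) hF.isBigO_deriv (isBigO_profile hν q₁ q₂)
        (by linarith)
      have t6 := IsBigO.mul_rpow (c := 1 - ν) hF.isBigO_deriv hG.isBigO (by linarith)
      refine (((t4.add t5).add t6).sub ((t1.add t2).add t3)).congr' ?_ EventuallyEq.rfl
      filter_upwards [self_mem_nhdsWithin] with x hx
      have hx : 0 < x := hx
      have e1 : x ^ (ν + 1 / 2) * x ^ (-ν - 1 / 2) = 1 := by
        rw [← Real.rpow_add hx]; ring_nf; exact Real.rpow_zero x
      have e2 : x ^ (-ν + 1 / 2) * x ^ (ν - 1 / 2) = 1 := by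
        rw [← Real.rpow_add hx]; ring_nf; exact Real.rpow_zero x
      simp only [hW, profile, profileDeriv]
      linear_combination (p₁ * q₂ * (-ν + 1 / 2) - p₂ * q₁ * (-ν + 1 / 2)) * e1
        - (p₁ * q₂ * (ν + 1 / 2) - p₂ * q₁ * (ν + 1 / 2)) * e2
    have := hO.trans_tendsto (tendsto_rpow_zero (by linarith : 0 < 1 - ν))
    simpa using this.add_const (2 * ν * (p₁ * q₂ - p₂ * q₁))
  exact tendsto_nhds_unique hlim (h2.congr' (h1.mono fun _ h => h.symm))

/-- Hardy's inequality: the form is nonnegative on functions without singular part. -/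
theorem integral_mul_nonneg (hF : HalfSol ν 0 0 F F₁ h) : 0 ≤ ∫ x, F x * h x ∂μH := by
  have hInt : Integrable (fun x => F x * h x) μH := hF.memLp.integrable_mul hF.memLp_rhs
  have b1 := hF.isBigO
  have b2 := hF.isBigO_deriv
  simp only [profile, profileDeriv, zero_mul, add_zero, sub_zero] at b1 b2
  -- Completing the square with the correction F²/(2x) gives P' = F h - (F' - F/(2x))² - (νF/x)², so
  -- the integral of F h over (ε, 1) is at least P(1) - P(ε) = -P(ε).
  set P : ℝ → ℝ := fun x => -(F x * F₁ x) + F x * F x * (x⁻¹ / 2) with hP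
  have hPlim : Tendsto (fun ε => - P ε) (𝓝[>] 0) (𝓝 0) := by
    have i1 : (fun x : ℝ => x⁻¹ / 2) =O[𝓝[>] 0] fun x : ℝ => x ^ (-1 : ℝ) := by
      simp_rw [div_eq_mul_inv, mul_comm _ (2 : ℝ)⁻¹, Real.rpow_neg_one]
      exact (isBigO_refl _ _).const_mul_left _
    have t1 := IsBigO.mul_rpow (c := 2) b1 b2 (by norm_num)
    have t2 := IsBigO.mul_rpow (c := 2) (IsBigO.mul_rpow (c := 3) b1 b1 (by norm_num)) i1
      (by norm_num)
    have := (t1.neg_left.add t2).neg_left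
    exact this.trans_tendsto (tendsto_rpow_zero two_pos)
  refine le_of_tendsto_of_tendsto hPlim (tendsto_integral hInt) ?_
  filter_upwards [Ioo_mem_nhdsGT one_pos] with ε hε
  have hinv : AbsolutelyContinuousOnInterval (fun x : ℝ => x⁻¹ / 2) ε 1 := by
    refine ContDiffOn.absolutelyContinuousOnInterval ?_
    refine (contDiffOn_inv ℝ).div_const 2 |>.mono fun x hx => ?_
    exact ((lt_min hε.1 one_pos).trans_le hx.1).ne'
  have hac : AbsolutelyContinuousOnInterval P ε 1 :=
    ((hF.ac ε hε).mul (hF.ac_deriv ε hε)).neg.add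
      (((hF.ac ε hε).mul (hF.ac ε hε)).mul hinv)
  have hd : ∀ᵐ x, x ∈ uIoc ε 1 → HasDerivAt P
      (F x * h x - ((F₁ x - F x * x⁻¹ / 2) ^ 2 + (ν * F x * x⁻¹) ^ 2)) x := by
    refine ae_uIoc ?_ hε
    filter_upwards [hF.ae_hasDerivAt] with x a1 hx
    have d := hF.hasDerivAt x hx
    refine ((d.mul (a1 hx)).neg.add ((d.mul d).mul
      ((hasDerivAt_inv hx.1.ne').div_const 2))).congr_deriv ?_
    have := hx.1.ne'
    simp only [Pi.mul_apply]
    field_simp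
    ring
  have hsub : - P ε = P 1 - P ε := by simp [hP, hF.apply_one]
  rw [hsub, ← hac.integral_deriv_eq_sub]
  refine intervalIntegral.integral_mono_ae_restrict hε.2.le hac.intervalIntegrable_deriv ?_ ?_
  · rw [intervalIntegrable_iff_integrableOn_Ioo_of_le hε.2.le]
    exact IntegrableOn.mono_set hInt (Ioo_subset_Ioo_left hε.1.le)
  · rw [EventuallyLE, ae_restrict_iff' measurableSet_Icc]
    filter_upwards [hd, Measure.ae_ne volume ε] with x hx hxε hx2
    rw [(hx (by rw [uIoc_of_le hε.2.le]; exact ⟨lt_of_le_of_ne hx2.1 (Ne.symm hxε), hx2.2⟩)).deriv]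
    nlinarith [sq_nonneg (F₁ x - F x * x⁻¹ / 2), sq_nonneg (ν * F x * x⁻¹)]

theorem continuousOn (hF : HalfSol ν p₁ p₂ F F₁ h) : ContinuousOn F (Ioo 0 1) := fun x hx =>
  (hF.hasDerivAt x hx).continuousAt.continuousWithinAt

theorem deriv_eq_zero (hF : HalfSol ν p₁ p₂ F F₁ h) {a b : ℝ} (ha : 0 ≤ a) (hb : b ≤ 1)
    (h0 : ∀ x ∈ Ioo a b, F x = 0) : ∀ x ∈ Ioo a b, F₁ x = 0 := by
  intro x hx
  refine (hF.hasDerivAt x ⟨ha.trans_lt hx.1, hx.2.trans_le hb⟩).unique ?_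
  refine (hasDerivAt_const x (0 : ℝ)).congr_of_eventuallyEq ?_
  filter_upwards [Ioo_mem_nhds hx.1 hx.2] with y hy using h0 y hy

theorem eq_zero_of_ae (hF : HalfSol ν p₁ p₂ F F₁ h) {a b : ℝ} (ha : 0 ≤ a) (hb : b ≤ 1)
    (h0 : ∀ᵐ x, x ∈ Ioo a b → F x = 0) : ∀ x ∈ Ioo a b, F x = 0 := by
  refine Measure.eqOn_open_of_ae_eq (μ := volume) ?_ isOpen_Ioo
    (hF.continuousOn.mono (Ioo_subset_Ioo ha hb)) continuousOn_const
  rwa [EventuallyEq, ae_restrict_iff' measurableSet_Ioo]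

/-- By continuity F vanishes everywhere on the interval, hence so do F₁ and its derivative, and the
equation leaves h = 0. This makes the operator single-valued. -/
theorem rhs_eq_zero (hF : HalfSol ν p₁ p₂ F F₁ h) (h0 : ∀ᵐ x, x ∈ Ioo (0 : ℝ) 1 → F x = 0) :
    ∀ᵐ x, x ∈ Ioo (0 : ℝ) 1 → h x = 0 := by
  have hz := hF.eq_zero_of_ae le_rfl le_rfl h0
  have hz1 := hF.deriv_eq_zero le_rfl le_rfl hz
  filter_upwards [hF.ae_hasDerivAt] with x hx hx'
  have h1 : HasDerivAt F₁ 0 x := by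
    refine (hasDerivAt_const x (0 : ℝ)).congr_of_eventuallyEq ?_
    filter_upwards [Ioo_mem_nhds hx'.1 hx'.2] with y hy using hz1 y hy
  have := (hx hx').unique h1
  rw [hz x hx'] at this
  linarith

/-- The singular coefficients of the zero function vanish. -/
theorem coeff_eq_zero (hν : 0 < ν) (hν1 : ν < 1) (hF : HalfSol ν p₁ p₂ F F₁ h)
    (h0 : ∀ x ∈ Ioo (0 : ℝ) 1, F x = 0) : p₁ = 0 ∧ p₂ = 0 := by
  have hp : profile ν p₁ p₂ =O[𝓝[>] 0] fun x : ℝ => x ^ (3 / 2 : ℝ) := by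
    refine (hF.isBigO.neg_left).congr' ?_ EventuallyEq.rfl
    filter_upwards [Ioo_mem_nhdsGT one_pos] with x hx
    rw [h0 x hx]; ring
  -- Multiplying by x^{ν - 1/2} turns the profile into p₁ x^{2ν} + p₂ and the bound into x^{1+ν},
  -- which isolates p₂; once p₂ = 0, the factor x^{-ν - 1/2} isolates p₁, with the bound x^{1-ν}.
  have h2 : p₂ = 0 := by
    have t1 := (IsBigO.mul_rpow (c := 1 + ν) hp (isBigO_refl (fun x : ℝ => x ^ (ν - 1 / 2)) _)
      (by linarith)).trans_tendsto (tendsto_rpow_zero (by linarith))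
    have t2 : Tendsto (fun x : ℝ => p₁ * x ^ (2 * ν) + p₂) (𝓝[>] 0) (𝓝 (p₁ * 0 + p₂)) :=
      ((tendsto_rpow_zero (by linarith)).const_mul p₁).add_const p₂
    have t3 := tendsto_nhds_unique (t1.congr' ?_) t2
    · linarith
    · filter_upwards [self_mem_nhdsWithin] with x hx
      have hx : 0 < x := hx
      have e1 : x ^ (ν + 1 / 2) * x ^ (ν - 1 / 2) = x ^ (2 * ν) := by
        rw [← Real.rpow_add hx]; ring_nf
      have e2 : x ^ (-ν + 1 / 2) * x ^ (ν - 1 / 2) = 1 := by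
        rw [← Real.rpow_add hx]; ring_nf; exact Real.rpow_zero x
      rw [profile]
      linear_combination p₁ * e1 + p₂ * e2
  refine ⟨?_, h2⟩
  have t1 := (IsBigO.mul_rpow (c := 1 - ν) hp (isBigO_refl (fun x : ℝ => x ^ (-ν - 1 / 2)) _)
    (by linarith)).trans_tendsto (tendsto_rpow_zero (by linarith))
  refine (tendsto_nhds_unique (t1.congr' ?_) tendsto_const_nhds).symm
  filter_upwards [self_mem_nhdsWithin] with x hx
  have hx : 0 < x := hx
  have e1 : x ^ (ν + 1 / 2) * x ^ (-ν - 1 / 2) = 1 := by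
    rw [← Real.rpow_add hx]; ring_nf; exact Real.rpow_zero x
  rw [profile, h2]
  linear_combination p₁ * e1

end HalfSol

end HalfInterval

/-! ### Unique continuation for eigenfunctions on (0, 1) -/

section Eigenfunction

open Filter Topology Asymptotics

namespace HalfSol

variable {ν p₁ p₂ v : ℝ} {F F₁ h : ℝ → ℝ}

/-- For an eigenfunction the right-hand side is continuous off 0, so F₁, being its primitive, is
differentiable everywhere and not merely almost everywhere. -/
theorem hasDerivAt_deriv (hF : HalfSol ν p₁ p₂ F F₁ h)
    (hv : ∀ᵐ x, x ∈ Ioo (0 : ℝ) 1 → h x = v * F x) {x : ℝ} (hx : x ∈ Ioo (0 : ℝ) 1) :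
    HasDerivAt F₁ ((ν ^ 2 - 1 / 4) / x ^ 2 * F x - v * F x) x := by
  set g : ℝ → ℝ := fun s => (ν ^ 2 - 1 / 4) / s ^ 2 * F s - v * F s with hg
  have hgc : ∀ ε ∈ Ioo (0 : ℝ) 1, ContinuousOn g (uIcc ε 1) := fun ε hε => by
    have h1 := (hF.ac ε hε).continuousOn
    refine ((continuousOn_const.div (by fun_prop) fun s hs => ?_).mul h1).sub
      (continuousOn_const.mul h1)
    exact pow_ne_zero 2 ((lt_min hε.1 one_pos).trans_le hs.1).ne'
  have key : ∀ y ∈ Ioo (0 : ℝ) 1, F₁ y = F₁ 1 - ∫ s in y..1, g s := fun y hy => by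
    rw [integral_eq_sub_of_ae_hasDerivAt (hF.ac_deriv y hy)]
    · ring
    · refine ae_uIoc ?_ hy
      filter_upwards [hF.ae_hasDerivAt, hv] with s h1 h2 hs
      have := h1 hs
      rwa [h2 hs] at this
  have hgo : ContinuousOn g (Ioo 0 1) := fun s hs =>
    ((hgc (s / 2) ⟨half_pos hs.1, by linarith [hs.1, hs.2]⟩).continuousAt
      (by
        rw [uIcc_of_le (by linarith [hs.2])]
        exact Icc_mem_nhds (by linarith [hs.1]) hs.2)).continuousWithinAt
  have hd := intervalIntegral.integral_hasDerivAt_left (hgc x hx).intervalIntegrable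
    (hgo.stronglyMeasurableAtFilter isOpen_Ioo x hx) (hgo.continuousAt (isOpen_Ioo.mem_nhds hx))
  refine ((hd.const_sub (F₁ 1)).congr_deriv (neg_neg _)).congr_of_eventuallyEq ?_
  filter_upwards [Ioo_mem_nhds hx.1 hx.2] with y hy using key y hy

/-- The energy whose logarithmic derivative is controlled by the two indicial exponents. -/
def energy (ν : ℝ) (F F₁ : ℝ → ℝ) (x : ℝ) : ℝ :=
  (F₁ x - (ν + 1 / 2) * (F x * x⁻¹)) ^ 2 + (F₁ x - (-ν + 1 / 2) * (F x * x⁻¹)) ^ 2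

/-- The two expressions squared in the energy differ by 2νF/x, so for ν > 0 the energy controls F.
-/
theorem eq_zero_of_energy (hν : 0 < ν) {x : ℝ} (hx : 0 < x) (h0 : energy ν F F₁ x ≤ 0) :
    F x = 0 := by
  unfold energy at h0
  have h1 : F₁ x - (ν + 1 / 2) * (F x * x⁻¹) = 0 := by
    rw [← sq_eq_zero_iff]
    exact le_antisymm (by nlinarith [sq_nonneg (F₁ x - (-ν + 1 / 2) * (F x * x⁻¹))]) (sq_nonneg _)
  have h2 : F₁ x - (-ν + 1 / 2) * (F x * x⁻¹) = 0 := by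
    rw [← sq_eq_zero_iff]
    exact le_antisymm (by nlinarith [sq_nonneg (F₁ x - (ν + 1 / 2) * (F x * x⁻¹))]) (sq_nonneg _)
  have h3 : 2 * ν * (F x * x⁻¹) = 0 := by linarith
  have h4 : F x * x⁻¹ = 0 := by
    rcases mul_eq_zero.1 h3 with h | h
    · linarith
    · exact h
  exact (mul_eq_zero.1 h4).resolve_right (inv_ne_zero hx.ne')

/-- Y₁ = F' - (ν + 1/2)F/x and Y₂ = F' - (-ν + 1/2)F/x diagonalize the Euler part of the equation:
xY₁' and xY₂' equal -(ν + 1/2)Y₁ and (ν - 1/2)Y₂ up to the common term -v x F. As F/x = (Y₂ -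
Y₁)/(2ν), that term perturbs the rates of the energy by at most |v|x²/ν. -/
theorem hasDerivAt_energy (hF : HalfSol ν p₁ p₂ F F₁ h)
    (hv : ∀ᵐ x, x ∈ Ioo (0 : ℝ) 1 → h x = v * F x) (hν : 0 < ν) {x : ℝ}
    (hx : x ∈ Ioo (0 : ℝ) 1) :
    ∃ E', HasDerivAt (energy ν F F₁) E' x ∧
      x * E' ≤ (2 * ν - 1 + |v| / ν * x ^ 2) * energy ν F F₁ x ∧
      -(2 * ν + 1 + |v| / ν * x ^ 2) * energy ν F F₁ x ≤ x * E' := by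
  have d0 := hF.hasDerivAt x hx
  have d1 := hF.hasDerivAt_deriv hv hx
  have hx0 := hx.1.ne'
  have dq := d0.mul (hasDerivAt_inv hx0)
  have dy : ∀ a : ℝ, HasDerivAt (fun x => (F₁ x - a * (F x * x⁻¹)) ^ 2) _ x := fun a =>
    (d1.sub (dq.const_mul a)).pow 2
  refine ⟨_, (dy (ν + 1 / 2)).add (dy (-ν + 1 / 2)), ?_⟩
  simp only [Pi.sub_apply, Pi.mul_apply, Nat.cast_ofNat, Nat.add_one_sub_one, pow_one]
  unfold energy
  set Y₁ := F₁ x - (ν + 1 / 2) * (F x * x⁻¹) with hY₁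
  set Y₂ := F₁ x - (-ν + 1 / 2) * (F x * x⁻¹) with hY₂
  have hq : 2 * ν * (F x * x⁻¹) = Y₂ - Y₁ := by rw [hY₁, hY₂]; ring
  have e : x * (2 * Y₁ * ((ν ^ 2 - 1 / 4) / x ^ 2 * F x - v * F x - (ν + 1 / 2) *
        (F₁ x * x⁻¹ + F x * (-(x ^ 2)⁻¹))) + 2 * Y₂ * ((ν ^ 2 - 1 / 4) / x ^ 2 * F x - v * F x -
        (-ν + 1 / 2) * (F₁ x * x⁻¹ + F x * (-(x ^ 2)⁻¹))))
      = -2 * (ν + 1 / 2) * Y₁ ^ 2 + 2 * (ν - 1 / 2) * Y₂ ^ 2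
        - v / ν * x ^ 2 * (Y₂ ^ 2 - Y₁ ^ 2) := by
    have e1 : x * ((ν ^ 2 - 1 / 4) / x ^ 2 * F x - v * F x - (ν + 1 / 2) *
        (F₁ x * x⁻¹ + F x * (-(x ^ 2)⁻¹))) = -(ν + 1 / 2) * Y₁ - v * x ^ 2 * (F x * x⁻¹) := by
      rw [hY₁]; field_simp; ring
    have e2 : x * ((ν ^ 2 - 1 / 4) / x ^ 2 * F x - v * F x - (-ν + 1 / 2) *
        (F₁ x * x⁻¹ + F x * (-(x ^ 2)⁻¹))) = (ν - 1 / 2) * Y₂ - v * x ^ 2 * (F x * x⁻¹) := by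
      rw [hY₂]; field_simp; ring
    have e3 : F x * x⁻¹ = (Y₂ - Y₁) / (2 * ν) := by rw [← hq]; field_simp
    calc _ = 2 * Y₁ * (x * ((ν ^ 2 - 1 / 4) / x ^ 2 * F x - v * F x - (ν + 1 / 2) *
        (F₁ x * x⁻¹ + F x * (-(x ^ 2)⁻¹)))) + 2 * Y₂ * (x * ((ν ^ 2 - 1 / 4) / x ^ 2 * F x -
        v * F x - (-ν + 1 / 2) * (F₁ x * x⁻¹ + F x * (-(x ^ 2)⁻¹)))) := by ring
      _ = _ := by
        rw [e1, e2, e3]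
        field_simp
        ring
  rw [e]
  have hw : |v / ν * x ^ 2| = |v| / ν * x ^ 2 := by
    rw [abs_mul, abs_div, abs_of_pos hν, abs_of_nonneg (sq_nonneg x)]
  obtain ⟨w1, w2⟩ := abs_le.1 hw.le
  constructor
  · nlinarith [mul_nonneg (by linarith : 0 ≤ |v| / ν * x ^ 2 + v / ν * x ^ 2) (sq_nonneg Y₂),
      mul_nonneg (by linarith : 0 ≤ |v| / ν * x ^ 2 - v / ν * x ^ 2) (sq_nonneg Y₁),
      mul_nonneg hν.le (sq_nonneg Y₁)]
  · nlinarith [mul_nonneg (by linarith : 0 ≤ |v| / ν * x ^ 2 + v / ν * x ^ 2) (sq_nonneg Y₁),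
      mul_nonneg (by linarith : 0 ≤ |v| / ν * x ^ 2 - v / ν * x ^ 2) (sq_nonneg Y₂),
      mul_nonneg hν.le (sq_nonneg Y₂)]

theorem hasDerivAt_weight (a K : ℝ) {x : ℝ} (hx : 0 < x) :
    HasDerivAt (fun x : ℝ => x ^ a * Real.exp (K * x ^ 2))
      (x ^ a * Real.exp (K * x ^ 2) * (a * x⁻¹ + 2 * K * x)) x := by
  have h1 := (Real.hasDerivAt_rpow_const (p := a) (Or.inl hx.ne'))
  have h2 := (((hasDerivAt_pow 2 x).const_mul K).exp)
  refine (h1.mul h2).congr_deriv ?_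
  rw [Real.rpow_sub_one hx.ne']
  field_simp
  push_cast
  ring

/-- Gronwall with the integrating factor of the upper rate. It carries vanishing to the right, in
particular away from the singularity; `monotoneOn_energy`, from the lower rate, carries it to the
left. -/
theorem antitoneOn_energy (hF : HalfSol ν p₁ p₂ F F₁ h)
    (hv : ∀ᵐ x, x ∈ Ioo (0 : ℝ) 1 → h x = v * F x) (hν : 0 < ν) :
    AntitoneOn (fun x => energy ν F F₁ x * (x ^ (1 - 2 * ν) * Real.exp (-(|v| / ν / 2) * x ^ 2)))
      (Ioo 0 1) := by
  have hd : ∀ x ∈ Ioo (0 : ℝ) 1, ∃ D ≤ 0, HasDerivAt (fun x => energy ν F F₁ x *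
      (x ^ (1 - 2 * ν) * Real.exp (-(|v| / ν / 2) * x ^ 2))) D x := by
    intro x hx
    obtain ⟨E', hE, h1, -⟩ := hF.hasDerivAt_energy hv hν hx
    refine ⟨_, ?_, hE.mul (hasDerivAt_weight _ _ hx.1)⟩
    have hpos : 0 < x ^ (1 - 2 * ν) * Real.exp (-(|v| / ν / 2) * x ^ 2) :=
      mul_pos (Real.rpow_pos_of_pos hx.1 _) (Real.exp_pos _)
    have hle : E' + energy ν F F₁ x * ((1 - 2 * ν) * x⁻¹ + 2 * -(|v| / ν / 2) * x) ≤ 0 := by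
      refine nonpos_of_mul_nonpos_right ?_ hx.1
      have : x * (E' + energy ν F F₁ x * ((1 - 2 * ν) * x⁻¹ + 2 * -(|v| / ν / 2) * x))
          = x * E' - (2 * ν - 1 + |v| / ν * x ^ 2) * energy ν F F₁ x := by
        have := hx.1.ne'
        field_simp
        ring
      rw [this]; linarith
    calc _ = (x ^ (1 - 2 * ν) * Real.exp (-(|v| / ν / 2) * x ^ 2)) *
        (E' + energy ν F F₁ x * ((1 - 2 * ν) * x⁻¹ + 2 * -(|v| / ν / 2) * x)) := by ring
      _ ≤ 0 := mul_nonpos_of_nonneg_of_nonpos hpos.le hle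
  choose! D hD0 hD using hd
  refine antitoneOn_of_deriv_nonpos (convex_Ioo 0 1)
    (fun x hx => (hD x hx).continuousAt.continuousWithinAt) (fun x hx => ?_) fun x hx => ?_
  · rw [interior_Ioo] at hx
    exact (hD x hx).differentiableAt.differentiableWithinAt
  · rw [interior_Ioo] at hx
    rw [(hD x hx).deriv]
    exact hD0 x hx

theorem monotoneOn_energy (hF : HalfSol ν p₁ p₂ F F₁ h)
    (hv : ∀ᵐ x, x ∈ Ioo (0 : ℝ) 1 → h x = v * F x) (hν : 0 < ν) :
    MonotoneOn (fun x => energy ν F F₁ x * (x ^ (1 + 2 * ν) * Real.exp (|v| / ν / 2 * x ^ 2)))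
      (Ioo 0 1) := by
  have hd : ∀ x ∈ Ioo (0 : ℝ) 1, ∃ D ≥ 0, HasDerivAt (fun x => energy ν F F₁ x *
      (x ^ (1 + 2 * ν) * Real.exp (|v| / ν / 2 * x ^ 2))) D x := by
    intro x hx
    obtain ⟨E', hE, -, h1⟩ := hF.hasDerivAt_energy hv hν hx
    refine ⟨_, ?_, hE.mul (hasDerivAt_weight _ _ hx.1)⟩
    have hpos : 0 < x ^ (1 + 2 * ν) * Real.exp (|v| / ν / 2 * x ^ 2) :=
      mul_pos (Real.rpow_pos_of_pos hx.1 _) (Real.exp_pos _)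
    have hle : 0 ≤ E' + energy ν F F₁ x * ((1 + 2 * ν) * x⁻¹ + 2 * (|v| / ν / 2) * x) := by
      refine nonneg_of_mul_nonneg_right ?_ hx.1
      have : x * (E' + energy ν F F₁ x * ((1 + 2 * ν) * x⁻¹ + 2 * (|v| / ν / 2) * x))
          = x * E' + (2 * ν + 1 + |v| / ν * x ^ 2) * energy ν F F₁ x := by
        have := hx.1.ne'
        field_simp
        ring
      rw [this]; linarith
    calc 0 ≤ (x ^ (1 + 2 * ν) * Real.exp (|v| / ν / 2 * x ^ 2)) *
        (E' + energy ν F F₁ x * ((1 + 2 * ν) * x⁻¹ + 2 * (|v| / ν / 2) * x)) :=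
          mul_nonneg hpos.le hle
      _ = _ := by ring
  choose! D hD0 hD using hd
  refine monotoneOn_of_deriv_nonneg (convex_Ioo 0 1)
    (fun x hx => (hD x hx).continuousAt.continuousWithinAt) (fun x hx => ?_) fun x hx => ?_
  · rw [interior_Ioo] at hx
    exact (hD x hx).differentiableAt.differentiableWithinAt
  · rw [interior_Ioo] at hx
    rw [(hD x hx).deriv]
    exact hD0 x hx

/-- Unique continuation from a subinterval. -/
theorem eq_zero_of_eq_zero_on (hF : HalfSol ν p₁ p₂ F F₁ h)
    (hv : ∀ᵐ x, x ∈ Ioo (0 : ℝ) 1 → h x = v * F x) (hν : 0 < ν) {a b : ℝ} (ha : 0 ≤ a)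
    (hab : a < b) (hb : b ≤ 1) (h0 : ∀ᵐ x, x ∈ Ioo a b → F x = 0) :
    ∀ x ∈ Ioo (0 : ℝ) 1, F x = 0 := by
  have z0 := hF.eq_zero_of_ae ha hb h0
  have z1 := hF.deriv_eq_zero ha hb z0
  obtain ⟨y, hy⟩ := exists_between hab
  have hy' : y ∈ Ioo (0 : ℝ) 1 := ⟨ha.trans_lt hy.1, hy.2.trans_le hb⟩
  have hE : energy ν F F₁ y = 0 := by simp [energy, z0 y hy, z1 y hy]
  intro x hx
  refine eq_zero_of_energy (F₁ := F₁) hν hx.1 ?_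
  rcases le_total x y with hxy | hxy
  · have := hF.monotoneOn_energy hv hν hx hy' hxy
    simp only [hE, zero_mul] at this
    exact nonpos_of_mul_nonpos_left this (mul_pos (Real.rpow_pos_of_pos hx.1 _) (Real.exp_pos _))
  · have := hF.antitoneOn_energy hv hν hy' hx hxy
    simp only [hE, zero_mul] at this
    exact nonpos_of_mul_nonpos_left this (mul_pos (Real.rpow_pos_of_pos hx.1 _) (Real.exp_pos _))

/-- Unique continuation from the singularity. -/
theorem eq_zero_of_coeff (hF : HalfSol ν 0 0 F F₁ h)
    (hv : ∀ᵐ x, x ∈ Ioo (0 : ℝ) 1 → h x = v * F x) (hν : 0 < ν) (hν1 : ν < 1) :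
    ∀ x ∈ Ioo (0 : ℝ) 1, F x = 0 := by
  have b1 := hF.isBigO
  have b2 := hF.isBigO_deriv
  simp only [profile, profileDeriv, zero_mul, add_zero, sub_zero] at b1 b2
  have i1 : (fun x : ℝ => x⁻¹) =O[𝓝[>] 0] fun x : ℝ => x ^ (-1 : ℝ) := by
    simp_rw [Real.rpow_neg_one]
    exact isBigO_refl _ _
  have hY : ∀ a : ℝ, (fun x => F₁ x - a * (F x * x⁻¹)) =O[𝓝[>] 0] fun x : ℝ => x ^ (1 / 2 : ℝ) :=
    fun a => b2.sub ((IsBigO.mul_rpow b1 i1 (by norm_num)).const_mul_left a)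
  have hE : energy ν F F₁ =O[𝓝[>] 0] fun x : ℝ => x ^ (1 : ℝ) := by
    refine ((IsBigO.mul_rpow (hY (ν + 1 / 2)) (hY (ν + 1 / 2)) (by norm_num)).add
      (IsBigO.mul_rpow (hY (-ν + 1 / 2)) (hY (-ν + 1 / 2)) (by norm_num))).congr_left fun x => ?_
    unfold energy; ring
  have hexp : (fun x : ℝ => Real.exp (-(|v| / ν / 2) * x ^ 2)) =O[𝓝[>] 0]
      fun x : ℝ => x ^ (0 : ℝ) := by
    simp_rw [Real.rpow_zero]
    exact ((by fun_prop : Continuous fun x : ℝ => Real.exp (-(|v| / ν / 2) * x ^ 2)).tendsto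
      0).mono_left nhdsWithin_le_nhds |>.isBigO_one ℝ
  -- Without singular part the energy is O(x), so the weighted energy is O(x^{2-2ν}) and tends to 0
  -- since ν < 1. An antitone quantity starting from the limit 0 is nonpositive.
  have hZ := (IsBigO.mul_rpow (c := 2 - 2 * ν) hE (IsBigO.mul_rpow (c := 1 - 2 * ν)
    (isBigO_refl (fun x : ℝ => x ^ (1 - 2 * ν)) _) hexp (by linarith))
    (by linarith)).trans_tendsto (tendsto_rpow_zero (by linarith))
  intro x hx
  refine eq_zero_of_energy (F₁ := F₁) hν hx.1 ?_
  have hle := ge_of_tendsto hZ (b := energy ν F F₁ x *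
    (x ^ (1 - 2 * ν) * Real.exp (-(|v| / ν / 2) * x ^ 2))) (by
      filter_upwards [Ioo_mem_nhdsGT hx.1] with y hy
      exact hF.antitoneOn_energy hv hν ⟨hy.1, hy.2.trans hx.2⟩ hx hy.2.le)
  exact nonpos_of_mul_nonpos_left hle (mul_pos (Real.rpow_pos_of_pos hx.1 _) (Real.exp_pos _))

end HalfSol

end Eigenfunction

/-! ### Regular parts on (0, 1) and their decay at 0 -/

section HalfRegular

open Filter Topology Asymptotics

theorem sq_integral_mul_le {α : Type*} [MeasurableSpace α] {μ : Measure α} {f g : α → ℝ}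
    (hf : MemLp f 2 μ) (hg : MemLp g 2 μ) :
    (∫ x, f x * g x ∂μ) ^ 2 ≤ (∫ x, f x ^ 2 ∂μ) * ∫ x, g x ^ 2 ∂μ := by
  have h := discrim_le_zero (a := ∫ x, f x ^ 2 ∂μ) (b := 2 * ∫ x, f x * g x ∂μ)
    (c := ∫ x, g x ^ 2 ∂μ) fun t => by
      have e : ∫ x, (t * f x + g x) ^ 2 ∂μ = (∫ x, f x ^ 2 ∂μ) * (t * t)
          + 2 * (∫ x, f x * g x ∂μ) * t + ∫ x, g x ^ 2 ∂μ := by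
        have i1 : Integrable (fun x => t * t * f x ^ 2) μ := hf.integrable_sq.const_mul _
        have i2 : Integrable (fun x => 2 * t * (f x * g x)) μ := (hf.integrable_mul hg).const_mul _
        have i3 : Integrable (fun x => t * t * f x ^ 2 + 2 * t * (f x * g x)) μ := i1.add i2
        calc _ = ∫ x, (t * t * f x ^ 2 + 2 * t * (f x * g x) + g x ^ 2) ∂μ := by
              congr 1; ext x; ring
          _ = _ := by
              rw [integral_add i3 hg.integrable_sq, integral_add i1 i2, integral_const_mul,
                integral_const_mul]
              ring
      rw [← e]
      exact integral_nonneg fun x => sq_nonneg _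
  rw [discrim] at h
  linarith

theorem memLp_rpow {a : ℝ} (ha : -(1 / 2) < a) : MemLp (fun s : ℝ => s ^ a) 2 μH := by
  have hm : AEStronglyMeasurable (fun s : ℝ => s ^ a) μH :=
    (by fun_prop : Measurable fun s : ℝ => s ^ a).aestronglyMeasurable
  rw [memLp_two_iff_integrable_sq hm]
  have h := (intervalIntegral.intervalIntegrable_rpow' (a := 0) (b := 1) (r := 2 * a)
    (by linarith)).1
  rw [integrableOn_Ioc_iff_integrableOn_Ioo] at h
  refine h.congr ?_
  filter_upwards [ae_restrict_mem measurableSet_Ioo] with s hs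
  rw [mul_comm, Real.rpow_mul hs.1.le, Real.rpow_two]

theorem restrict_Ioc_le {x : ℝ} (hx : x ≤ 1) : volume.restrict (Ioc (0 : ℝ) x) ≤ μH := by
  rw [show μH = volume.restrict (Ioc (0 : ℝ) 1) from restrict_Ioo_eq_restrict_Ioc]
  exact Measure.restrict_mono (Ioc_subset_Ioc_right hx) le_rfl

theorem integral_rpow_sq {a : ℝ} (ha : -(1 / 2) < a) {x : ℝ} (hx : 0 ≤ x) :
    ∫ s in Ioc 0 x, (s ^ a) ^ 2 = (2 * a + 1)⁻¹ * x ^ (2 * a + 1) := by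
  have : ∫ s in Ioc 0 x, (s ^ a) ^ 2 = ∫ s in Ioc 0 x, s ^ (2 * a) := by
    refine setIntegral_congr_fun measurableSet_Ioc fun s hs => ?_
    rw [mul_comm, Real.rpow_mul hs.1.le, Real.rpow_two]
  rw [this, ← intervalIntegral.integral_of_le hx, integral_rpow (Or.inl (by linarith)),
    Real.zero_rpow (by linarith)]
  ring

/-- The Cauchy–Schwarz bound for a weighted primitive. -/
theorem abs_integral_rpow_mul_le {a : ℝ} (ha : -(1 / 2) < a) {h : ℝ → ℝ} (hh : MemLp h 2 μH)
    {x : ℝ} (hx : x ∈ Icc (0 : ℝ) 1) :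
    |∫ s in (0 : ℝ)..x, s ^ a * h s| ≤
      √((2 * a + 1)⁻¹ * ∫ s, h s ^ 2 ∂μH) * x ^ (a + 1 / 2) := by
  have hle := restrict_Ioc_le hx.2
  have hpos : 0 < 2 * a + 1 := by linarith
  refine abs_le_of_sq_le_sq ?_ (mul_nonneg (Real.sqrt_nonneg _) (Real.rpow_nonneg hx.1 _))
  rw [intervalIntegral.integral_of_le hx.1]
  refine (sq_integral_mul_le ((memLp_rpow ha).mono_measure hle) (hh.mono_measure hle)).trans ?_
  rw [integral_rpow_sq ha hx.1, mul_pow, Real.sq_sqrt (mul_nonneg (inv_nonneg.2 hpos.le)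
    (integral_nonneg fun s => sq_nonneg _)), ← Real.rpow_two, ← Real.rpow_mul hx.1,
    show (a + 1 / 2) * 2 = 2 * a + 1 by ring, mul_right_comm]
  refine mul_le_mul_of_nonneg_right (mul_le_mul_of_nonneg_left ?_ (inv_nonneg.2 hpos.le))
    (Real.rpow_nonneg hx.1 _)
  exact integral_mono_measure hle (ae_of_all _ fun s => sq_nonneg _) hh.integrable_sq

theorem ac_congr {f g : ℝ → ℝ} {a b : ℝ} (hf : AbsolutelyContinuousOnInterval f a b)
    (h : EqOn f g (uIcc a b)) : AbsolutelyContinuousOnInterval g a b := by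
  rw [absolutelyContinuousOnInterval_iff] at hf ⊢
  intro ε hε
  obtain ⟨δ, hδ, H⟩ := hf ε hε
  refine ⟨δ, hδ, fun E hE hE' => ?_⟩
  refine lt_of_eq_of_lt (Finset.sum_congr rfl fun i hi => ?_) (H E hE hE')
  rw [h (hE.1 i hi).1, h (hE.1 i hi).2]

theorem intervalIntegrable_of_memLp {f : ℝ → ℝ} (hf : MemLp f 2 μH) :
    IntervalIntegrable f volume 0 1 := by
  rw [intervalIntegrable_iff_integrableOn_Ioo_of_le zero_le_one]
  exact hf.integrable one_le_two

theorem memLp_of_continuousOn {f : ℝ → ℝ} (hf : ContinuousOn f (Icc 0 1)) : MemLp f 2 μH := by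
  obtain ⟨C, hC⟩ := isCompact_Icc.exists_bound_of_continuousOn hf
  refine MemLp.of_bound
    ((hf.mono Ioo_subset_Icc_self).aestronglyMeasurable measurableSet_Ioo) C ?_
  filter_upwards [ae_restrict_mem measurableSet_Ioo] with x hx
  exact hC x (Ioo_subset_Icc_self hx)

/-- `r` is a twice iterated primitive of `r₂ ∈ L²(0, 1)` from `0`. -/
structure HalfReg (r r₁ r₂ : ℝ → ℝ) : Prop where
  memLp : MemLp r₂ 2 μH
  deriv_eq : ∀ x ∈ Icc (0 : ℝ) 1, r₁ x = ∫ s in (0 : ℝ)..x, r₂ s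
  eq : ∀ x ∈ Icc (0 : ℝ) 1, r x = ∫ s in (0 : ℝ)..x, r₁ s

namespace HalfReg

variable {r r₁ r₂ : ℝ → ℝ}

theorem ac_deriv (hr : HalfReg r r₁ r₂) : AbsolutelyContinuousOnInterval r₁ 0 1 :=
  ac_congr ((intervalIntegrable_of_memLp hr.memLp).absolutelyContinuousOnInterval_intervalIntegral
    (c := 0) (by simp)) fun x hx => (hr.deriv_eq x (by rwa [uIcc_of_le zero_le_one] at hx)).symm

theorem continuousOn_deriv (hr : HalfReg r r₁ r₂) : ContinuousOn r₁ (Icc 0 1) := by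
  have := hr.ac_deriv.continuousOn
  rwa [uIcc_of_le zero_le_one] at this

theorem ac (hr : HalfReg r r₁ r₂) : AbsolutelyContinuousOnInterval r 0 1 :=
  ac_congr ((intervalIntegrable_of_memLp (memLp_of_continuousOn
    hr.continuousOn_deriv)).absolutelyContinuousOnInterval_intervalIntegral
    (c := 0) (by simp)) fun x hx => (hr.eq x (by rwa [uIcc_of_le zero_le_one] at hx)).symm

theorem continuousOn (hr : HalfReg r r₁ r₂) : ContinuousOn r (Icc 0 1) := by
  have := hr.ac.continuousOn
  rwa [uIcc_of_le zero_le_one] at this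

/-- Cauchy–Schwarz on (0, x) yields the factor x^{1/2}; integrating once more gives x^{3/2} for r.
These rates separate the regular part from both singular profiles when ν < 1. -/
theorem abs_deriv_le (hr : HalfReg r r₁ r₂) {x : ℝ} (hx : x ∈ Icc (0 : ℝ) 1) :
    |r₁ x| ≤ √(∫ s, r₂ s ^ 2 ∂μH) * x ^ (1 / 2 : ℝ) := by
  have := abs_integral_rpow_mul_le (a := 0) (by norm_num) hr.memLp hx
  simpa [hr.deriv_eq x hx] using this

theorem abs_le (hr : HalfReg r r₁ r₂) {x : ℝ} (hx : x ∈ Icc (0 : ℝ) 1) :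
    |r x| ≤ √(∫ s, r₂ s ^ 2 ∂μH) * x ^ (3 / 2 : ℝ) := by
  rw [hr.eq x hx]
  have h1 := intervalIntegral.norm_integral_le_of_norm_le_const (a := 0) (b := x) (f := r₁)
    (C := √(∫ s, r₂ s ^ 2 ∂μH) * x ^ (1 / 2 : ℝ)) fun s hs => by
      rw [uIoc_of_le hx.1] at hs
      refine (hr.abs_deriv_le ⟨hs.1.le, hs.2.trans hx.2⟩).trans ?_
      exact mul_le_mul_of_nonneg_left (Real.rpow_le_rpow hs.1.le hs.2 (by norm_num))
        (Real.sqrt_nonneg _)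
  refine h1.trans_eq ?_
  rw [sub_zero, abs_of_nonneg hx.1, mul_assoc]
  congr 1
  rcases hx.1.eq_or_lt with h | h
  · rw [← h, Real.zero_rpow (by norm_num), Real.zero_rpow (by norm_num), zero_mul]
  · rw [← Real.rpow_add_one h.ne']; norm_num

theorem hasDerivAt (hr : HalfReg r r₁ r₂) {x : ℝ} (hx : x ∈ Ioo (0 : ℝ) 1) :
    HasDerivAt r (r₁ x) x := by
  have hc := hr.continuousOn_deriv.mono Ioo_subset_Icc_self
  have hi : IntervalIntegrable r₁ volume 0 x := by
    refine (hr.continuousOn_deriv.mono ?_).intervalIntegrable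
    rw [uIcc_of_le hx.1.le]
    exact Icc_subset_Icc_right hx.2.le
  have := intervalIntegral.integral_hasDerivAt_right hi
    (hc.stronglyMeasurableAtFilter isOpen_Ioo x hx) (hc.continuousAt (isOpen_Ioo.mem_nhds hx))
  refine this.congr_of_eventuallyEq ?_
  filter_upwards [isOpen_Ioo.mem_nhds hx] with y hy using hr.eq y (Ioo_subset_Icc_self hy)

theorem ae_hasDerivAt_deriv (hr : HalfReg r r₁ r₂) :
    ∀ᵐ x, x ∈ Ioo (0 : ℝ) 1 → HasDerivAt r₁ (r₂ x) x := by
  filter_upwards [(intervalIntegrable_of_memLp hr.memLp).ae_hasDerivAt_integral] with x hx hx'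
  have := hx (by rw [uIcc_of_le zero_le_one]; exact Ioo_subset_Icc_self hx') 0 (by simp)
  refine this.congr_of_eventuallyEq ?_
  filter_upwards [isOpen_Ioo.mem_nhds hx'] with y hy using hr.deriv_eq y (Ioo_subset_Icc_self hy)

/-- The profile solves the homogeneous equation, so only r enters the right-hand side, and the
asymptotics at 0 are the decay of r. Square integrability of the profile needs -ν + 1/2 > -1/2, that
is ν < 1. -/
theorem halfSol (hr : HalfReg r r₁ r₂) {ν p₁ p₂ : ℝ} (hν : 0 < ν) (hν1 : ν < 1) {h : ℝ → ℝ}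
    (hL : MemLp h 2 μH)
    (hh : ∀ᵐ x, x ∈ Ioo (0 : ℝ) 1 → h x = -r₂ x + (ν ^ 2 - 1 / 4) / x ^ 2 * r x)
    (h1 : r 1 + (p₁ + p₂) = 0) :
    HalfSol ν p₁ p₂ (fun x => r x + profile ν p₁ p₂ x) (fun x => r₁ x + profileDeriv ν p₁ p₂ x)
      h where
  memLp := (memLp_of_continuousOn hr.continuousOn).add
    (((memLp_rpow (by linarith)).const_mul p₁).add ((memLp_rpow (by linarith)).const_mul p₂))
  memLp_rhs := hL
  hasDerivAt x hx := (hr.hasDerivAt hx).add (hasDerivAt_profile ν p₁ p₂ hx.1)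
  ac ε hε := (hr.ac.mono (uIcc_subset_uIcc (by simp [uIcc_of_le, hε.1.le, hε.2.le])
    (by simp))).add (ac_profile ν p₁ p₂ hε.1)
  ac_deriv ε hε := (hr.ac_deriv.mono (uIcc_subset_uIcc (by simp [uIcc_of_le, hε.1.le, hε.2.le])
    (by simp))).add (ac_profileDeriv ν p₁ p₂ hε.1)
  ae_hasDerivAt := by
    filter_upwards [hr.ae_hasDerivAt_deriv, hh] with x a1 a2 hx
    refine ((a1 hx).add (hasDerivAt_profileDeriv ν p₁ p₂ hx.1)).congr_deriv ?_
    rw [a2 hx]; ring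
  isBigO := by
    refine IsBigO.of_bound (√(∫ s, r₂ s ^ 2 ∂μH)) ?_
    filter_upwards [Ioo_mem_nhdsGT one_pos] with x hx
    rw [add_sub_cancel_right, Real.norm_of_nonneg (Real.rpow_nonneg hx.1.le _)]
    exact hr.abs_le (Ioo_subset_Icc_self hx)
  isBigO_deriv := by
    refine IsBigO.of_bound (√(∫ s, r₂ s ^ 2 ∂μH)) ?_
    filter_upwards [Ioo_mem_nhdsGT one_pos] with x hx
    rw [add_sub_cancel_right, Real.norm_of_nonneg (Real.rpow_nonneg hx.1.le _)]
    exact hr.abs_deriv_le (Ioo_subset_Icc_self hx)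
  apply_one := by simpa [profile] using h1

end HalfReg

end HalfRegular

/-! ### The operator as a linear relation, and its restriction to the two halves -/

section Graph

open Filter Topology

theorem singularPart_of_pos (ν m₁ m₂ p₁ p₂ : ℝ) {x : ℝ} (hx : 0 < x) :
    singularPart ν m₁ m₂ p₁ p₂ x = profile ν p₁ p₂ x := by
  rw [singularPart, if_pos hx, abs_of_pos hx, profile]

theorem singularPart_of_neg (ν m₁ m₂ p₁ p₂ : ℝ) {x : ℝ} (hx : x < 0) :
    singularPart ν m₁ m₂ p₁ p₂ x = profile ν m₁ m₂ (-x) := by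
  rw [singularPart, if_neg hx.not_gt, if_pos hx, abs_of_neg hx, profile]

theorem iteratedDeriv_two_singularPart (ν m₁ m₂ p₁ p₂ : ℝ) {x : ℝ} (hx : x ≠ 0) :
    iteratedDeriv 2 (singularPart ν m₁ m₂ p₁ p₂) x
      = (ν ^ 2 - 1 / 4) / x ^ 2 * singularPart ν m₁ m₂ p₁ p₂ x := by
  rw [iteratedDeriv_succ, iteratedDeriv_one]
  rcases hx.lt_or_gt with hx | hx
  · have h1 : deriv (singularPart ν m₁ m₂ p₁ p₂) =ᶠ[𝓝 x] fun y => -profileDeriv ν m₁ m₂ (-y) := by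
      filter_upwards [Iio_mem_nhds hx] with y hy
      have hy : y < 0 := hy
      refine HasDerivAt.deriv ?_
      have h2 := (hasDerivAt_profile ν m₁ m₂ (neg_pos.2 hy)).scomp y (hasDerivAt_neg y)
      refine (h2.congr_deriv (by simp)).congr_of_eventuallyEq ?_
      filter_upwards [Iio_mem_nhds hy] with z hz using singularPart_of_neg _ _ _ _ _ hz
    rw [h1.deriv_eq, singularPart_of_neg _ _ _ _ _ hx]
    have h2 := ((hasDerivAt_profileDeriv ν m₁ m₂ (neg_pos.2 hx)).scomp x (hasDerivAt_neg x)).neg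
    refine (h2.congr_deriv ?_).deriv
    simp
  · have h1 : deriv (singularPart ν m₁ m₂ p₁ p₂) =ᶠ[𝓝 x] profileDeriv ν p₁ p₂ := by
      filter_upwards [Ioi_mem_nhds hx] with y hy
      have hy : 0 < y := hy
      refine HasDerivAt.deriv ?_
      refine (hasDerivAt_profile ν p₁ p₂ hy).congr_of_eventuallyEq ?_
      filter_upwards [Ioi_mem_nhds hy] with z hz using singularPart_of_pos _ _ _ _ _ hz
    rw [h1.deriv_eq, singularPart_of_pos _ _ _ _ _ hx]
    exact (hasDerivAt_profileDeriv ν p₁ p₂ hx).deriv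

theorem nu_pos {c : ℝ} (hc : c ∈ Ioo (-1 / 4 : ℝ) (3 / 4)) : 0 < nu c :=
  Real.sqrt_pos.2 (by linarith [hc.1])

theorem nu_lt_one {c : ℝ} (hc : c ∈ Ioo (-1 / 4 : ℝ) (3 / 4)) : nu c < 1 := by
  rw [nu, Real.sqrt_lt' one_pos]; linarith [hc.2]

theorem nu_sq {c : ℝ} (hc : c ∈ Ioo (-1 / 4 : ℝ) (3 / 4)) : nu c ^ 2 - 1 / 4 = c := by
  rw [nu, Real.sq_sqrt (by linarith [hc.1])]; ring

/-- `r` is a twice iterated primitive of `r₂ ∈ L²(-1, 1)` from `0`. -/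
structure RegPart (r r₁ r₂ : ℝ → ℝ) : Prop where
  memLp : MemLp r₂ 2 μI
  deriv_eq : ∀ x ∈ Icc (-1 : ℝ) 1, r₁ x = ∫ s in (0 : ℝ)..x, r₂ s
  eq : ∀ x ∈ Icc (-1 : ℝ) 1, r x = ∫ s in (0 : ℝ)..x, r₁ s

theorem intervalIntegrable_of_memLp_symm {f : ℝ → ℝ} (hf : MemLp f 2 μI) :
    IntervalIntegrable f volume (-1) 1 := by
  rw [intervalIntegrable_iff_integrableOn_Ioo_of_le (by norm_num)]
  exact hf.integrable one_le_two

theorem continuousOn_primitive {f r : ℝ → ℝ} (hf : IntervalIntegrable f volume (-1) 1)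
    (hr : ∀ x ∈ Icc (-1 : ℝ) 1, r x = ∫ s in (0 : ℝ)..x, f s) : ContinuousOn r (Icc (-1) 1) := by
  have := (hf.absolutelyContinuousOnInterval_intervalIntegral (c := 0)
    (by rw [uIcc_of_le] <;> norm_num)).continuousOn
  rw [uIcc_of_le (by norm_num)] at this
  exact this.congr hr

theorem RegPart.continuousOn_deriv {r r₁ r₂ : ℝ → ℝ} (h : RegPart r r₁ r₂) :
    ContinuousOn r₁ (Icc (-1) 1) :=
  continuousOn_primitive (intervalIntegrable_of_memLp_symm h.memLp) h.deriv_eq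

theorem RegPart.intervalIntegrable_deriv {r r₁ r₂ : ℝ → ℝ} (h : RegPart r r₁ r₂) :
    IntervalIntegrable r₁ volume (-1) 1 := by
  refine ContinuousOn.intervalIntegrable ?_
  rw [uIcc_of_le (by norm_num)]
  exact h.continuousOn_deriv

/-- Weak derivatives become iterated integrals from 0, the conditions r(0) = r₁(0) = 0 being the
vanishing constants of integration. All later arguments use this form. -/
theorem isRegularPart_iff {r r₁ r₂ : ℝ → ℝ} : IsRegularPart r r₁ r₂ ↔ RegPart r r₁ r₂ := by
  constructor
  · intro h
    have i1 : IntervalIntegrable r₁ volume (-1) 1 := by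
      refine ContinuousOn.intervalIntegrable ?_
      rw [uIcc_of_le (by norm_num)]
      exact h.continuousOn_deriv
    refine ⟨h.memLp, fun x hx => ?_, fun x hx => ?_⟩
    · rw [h.weakDeriv₂.eq_primitive h.continuousOn_deriv
        (intervalIntegrable_of_memLp_symm h.memLp) x hx, h.deriv_zero, zero_add]
    · rw [h.weakDeriv.eq_primitive h.continuousOn i1 x hx, h.apply_zero, zero_add]
  · intro h
    have z : (0 : ℝ) ∈ Icc (-1 : ℝ) 1 := by norm_num
    exact ⟨continuousOn_primitive h.intervalIntegrable_deriv h.eq, h.continuousOn_deriv, h.memLp,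
      isWeakDeriv_primitive h.intervalIntegrable_deriv 0 (by simpa using h.eq),
      isWeakDeriv_primitive (intervalIntegrable_of_memLp_symm h.memLp) 0 (by simpa using h.deriv_eq),
      by rw [h.eq 0 z, intervalIntegral.integral_same],
      by rw [h.deriv_eq 0 z, intervalIntegral.integral_same]⟩

theorem intervalIntegrable_zero {f : ℝ → ℝ} (hf : IntervalIntegrable f volume (-1) 1) {x : ℝ}
    (hx : x ∈ Icc (-1 : ℝ) 1) : IntervalIntegrable f volume 0 x :=
  hf.mono_set (uIcc_subset_uIcc (by rw [uIcc_of_le] <;> norm_num)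
    (by rw [uIcc_of_le (by norm_num)]; exact hx))

theorem RegPart.zero : RegPart 0 0 0 :=
  ⟨MemLp.zero, fun x _ => by simp, fun x _ => by simp⟩

theorem RegPart.add {r r₁ r₂ s s₁ s₂ : ℝ → ℝ} (h : RegPart r r₁ r₂) (h' : RegPart s s₁ s₂) :
    RegPart (r + s) (r₁ + s₁) (r₂ + s₂) := by
  refine ⟨h.memLp.add h'.memLp, fun x hx => ?_, fun x hx => ?_⟩
  · simp only [Pi.add_apply]
    rw [intervalIntegral.integral_add
      (intervalIntegrable_zero (intervalIntegrable_of_memLp_symm h.memLp) hx)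
      (intervalIntegrable_zero (intervalIntegrable_of_memLp_symm h'.memLp) hx),
      h.deriv_eq x hx, h'.deriv_eq x hx]
  · simp only [Pi.add_apply]
    rw [intervalIntegral.integral_add (intervalIntegrable_zero h.intervalIntegrable_deriv hx)
      (intervalIntegrable_zero h'.intervalIntegrable_deriv hx), h.eq x hx, h'.eq x hx]

theorem RegPart.smul {r r₁ r₂ : ℝ → ℝ} (a : ℝ) (h : RegPart r r₁ r₂) :
    RegPart (a • r) (a • r₁) (a • r₂) := by
  refine ⟨h.memLp.const_smul a, fun x hx => ?_, fun x hx => ?_⟩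
  · simp only [Pi.smul_apply, smul_eq_mul, intervalIntegral.integral_const_mul, h.deriv_eq x hx]
  · simp only [Pi.smul_apply, smul_eq_mul, intervalIntegral.integral_const_mul, h.eq x hx]

theorem singularPart_add (ν : ℝ) (k l : Fin 4 → ℝ) (x : ℝ) :
    singularPart ν ((k + l) 0) ((k + l) 1) ((k + l) 2) ((k + l) 3) x
      = singularPart ν (k 0) (k 1) (k 2) (k 3) x + singularPart ν (l 0) (l 1) (l 2) (l 3) x := by
  simp only [singularPart, Pi.add_apply]
  split_ifs <;> ring

theorem singularPart_smul (ν a : ℝ) (k : Fin 4 → ℝ) (x : ℝ) :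
    singularPart ν ((a • k) 0) ((a • k) 1) ((a • k) 2) ((a • k) 3) x
      = a * singularPart ν (k 0) (k 1) (k 2) (k 3) x := by
  simp only [singularPart, Pi.smul_apply, smul_eq_mul]
  split_ifs <;> ring

/-- The graph of the operator together with the singular coefficients `m₁, m₂, p₁, p₂`. -/
def coeffGraph (c : ℝ) : Submodule ℝ (L2I × L2I × (Fin 4 → ℝ)) where
  carrier := {z | ∃ r r₁ r₂ : ℝ → ℝ, RegPart r r₁ r₂ ∧
    r (-1) + (z.2.2 0 + z.2.2 1) = 0 ∧ r 1 + (z.2.2 2 + z.2.2 3) = 0 ∧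
    z.2.2 0 + z.2.2 1 + z.2.2 2 + z.2.2 3 = 0 ∧
    (nu c + 1 / 2) * z.2.2 0 + (-nu c + 1 / 2) * z.2.2 1
      = (nu c + 1 / 2) * z.2.2 2 + (-nu c + 1 / 2) * z.2.2 3 ∧
    (∀ᵐ x ∂μI, z.1 x = r x + singularPart (nu c) (z.2.2 0) (z.2.2 1) (z.2.2 2) (z.2.2 3) x) ∧
    (∀ᵐ x ∂μI, z.2.1 x = -r₂ x + c / x ^ 2 * r x)}
  zero_mem' := by
    refine ⟨0, 0, 0, RegPart.zero, by simp, by simp, by simp, by simp, ?_, ?_⟩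
    · filter_upwards [Lp.coeFn_zero ℝ 2 μI] with x hx
      simp only [Prod.fst_zero, Prod.snd_zero, hx, Pi.zero_apply, singularPart]
      simp
    · filter_upwards [Lp.coeFn_zero ℝ 2 μI] with x hx
      simp only [Prod.fst_zero, Prod.snd_zero, hx, Pi.zero_apply]
      simp
  add_mem' := by
    rintro ⟨f, h, k⟩ ⟨g, h', k'⟩ ⟨r, r₁, r₂, a1, a2, a3, a4, a5, a6, a7⟩
      ⟨s, s₁, s₂, b1, b2, b3, b4, b5, b6, b7⟩
    refine ⟨r + s, r₁ + s₁, r₂ + s₂, a1.add b1, ?_, ?_, ?_, ?_, ?_, ?_⟩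
    · simp only [Prod.snd_add, Pi.add_apply] at *; linarith
    · simp only [Prod.snd_add, Pi.add_apply] at *; linarith
    · simp only [Prod.snd_add, Pi.add_apply] at *; linarith
    · simp only [Prod.snd_add, Pi.add_apply] at *; linarith
    · filter_upwards [Lp.coeFn_add f g, a6, b6] with x e1 e2 e3
      simp only [Prod.mk_add_mk]
      rw [singularPart_add, e1, Pi.add_apply, Pi.add_apply, e2, e3]
      ring
    · filter_upwards [Lp.coeFn_add h h', a7, b7] with x e1 e2 e3
      simp only [Prod.mk_add_mk]
      rw [e1, Pi.add_apply, Pi.add_apply, Pi.add_apply, e2, e3]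
      ring
  smul_mem' := by
    rintro a ⟨f, h, k⟩ ⟨r, r₁, r₂, a1, a2, a3, a4, a5, a6, a7⟩
    refine ⟨a • r, a • r₁, a • r₂, a1.smul a, ?_, ?_, ?_, ?_, ?_, ?_⟩
    · simp only [Prod.smul_snd, Pi.smul_apply, smul_eq_mul] at *; linear_combination a * a2
    · simp only [Prod.smul_snd, Pi.smul_apply, smul_eq_mul] at *; linear_combination a * a3
    · simp only [Prod.smul_snd, Pi.smul_apply, smul_eq_mul] at *; linear_combination a * a4
    · simp only [Prod.smul_snd, Pi.smul_apply, smul_eq_mul] at *; linear_combination a * a5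
    · filter_upwards [Lp.coeFn_smul a f, a6] with x e1 e2
      simp only [Prod.smul_mk]
      rw [singularPart_smul, e1, Pi.smul_apply, Pi.smul_apply, smul_eq_mul, smul_eq_mul, e2]
      ring
    · filter_upwards [Lp.coeFn_smul a h, a7] with x e1 e2
      simp only [Prod.smul_mk]
      rw [e1, Pi.smul_apply, Pi.smul_apply, Pi.smul_apply, smul_eq_mul, smul_eq_mul, smul_eq_mul,
        e2]
      ring

/-- The graph of the operator as a linear relation. -/
def graph (c : ℝ) : Submodule ℝ (L2I × L2I) :=
  (coeffGraph c).map ((LinearMap.fst ℝ L2I (L2I × (Fin 4 → ℝ))).prod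
    ((LinearMap.fst ℝ L2I (Fin 4 → ℝ)).comp (LinearMap.snd ℝ L2I (L2I × (Fin 4 → ℝ)))))

theorem mem_graph {c : ℝ} {f h : L2I} : (f, h) ∈ graph c ↔ ∃ k, (f, h, k) ∈ coeffGraph c := by
  simp [graph, Submodule.mem_map]

theorem ae_ne_zero : ∀ᵐ x ∂μI, x ≠ 0 := ae_restrict_of_ae (Measure.ae_ne volume 0)

/-- Off 0 the singular part is annihilated by the differential expression, so it drops out of the
formula for h; at ±1 its powers of |x| equal 1, leaving sums of coefficients. -/
theorem opGraph_iff {c : ℝ} (hc : c ∈ Ioo (-1 / 4 : ℝ) (3 / 4)) {f h : L2I} :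
    OpGraph c f h ↔ (f, h) ∈ graph c := by
  rw [mem_graph]
  have hs : ∀ m₁ m₂ p₁ p₂ : ℝ, singularPart (nu c) m₁ m₂ p₁ p₂ 1 = p₁ + p₂ ∧
      singularPart (nu c) m₁ m₂ p₁ p₂ (-1) = m₁ + m₂ := fun m₁ m₂ p₁ p₂ => by
    rw [singularPart_of_pos _ _ _ _ _ one_pos, singularPart_of_neg _ _ _ _ _ (by norm_num)]
    simp [profile]
  have hae : ∀ (r r₂ : ℝ → ℝ) (m₁ m₂ p₁ p₂ : ℝ),
      (∀ᵐ x ∂μI, h x = -(r₂ x + iteratedDeriv 2 (singularPart (nu c) m₁ m₂ p₁ p₂) x)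
        + c / x ^ 2 * (r x + singularPart (nu c) m₁ m₂ p₁ p₂ x)) ↔
      ∀ᵐ x ∂μI, h x = -r₂ x + c / x ^ 2 * r x := fun r r₂ m₁ m₂ p₁ p₂ => by
    refine eventually_congr ?_
    filter_upwards [ae_ne_zero] with x hx
    rw [iteratedDeriv_two_singularPart _ _ _ _ _ hx, nu_sq hc]
    ring_nf
  constructor
  · rintro ⟨r, r₁, r₂, m₁, m₂, p₁, p₂, h1, h2, h3, h4, h5, h6, h7⟩
    rw [(hs m₁ m₂ p₁ p₂).2] at h2
    rw [(hs m₁ m₂ p₁ p₂).1] at h3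
    exact ⟨![m₁, m₂, p₁, p₂], r, r₁, r₂, isRegularPart_iff.1 h1, h2, h3, h4, h5, h6,
      (hae _ _ _ _ _ _).1 h7⟩
  · rintro ⟨k, r, r₁, r₂, h1, h2, h3, h4, h5, h6, h7⟩
    refine ⟨r, r₁, r₂, k 0, k 1, k 2, k 3, isRegularPart_iff.2 h1, ?_, ?_, h4, h5, h6,
      (hae _ _ _ _ _ _).2 h7⟩
    · rw [(hs _ _ _ _).2]; exact h2
    · rw [(hs _ _ _ _).1]; exact h3

theorem measurePreserving_neg_half :
    MeasurePreserving (fun x : ℝ => -x) μH (volume.restrict (Ioo (-1 : ℝ) 0)) := by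
  have h := (Measure.measurePreserving_neg (volume : Measure ℝ)).restrict_preimage
    (s := Ioo (-1 : ℝ) 0) measurableSet_Ioo
  have e : (Neg.neg : ℝ → ℝ) ⁻¹' Ioo (-1) 0 = Ioo 0 1 := by
    ext x; simp only [mem_preimage, mem_Ioo]; constructor <;> rintro ⟨h1, h2⟩ <;>
      constructor <;> linarith
  rwa [e] at h

theorem memLp_right {f : ℝ → ℝ} (hf : MemLp f 2 μI) : MemLp f 2 μH :=
  hf.mono_measure (Measure.restrict_mono (Ioo_subset_Ioo_left (by norm_num)) le_rfl)

theorem memLp_left {f : ℝ → ℝ} (hf : MemLp f 2 μI) : MemLp (fun x => f (-x)) 2 μH :=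
  (hf.mono_measure (Measure.restrict_mono (Ioo_subset_Ioo_right zero_le_one)
    le_rfl)).comp_measurePreserving measurePreserving_neg_half

theorem ae_right {P : ℝ → Prop} (h : ∀ᵐ x ∂μI, P x) : ∀ᵐ x, x ∈ Ioo (0 : ℝ) 1 → P x := by
  rw [ae_restrict_iff' measurableSet_Ioo] at h
  filter_upwards [h] with x hx hx'
  exact hx ⟨by linarith [hx'.1], hx'.2⟩

theorem ae_neg {P : ℝ → Prop} (h : ∀ᵐ x, P x) : ∀ᵐ x : ℝ, P (-x) :=
  (Measure.measurePreserving_neg (volume : Measure ℝ)).quasiMeasurePreserving.ae h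

theorem ae_left {P : ℝ → Prop} (h : ∀ᵐ x ∂μI, P x) : ∀ᵐ x, x ∈ Ioo (0 : ℝ) 1 → P (-x) := by
  rw [ae_restrict_iff' measurableSet_Ioo] at h
  filter_upwards [ae_neg h] with x hx hx'
  exact hx ⟨by linarith [hx'.2], by linarith [hx'.1]⟩

theorem ae_of_halves {P : ℝ → Prop} (h1 : ∀ᵐ x, x ∈ Ioo (0 : ℝ) 1 → P x)
    (h2 : ∀ᵐ x, x ∈ Ioo (0 : ℝ) 1 → P (-x)) : ∀ᵐ x ∂μI, P x := by
  rw [ae_restrict_iff' measurableSet_Ioo]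
  filter_upwards [h1, ae_neg h2, Measure.ae_ne volume 0] with x a1 a2 a3 hx
  rcases a3.lt_or_gt with h | h
  · simpa using a2 ⟨by linarith, by linarith [hx.1]⟩
  · exact a1 ⟨h, hx.2⟩

theorem integral_halves {f : ℝ → ℝ} (hf : Integrable f μI) :
    ∫ x, f x ∂μI = (∫ x, f x ∂μH) + ∫ x, f (-x) ∂μH := by
  have hi : IntervalIntegrable f volume (-1) 1 := by
    rwa [intervalIntegrable_iff_integrableOn_Ioo_of_le (by norm_num)]
  have e : ∀ g : ℝ → ℝ, ∫ x, g x ∂μH = ∫ x in (0 : ℝ)..1, g x := fun g => by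
    rw [intervalIntegral.integral_of_le zero_le_one, integral_Ioc_eq_integral_Ioo]
  rw [e, e, intervalIntegral.integral_comp_neg (f := f), neg_zero, integral_Ioo_eq_interval,
    add_comm]
  exact (intervalIntegral.integral_add_adjacent_intervals
    (intervalIntegrable_zero hi (by norm_num)).symm
    (intervalIntegrable_zero hi (by norm_num))).symm

theorem RegPart.right {r r₁ r₂ : ℝ → ℝ} (h : RegPart r r₁ r₂) : HalfReg r r₁ r₂ :=
  ⟨memLp_right h.memLp, fun x hx => h.deriv_eq x ⟨by linarith [hx.1], hx.2⟩,
    fun x hx => h.eq x ⟨by linarith [hx.1], hx.2⟩⟩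

theorem RegPart.left {r r₁ r₂ : ℝ → ℝ} (h : RegPart r r₁ r₂) :
    HalfReg (fun x => r (-x)) (fun x => -r₁ (-x)) (fun x => r₂ (-x)) := by
  refine ⟨memLp_left h.memLp, fun x hx => ?_, fun x hx => ?_⟩
  · rw [h.deriv_eq (-x) ⟨by linarith [hx.2], by linarith [hx.1]⟩,
      intervalIntegral.integral_comp_neg, neg_zero, ← intervalIntegral.integral_symm]
  · rw [h.eq (-x) ⟨by linarith [hx.2], by linarith [hx.1]⟩, intervalIntegral.integral_neg,
      intervalIntegral.integral_comp_neg, neg_zero, ← intervalIntegral.integral_symm]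

/-- Restriction of an element of the graph to the two halves of the interval. -/
theorem exists_halves {c : ℝ} (hc : c ∈ Ioo (-1 / 4 : ℝ) (3 / 4)) {f h : L2I} {k : Fin 4 → ℝ}
    (hk : (f, h, k) ∈ coeffGraph c) :
    ∃ F F₁ G G₁ : ℝ → ℝ, HalfSol (nu c) (k 2) (k 3) F F₁ h ∧
      HalfSol (nu c) (k 0) (k 1) G G₁ (fun x => h (-x)) ∧
      (∀ᵐ x, x ∈ Ioo (0 : ℝ) 1 → f x = F x) ∧ (∀ᵐ x, x ∈ Ioo (0 : ℝ) 1 → f (-x) = G x) := by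
  obtain ⟨r, r₁, r₂, h1, h2, h3, h4, h5, h6, h7⟩ := hk
  simp only at h2 h3 h4 h5 h6 h7
  refine ⟨_, _, _, _, h1.right.halfSol (nu_pos hc) (nu_lt_one hc) (memLp_right (Lp.memLp h)) ?_ h3,
    h1.left.halfSol (nu_pos hc) (nu_lt_one hc) (memLp_left (Lp.memLp h)) ?_ h2, ?_, ?_⟩
  · rw [nu_sq hc]
    exact ae_right h7
  · rw [nu_sq hc]
    simpa using ae_left h7
  · filter_upwards [ae_right h6] with x hx hx'
    rw [hx hx', singularPart_of_pos _ _ _ _ _ hx'.1]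
  · filter_upwards [ae_left h6] with x hx hx'
    rw [hx hx', singularPart_of_neg _ _ _ _ _ (neg_lt_zero.2 hx'.1), neg_neg]

end Graph

/-! ### Symmetry, lower bound and unique continuation for the operator -/

section Operator

open Filter Topology
open scoped InnerProductSpace

theorem inner_eq_integral (f g : L2I) : ⟪f, g⟫_ℝ = ∫ x, f x * g x ∂μI := by
  rw [L2.inner_def]
  refine integral_congr_ae (ae_of_all _ fun x => ?_)
  simp [mul_comm]

theorem integrable_mul (f g : L2I) : Integrable (fun x => f x * g x) μI :=
  (Lp.memLp f).integrable_mul (Lp.memLp g)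

theorem integral_congr_half {f g : ℝ → ℝ} (h : ∀ᵐ x, x ∈ Ioo (0 : ℝ) 1 → f x = g x) :
    ∫ x, f x ∂μH = ∫ x, g x ∂μH :=
  integral_congr_ae (by rwa [EventuallyEq, ae_restrict_iff' measurableSet_Ioo])

/-- The operator is symmetric. -/
theorem inner_graph {c : ℝ} (hc : c ∈ Ioo (-1 / 4 : ℝ) (3 / 4)) {f h g k : L2I}
    (hf : (f, h) ∈ graph c) (hg : (g, k) ∈ graph c) : ⟪h, g⟫_ℝ = ⟪f, k⟫_ℝ := by
  obtain ⟨p, hp⟩ := mem_graph.1 hf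
  obtain ⟨q, hq⟩ := mem_graph.1 hg
  obtain ⟨F, F₁, G, G₁, a1, a2, a3, a4⟩ := exists_halves hc hp
  obtain ⟨F', F₁', G', G₁', b1, b2, b3, b4⟩ := exists_halves hc hq
  obtain ⟨-, -, -, -, -, -, hp1, hp2, -⟩ := hp
  obtain ⟨-, -, -, -, -, -, hq1, hq2, -⟩ := hq
  simp only at hp1 hp2 hq1 hq2
  have w1 := HalfSol.integral_wronskian (nu_pos hc) (nu_lt_one hc) a1 b1
  have w2 := HalfSol.integral_wronskian (nu_pos hc) (nu_lt_one hc) a2 b2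
  rw [← sub_eq_zero, inner_eq_integral, inner_eq_integral,
    ← integral_sub (integrable_mul h g) (integrable_mul f k),
    integral_halves (f := fun x => h x * g x - f x * k x)
      ((integrable_mul h g).sub (integrable_mul f k))]
  have e1 : ∫ x, (h x * g x - f x * k x) ∂μH = ∫ x, (F' x * h x - F x * k x) ∂μH := by
    refine integral_congr_half ?_
    filter_upwards [a3, b3] with x h1 h2 hx
    rw [h1 hx, h2 hx]; ring
  have e2 : ∫ x, (h (-x) * g (-x) - f (-x) * k (-x)) ∂μH
      = ∫ x, (G' x * h (-x) - G x * k (-x)) ∂μH := by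
    refine integral_congr_half ?_
    filter_upwards [a4, b4] with x h1 h2 hx
    rw [h1 hx, h2 hx]; ring
  rw [e1, e2, w1, w2]
  set ν := nu c
  -- With a = s + t and b = (ν + 1/2)s + (-ν + 1/2)t for a coefficient pair (s, t), the boundary
  -- form is 2ν(st' - ts') = a'b - ab'. The transmission conditions say that a changes sign across 0
  -- while b does not, so the two halves cancel.
  linear_combination -((ν + 1 / 2) * q 2 + (-ν + 1 / 2) * q 3) * hp1
    - (p 0 + p 1) * hq2 + ((ν + 1 / 2) * p 2 + (-ν + 1 / 2) * p 3) * hq1 + (q 0 + q 1) * hp2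

theorem eq_zero_of_graph_zero {c : ℝ} (hc : c ∈ Ioo (-1 / 4 : ℝ) (3 / 4)) {h : L2I}
    (hh : ((0 : L2I), h) ∈ graph c) : h = 0 := by
  obtain ⟨p, hp⟩ := mem_graph.1 hh
  obtain ⟨F, F₁, G, G₁, a1, a2, a3, a4⟩ := exists_halves hc hp
  have z := Lp.coeFn_zero ℝ 2 μI
  have h1 := a1.rhs_eq_zero (by
    filter_upwards [a3, ae_right z] with x e1 e2 hx
    rw [← e1 hx, e2 hx, Pi.zero_apply])
  have h2 := a2.rhs_eq_zero (by
    filter_upwards [a4, ae_left z] with x e1 e2 hx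
    rw [← e1 hx, e2 hx, Pi.zero_apply])
  refine Lp.ext ?_
  filter_upwards [ae_of_halves h1 h2, z] with x e1 e2
  rw [e1, e2, Pi.zero_apply]

/-- The form is nonnegative on functions without singular part. -/
theorem inner_nonneg_of_coeff {c : ℝ} (hc : c ∈ Ioo (-1 / 4 : ℝ) (3 / 4)) {f h : L2I}
    (hp : (f, h, (0 : Fin 4 → ℝ)) ∈ coeffGraph c) : 0 ≤ ⟪f, h⟫_ℝ := by
  obtain ⟨F, F₁, G, G₁, a1, a2, a3, a4⟩ := exists_halves hc hp
  rw [inner_eq_integral, integral_halves (integrable_mul f h)]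
  refine add_nonneg ?_ ?_
  · refine a1.integral_mul_nonneg.trans_eq (integral_congr_half ?_)
    filter_upwards [a3] with x e hx
    rw [e hx]
  · refine a2.integral_mul_nonneg.trans_eq (integral_congr_half ?_)
    filter_upwards [a4] with x e hx
    rw [e hx]

/-- The eigenvalues are bounded below. -/
theorem exists_lower_bound {c : ℝ} (hc : c ∈ Ioo (-1 / 4 : ℝ) (3 / 4)) {ι : Type*}
    {b : ι → L2I} (hb : Orthonormal ℝ b) {l : ι → ℝ} (h : ∀ i, (b i, l i • b i) ∈ graph c) :
    ∃ m, 0 ≤ m ∧ ∀ i, -m ≤ l i := by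
  -- Five negative eigenvalues would give five coefficient vectors in ℝ⁴, hence a nontrivial
  -- combination of eigenvectors without singular part. Its form is nonnegative by Hardy, yet equals
  -- ∑ gᵢ² lᵢ < 0.
  have hfin : {i | l i < 0}.Finite := by
    by_contra hinf
    obtain ⟨s, hs, hcard⟩ := (show {i | l i < 0}.Infinite from hinf).exists_subset_card_eq 5
    choose k hk using fun i => mem_graph.1 (h i)
    have hdep : ¬ LinearIndependent ℝ fun i : s => k i := by
      intro hli
      have := hli.fintype_card_le_finrank
      simp [hcard] at this
    obtain ⟨g, hg, j, hj⟩ := Fintype.not_linearIndependent_iff.1 hdep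
    have hmem : ∑ i : s, g i • ((b i, l i • b i, k i) : L2I × L2I × (Fin 4 → ℝ)) ∈ coeffGraph c :=
      Submodule.sum_mem _ fun i _ => Submodule.smul_mem _ _ (hk i)
    have e : ∑ i : s, g i • ((b i, l i • b i, k i) : L2I × L2I × (Fin 4 → ℝ))
        = (∑ i : s, g i • b i, ∑ i : s, (g i * l i) • b i, 0) := by
      refine Prod.ext ?_ (Prod.ext ?_ ?_)
      · simp [Prod.fst_sum]
      · simp [Prod.fst_sum, Prod.snd_sum, smul_smul]
      · simpa [Prod.snd_sum] using hg
    rw [e] at hmem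
    have hpos := inner_nonneg_of_coeff hc hmem
    have hon : Orthonormal ℝ fun i : s => b i := hb.comp _ Subtype.val_injective
    rw [hon.inner_sum] at hpos
    refine hpos.not_gt (Finset.sum_neg' (fun i _ => ?_) ⟨j, Finset.mem_univ j, ?_⟩)
    · have : l i < 0 := hs i.2
      simp only [conj_trivial]
      nlinarith [mul_self_nonneg (g i)]
    · have : l j < 0 := hs j.2
      simp only [conj_trivial]
      nlinarith [mul_self_pos.2 hj]
  refine ⟨∑ i ∈ hfin.toFinset, -l i, Finset.sum_nonneg fun i hi => ?_, fun i => ?_⟩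
  · have : l i < 0 := by simpa using hi
    linarith
  · have h0 : ∀ i ∈ hfin.toFinset, 0 ≤ -l i := fun i hi => by
      have : l i < 0 := by simpa using hi
      linarith
    by_cases hi : l i < 0
    · have := Finset.single_le_sum h0 (by simpa using hi : i ∈ hfin.toFinset)
      linarith
    · have := Finset.sum_nonneg h0
      linarith

/-- Eigenfunctions vanishing on an open set vanish. -/
theorem eq_zero_of_eigenfunction {c : ℝ} (hc : c ∈ Ioo (-1 / 4 : ℝ) (3 / 4)) {ω : Set ℝ}
    (hω : IsOpen ω) (hne : ω.Nonempty) (hsub : ω ⊆ Ioo (-1) 1) {v : ℝ} {f : L2I}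
    (hf : (f, v • f) ∈ graph c) (h0 : ∀ᵐ x ∂μI, x ∈ ω → f x = 0) : f = 0 := by
  have hν := nu_pos hc
  have hν1 := nu_lt_one hc
  obtain ⟨p, hp⟩ := mem_graph.1 hf
  obtain ⟨F, F₁, G, G₁, a1, a2, a3, a4⟩ := exists_halves hc hp
  obtain ⟨-, -, -, -, -, -, hp1, hp2, -⟩ := hp
  simp only at hp1 hp2
  have hs := Lp.coeFn_smul v f
  have hvF : ∀ᵐ x, x ∈ Ioo (0 : ℝ) 1 → (v • f : L2I) x = v * F x := by
    filter_upwards [a3, ae_right hs] with x e1 e2 hx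
    rw [e2 hx, Pi.smul_apply, smul_eq_mul, e1 hx]
  have hvG : ∀ᵐ x, x ∈ Ioo (0 : ℝ) 1 → (v • f : L2I) (-x) = v * G x := by
    filter_upwards [a4, ae_left hs] with x e1 e2 hx
    rw [e2 hx, Pi.smul_apply, smul_eq_mul, e1 hx]
  suffices hz : (∀ x ∈ Ioo (0 : ℝ) 1, F x = 0) ∧ ∀ x ∈ Ioo (0 : ℝ) 1, G x = 0 by
    refine Lp.ext ?_
    have := ae_of_halves (P := fun x => f x = 0)
      (by filter_upwards [a3] with x e hx; rw [e hx, hz.1 x hx])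
      (by filter_upwards [a4] with x e hx; rw [e hx, hz.2 x hx])
    filter_upwards [this, Lp.coeFn_zero ℝ 2 μI] with x e1 e2
    rw [e1, e2, Pi.zero_apply]
  -- The two transmission functionals of one side are independent because ν ≠ 0.
  have coeff_zero : ∀ {s t : ℝ}, s + t = 0 → (nu c + 1 / 2) * s + (-nu c + 1 / 2) * t = 0 →
      s = 0 ∧ t = 0 := fun {s t} h1 h2 => by
    have h3 : 2 * nu c * s = 0 := by linear_combination h2 + (nu c - 1 / 2) * h1
    have h4 : s = 0 := by
      rcases mul_eq_zero.1 h3 with h | h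
      · linarith
      · exact h
    exact ⟨h4, by linarith⟩
  -- Any interval around a nonzero point of ω, cut to one half, suffices to start.
  obtain ⟨y, hy, hy0⟩ : ∃ y ∈ ω, y ≠ 0 := by
    obtain ⟨y, hy⟩ := (dense_compl_singleton (0 : ℝ)).inter_open_nonempty ω hω hne
    exact ⟨y, hy.1, hy.2⟩
  obtain ⟨ε, hε, hball⟩ := Metric.isOpen_iff.1 hω y hy
  rw [Real.ball_eq_Ioo] at hball
  rcases hy0.lt_or_gt with hneg | hpos
  · have hG : ∀ x ∈ Ioo (0 : ℝ) 1, G x = 0 := by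
      refine a2.eq_zero_of_eq_zero_on hvG hν (a := max 0 (-y - ε)) (b := min 1 (-y + ε))
        (le_max_left _ _) ?_ (min_le_left _ _) ?_
      · refine max_lt (lt_min one_pos (by linarith)) (lt_min ?_ (by linarith))
        linarith [(hsub hy).1]
      · filter_upwards [a4, ae_left h0] with x e1 e2 hx
        have hx' : x ∈ Ioo (0 : ℝ) 1 :=
          ⟨(le_max_left _ _).trans_lt hx.1, hx.2.trans_le (min_le_left _ _)⟩
        rw [← e1 hx']
        refine e2 hx' (hball ⟨?_, ?_⟩)
        · linarith [hx.2.trans_le (min_le_right _ _)]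
        · linarith [(le_max_right 0 (-y - ε)).trans_lt hx.1]
    -- Vanishing crosses the singularity here: zero coefficients on this side force zero
    -- coefficients on the other through the transmission conditions, and uniqueness from the
    -- singularity finishes.
    obtain ⟨c0, c1⟩ := a2.coeff_eq_zero hν hν1 hG
    rw [c0, c1] at hp1 hp2
    obtain ⟨c2, c3⟩ := coeff_zero (s := p 2) (t := p 3) (by linarith) (by linarith)
    rw [c2, c3] at a1
    exact ⟨a1.eq_zero_of_coeff hvF hν hν1, hG⟩
  · have hF : ∀ x ∈ Ioo (0 : ℝ) 1, F x = 0 := by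
      refine a1.eq_zero_of_eq_zero_on hvF hν (a := max 0 (y - ε)) (b := min 1 (y + ε))
        (le_max_left _ _) ?_ (min_le_left _ _) ?_
      · refine max_lt (lt_min one_pos (by linarith)) (lt_min ?_ (by linarith))
        linarith [(hsub hy).2]
      · filter_upwards [a3, ae_right h0] with x e1 e2 hx
        have hx' : x ∈ Ioo (0 : ℝ) 1 :=
          ⟨(le_max_left _ _).trans_lt hx.1, hx.2.trans_le (min_le_left _ _)⟩
        rw [← e1 hx']
        refine e2 hx' (hball ⟨?_, ?_⟩)
        · linarith [(le_max_right 0 (y - ε)).trans_lt hx.1]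
        · linarith [hx.2.trans_le (min_le_right _ _)]
    obtain ⟨c2, c3⟩ := a1.coeff_eq_zero hν hν1 hF
    rw [c2, c3] at hp1 hp2
    obtain ⟨c0, c1⟩ := coeff_zero (s := p 0) (t := p 1) (by linarith) (by linarith)
    rw [c0, c1] at a2
    exact ⟨hF, a2.eq_zero_of_coeff hvG hν hν1⟩

end Operator

/-! ### Solving the equation on (0, 1) by variation of constants -/

section Green

open Filter Topology

/-- The weighted primitive `∫₀ˣ sᵃ h(s) ds`. -/
def wprim (a : ℝ) (h : ℝ → ℝ) (x : ℝ) : ℝ := ∫ s in (0 : ℝ)..x, s ^ a * h s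

variable {a : ℝ} {h : ℝ → ℝ}

theorem intervalIntegrable_rpow_mul (ha : -(1 / 2) < a) (hh : MemLp h 2 μH) :
    IntervalIntegrable (fun s => s ^ a * h s) volume 0 1 := by
  rw [intervalIntegrable_iff_integrableOn_Ioo_of_le zero_le_one]
  exact (memLp_rpow ha).integrable_mul hh

theorem abs_wprim_le (ha : -(1 / 2) < a) (hh : MemLp h 2 μH) {M : ℝ}
    (hM : ∫ s, h s ^ 2 ∂μH ≤ M) {x : ℝ} (hx : x ∈ Icc (0 : ℝ) 1) :
    |wprim a h x| ≤ √((2 * a + 1)⁻¹ * M) * x ^ (a + 1 / 2) := by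
  refine (abs_integral_rpow_mul_le ha hh hx).trans ?_
  have : 0 ≤ (2 * a + 1)⁻¹ := inv_nonneg.2 (by linarith)
  have := Real.rpow_nonneg hx.1 (a + 1 / 2)
  gcongr

theorem ac_wprim (ha : -(1 / 2) < a) (hh : MemLp h 2 μH) :
    AbsolutelyContinuousOnInterval (wprim a h) 0 1 :=
  (intervalIntegrable_rpow_mul ha hh).absolutelyContinuousOnInterval_intervalIntegral (by simp)

theorem ac_wprim_of_pos (ha : -(1 / 2) < a) (hh : MemLp h 2 μH) {ε : ℝ} (hε : ε ∈ Ioo (0 : ℝ) 1) :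
    AbsolutelyContinuousOnInterval (wprim a h) ε 1 :=
  (ac_wprim ha hh).mono (uIcc_subset_uIcc (by simp [uIcc_of_le, hε.1.le, hε.2.le]) (by simp))

theorem ac_rpow (b : ℝ) {ε : ℝ} (hε : 0 < ε) :
    AbsolutelyContinuousOnInterval (fun x : ℝ => x ^ b) ε 1 :=
  (contDiffOn_rpow b hε).absolutelyContinuousOnInterval

theorem ae_hasDerivAt_wprim (ha : -(1 / 2) < a) (hh : MemLp h 2 μH) :
    ∀ᵐ x, x ∈ Ioo (0 : ℝ) 1 → HasDerivAt (wprim a h) (x ^ a * h x) x := by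
  filter_upwards [(intervalIntegrable_rpow_mul ha hh).ae_hasDerivAt_integral] with x hx hx'
  exact hx (by rw [uIcc_of_le zero_le_one]; exact Ioo_subset_Icc_self hx') 0 (by simp)

/-- **Hardy's inequality** for the weighted primitive. -/
theorem memLp_hardy (ha : -(1 / 2) < a) (hh : MemLp h 2 μH) :
    MemLp (fun x => x ^ (-a - 1) * wprim a h x) 2 μH := by
  set w : ℝ → ℝ := fun x => x ^ (-a - 1) * wprim a h x with hw
  set κ := 2 * a + 1 with hκ
  have hκ0 : 0 < κ := by rw [hκ]; linarith
  have hac : ∀ ε ∈ Ioo (0 : ℝ) 1, AbsolutelyContinuousOnInterval w ε 1 := fun ε hε =>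
    (ac_rpow _ hε.1).mul (ac_wprim_of_pos ha hh hε)
  have hwc : ∀ ε ∈ Ioo (0 : ℝ) 1, ContinuousOn w (uIcc ε 1) := fun ε hε => (hac ε hε).continuousOn
  have hwo : ContinuousOn w (Ioo 0 1) := fun s hs =>
    ((hwc (s / 2) ⟨half_pos hs.1, by linarith [hs.1, hs.2]⟩).continuousAt
      (by
        rw [uIcc_of_le (by linarith [hs.2])]
        exact Icc_mem_nhds (by linarith [hs.1]) hs.2)).continuousWithinAt
  rw [memLp_two_iff_integrable_sq (hwo.aestronglyMeasurable measurableSet_Ioo)]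
  set N := ∫ s, h s ^ 2 ∂μH with hN
  -- P' = -κ w² + 2 w h, so integrating over (ε, 1) bounds the integral of w² by a cross term and
  -- P(ε). Young's inequality absorbs half of κ∫w², and Cauchy–Schwarz gives P(ε) ≤ N/κ; together
  -- (2/κ)(2/κ + 1/κ)N = 6N/κ², independent of ε.
  set P : ℝ → ℝ := fun x => x ^ (-κ) * (wprim a h x * wprim a h x) with hP
  have hbound : ∀ ε ∈ Ioo (0 : ℝ) 1, ∫ x in ε..1, w x ^ 2 ≤ 6 / κ ^ 2 * N := by
    intro ε hε
    have hle : volume.restrict (Ioc ε 1) ≤ μH := by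
      rw [show μH = volume.restrict (Ioc (0 : ℝ) 1) from restrict_Ioo_eq_restrict_Ioc]
      exact Measure.restrict_mono (Ioc_subset_Ioc_left hε.1.le) le_rfl
    have hPac : AbsolutelyContinuousOnInterval P ε 1 :=
      (ac_rpow _ hε.1).mul ((ac_wprim_of_pos ha hh hε).mul (ac_wprim_of_pos ha hh hε))
    have hd : ∀ᵐ x, x ∈ uIoc ε 1 → HasDerivAt P (-κ * w x ^ 2 + 2 * (w x * h x)) x := by
      refine HalfSol.ae_uIoc ?_ hε
      filter_upwards [ae_hasDerivAt_wprim ha hh] with x hx hx'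
      have d := hx hx'
      refine ((Real.hasDerivAt_rpow_const (p := -κ) (Or.inl hx'.1.ne')).mul (d.mul d)).congr_deriv ?_
      have e1 : x ^ (-κ - 1) = x ^ (-a - 1) * x ^ (-a - 1) := by
        rw [← Real.rpow_add hx'.1]; congr 1; rw [hκ]; ring
      have e2 : x ^ (-κ) * x ^ a = x ^ (-a - 1) := by
        rw [← Real.rpow_add hx'.1]; congr 1; rw [hκ]; ring
      simp only [hw, Pi.mul_apply]
      rw [e1]
      linear_combination 2 * wprim a h x * h x * e2
    have hF := integral_eq_sub_of_ae_hasDerivAt hPac hd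
    have i1 : IntervalIntegrable (fun x => w x ^ 2) volume ε 1 :=
      ((hwc ε hε).pow 2).intervalIntegrable
    have ih : IntervalIntegrable h volume ε 1 :=
      (intervalIntegrable_of_memLp hh).mono_set
        (uIcc_subset_uIcc (by simp [uIcc_of_le, hε.1.le, hε.2.le]) (by simp))
    have i2 : IntervalIntegrable (fun x => w x * h x) volume ε 1 :=
      ih.continuousOn_mul (hwc ε hε)
    have i3 : IntervalIntegrable (fun x => h x ^ 2) volume ε 1 := by
      rw [intervalIntegrable_iff_integrableOn_Ioc_of_le hε.2.le]
      exact hh.integrable_sq.mono_measure hle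
    rw [intervalIntegral.integral_add (i1.const_mul _) (i2.const_mul _),
      intervalIntegral.integral_const_mul, intervalIntegral.integral_const_mul] at hF
    have hwh : 2 * ∫ x in ε..1, w x * h x ≤ κ / 2 * (∫ x in ε..1, w x ^ 2)
        + 2 / κ * ∫ x in ε..1, h x ^ 2 := by
      rw [← intervalIntegral.integral_const_mul, ← intervalIntegral.integral_const_mul,
        ← intervalIntegral.integral_const_mul,
        ← intervalIntegral.integral_add (i1.const_mul _) (i3.const_mul _)]
      refine intervalIntegral.integral_mono_on hε.2.le (i2.const_mul _)
        ((i1.const_mul _).add (i3.const_mul _)) fun x _ => ?_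
      have : 0 ≤ κ / 2 * (w x - 2 / κ * h x) ^ 2 := by positivity
      have e : κ / 2 * (w x - 2 / κ * h x) ^ 2
          = κ / 2 * w x ^ 2 + 2 / κ * h x ^ 2 - 2 * (w x * h x) := by
        field_simp; ring
      linarith
    have hN' : ∫ x in ε..1, h x ^ 2 ≤ N := by
      rw [intervalIntegral.integral_of_le hε.2.le]
      exact integral_mono_measure hle (ae_of_all _ fun s => sq_nonneg _) hh.integrable_sq
    have hP1 : 0 ≤ P 1 := by simp [hP, mul_self_nonneg]
    have hPε : P ε ≤ κ⁻¹ * N := by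
      have hN0 : 0 ≤ N := integral_nonneg fun s => sq_nonneg _
      have h1 := abs_wprim_le ha hh (le_refl N) ⟨hε.1.le, hε.2.le⟩
      have h2 : wprim a h ε * wprim a h ε ≤ κ⁻¹ * N * ε ^ κ := by
        rw [← abs_mul_abs_self]
        refine (mul_self_le_mul_self (abs_nonneg _) h1).trans_eq ?_
        have h3 : √(κ⁻¹ * N) * √(κ⁻¹ * N) = κ⁻¹ * N := Real.mul_self_sqrt (by positivity)
        have h4 : ε ^ (a + 1 / 2) * ε ^ (a + 1 / 2) = ε ^ κ := by
          rw [← Real.rpow_add hε.1]; congr 1; rw [hκ]; ring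
        calc _ = (√(κ⁻¹ * N) * √(κ⁻¹ * N)) * (ε ^ (a + 1 / 2) * ε ^ (a + 1 / 2)) := by ring
          _ = _ := by rw [h3, h4]
      calc P ε ≤ ε ^ (-κ) * (κ⁻¹ * N * ε ^ κ) :=
            mul_le_mul_of_nonneg_left h2 (Real.rpow_nonneg hε.1.le _)
        _ = κ⁻¹ * N := by
            rw [Real.rpow_neg hε.1.le]
            have := (Real.rpow_pos_of_pos hε.1 κ).ne'
            field_simp
    have key : κ / 2 * (∫ x in ε..1, w x ^ 2) ≤ 3 / κ * N := by
      have : 2 / κ * (∫ x in ε..1, h x ^ 2) ≤ 2 / κ * N := by gcongr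
      have e : 3 / κ * N = 2 / κ * N + κ⁻¹ * N := by field_simp; ring
      rw [e]
      linarith
    calc ∫ x in ε..1, w x ^ 2 = 2 / κ * (κ / 2 * (∫ x in ε..1, w x ^ 2)) := by field_simp
      _ ≤ 2 / κ * (3 / κ * N) := by gcongr
      _ = 6 / κ ^ 2 * N := by field_simp; ring
  -- The left endpoints 1/(n + 2) tend to 0 and, unlike 1/(n + 1), stay below 1 from n = 0 on.
  have hseq : ∀ n : ℕ, (1 : ℝ) / (n + 2) ∈ Ioo (0 : ℝ) 1 := fun n => by
    have : (0 : ℝ) < n + 2 := by positivity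
    refine ⟨by positivity, ?_⟩
    rw [div_lt_one this]
    have : (0 : ℝ) ≤ n := Nat.cast_nonneg n
    linarith
  have hlim : Tendsto (fun n : ℕ => (1 : ℝ) / (n + 2)) atTop (𝓝 0) := by
    have := (tendsto_add_atTop_iff_nat 1).2 (tendsto_one_div_add_atTop_nhds_zero_nat (𝕜 := ℝ))
    refine this.congr fun n => ?_
    push_cast
    ring
  have := integrableOn_Ioc_of_intervalIntegral_norm_bounded_left (f := fun x => w x ^ 2) (b := 1)
    (I := 6 / κ ^ 2 * N) (l := atTop) (fun n : ℕ => ?_) hlim (Eventually.of_forall fun n => ?_)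
  · rwa [integrableOn_Ioc_iff_integrableOn_Ioo] at this
  · rw [← intervalIntegrable_iff_integrableOn_Ioc_of_le (hseq n).2.le]
    exact ((hwc _ (hseq n)).pow 2).intervalIntegrable
  · refine (hbound _ (hseq n)).trans' (le_of_eq ?_)
    rw [intervalIntegral.integral_of_le (hseq n).2.le]
    refine integral_congr_ae (ae_of_all _ fun x => ?_)
    exact Real.norm_of_nonneg (sq_nonneg _)

/-- A function that is absolutely continuous away from `0` and tends to `0` there is the primitive
of its derivative. -/
theorem eq_integral_of_ac {f g : ℝ → ℝ} (hac : ∀ ε ∈ Ioo (0 : ℝ) 1, AbsolutelyContinuousOnInterval f ε 1)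
    (hd : ∀ᵐ x, x ∈ Ioo (0 : ℝ) 1 → HasDerivAt f (g x) x) (hg : IntervalIntegrable g volume 0 1)
    (h0 : f 0 = 0) (hlim : Tendsto f (𝓝[>] 0) (𝓝 0)) :
    ∀ x ∈ Icc (0 : ℝ) 1, f x = ∫ s in (0 : ℝ)..x, g s := by
  intro x hx
  rcases hx.1.eq_or_lt with rfl | hx0
  · rw [h0, intervalIntegral.integral_same]
  have h1 : ∀ ε ∈ Ioo (0 : ℝ) x, f x = f ε + ((∫ s in (0 : ℝ)..x, g s) - ∫ s in (0 : ℝ)..ε, g s) := by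
    intro ε hε
    have hε1 : ε < 1 := hε.2.trans_le hx.2
    have hsub : ∀ y ∈ Icc (0 : ℝ) 1, IntervalIntegrable g volume 0 y := fun y hy =>
      hg.mono_set (uIcc_subset_uIcc (by simp) (by rw [uIcc_of_le zero_le_one]; exact hy))
    rw [intervalIntegral.integral_interval_sub_left (hsub x hx) (hsub ε ⟨hε.1.le, hε1.le⟩),
      integral_eq_sub_of_ae_hasDerivAt (f := f) ((hac ε ⟨hε.1, hε1⟩).mono ?_)]
    · ring
    · filter_upwards [HalfSol.ae_uIoc hd ⟨hε.1, hε1⟩] with y hy hy'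
      refine hy ?_
      rw [uIoc_of_le hε.2.le] at hy'
      rw [uIoc_of_le hε1.le]
      exact ⟨hy'.1, hy'.2.trans hx.2⟩
    · exact uIcc_subset_uIcc (by simp) (by rw [uIcc_of_le hε1.le]; exact ⟨hε.2.le, hx.2⟩)
  have h2 : Tendsto (fun ε => ∫ s in (0 : ℝ)..ε, g s) (𝓝[>] 0) (𝓝 0) := by
    have := intervalIntegral.continuousOn_primitive_interval' hg (a := 0) (by simp) 0 (by simp)
    rw [ContinuousWithinAt, intervalIntegral.integral_same, uIcc_of_le zero_le_one] at this
    exact this.mono_left (nhdsWithin_le_of_mem (Icc_mem_nhdsGT one_pos))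
  have h3 : Tendsto (fun ε => f ε + ((∫ s in (0 : ℝ)..x, g s) - ∫ s in (0 : ℝ)..ε, g s)) (𝓝[>] 0)
      (𝓝 (0 + ((∫ s in (0 : ℝ)..x, g s) - 0))) := hlim.add (h2.const_sub _)
  have h4 : Tendsto (fun _ : ℝ => f x) (𝓝[>] 0) (𝓝 (f x)) := tendsto_const_nhds
  have := tendsto_nhds_unique (h4.congr' ?_) h3
  · simpa using this
  · filter_upwards [Ioo_mem_nhdsGT hx0] with ε hε using h1 ε hε

/-- The solution of `-V'' + (ν² - 1/4) / x² V = h` without singular part. -/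
def green (ν : ℝ) (h : ℝ → ℝ) (x : ℝ) : ℝ :=
  (2 * ν)⁻¹ * (x ^ (-ν + 1 / 2) * wprim (ν + 1 / 2) h x - x ^ (ν + 1 / 2) * wprim (-ν + 1 / 2) h x)

/-- The derivative of `green`. -/
def greenDeriv (ν : ℝ) (h : ℝ → ℝ) (x : ℝ) : ℝ :=
  (2 * ν)⁻¹ * ((-ν + 1 / 2) * (x ^ (-ν - 1 / 2) * wprim (ν + 1 / 2) h x)
    - (ν + 1 / 2) * (x ^ (ν - 1 / 2) * wprim (-ν + 1 / 2) h x))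

/-- A bound for `greenDeriv` in terms of the squared norm of the right hand side. -/
def greenBound (ν M : ℝ) : ℝ :=
  (2 * ν)⁻¹ * (|-ν + 1 / 2| * √((2 * (ν + 1 / 2) + 1)⁻¹ * M)
    + (ν + 1 / 2) * √((2 * (-ν + 1 / 2) + 1)⁻¹ * M))

variable {ν : ℝ}

theorem greenBound_nonneg (hν : 0 < ν) (M : ℝ) : 0 ≤ greenBound ν M := by
  unfold greenBound; positivity

/-- The powers x^{∓ν - 1/2} multiply the bounds x^{±ν + 1} of the weighted primitives to x^{1/2}.
The bound is uniform over right-hand sides with squared norm at most M, which later gives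
compactness. -/
theorem abs_greenDeriv_le (hν : 0 < ν) (hν1 : ν < 1) (hh : MemLp h 2 μH) {M : ℝ}
    (hM : ∫ s, h s ^ 2 ∂μH ≤ M) {x : ℝ} (hx : x ∈ Ioc (0 : ℝ) 1) :
    |greenDeriv ν h x| ≤ greenBound ν M * x ^ (1 / 2 : ℝ) := by
  have hx' : x ∈ Icc (0 : ℝ) 1 := ⟨hx.1.le, hx.2⟩
  have b1 := abs_wprim_le (a := ν + 1 / 2) (by linarith) hh hM hx'
  have b2 := abs_wprim_le (a := -ν + 1 / 2) (by linarith) hh hM hx'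
  have c1 : |x ^ (-ν - 1 / 2) * wprim (ν + 1 / 2) h x|
      ≤ √((2 * (ν + 1 / 2) + 1)⁻¹ * M) * x ^ (1 / 2 : ℝ) := by
    rw [abs_mul, abs_of_nonneg (Real.rpow_nonneg hx.1.le _)]
    refine (mul_le_mul_of_nonneg_left b1 (Real.rpow_nonneg hx.1.le _)).trans_eq ?_
    rw [mul_left_comm, ← Real.rpow_add hx.1]
    congr 2; ring
  have c2 : |x ^ (ν - 1 / 2) * wprim (-ν + 1 / 2) h x|
      ≤ √((2 * (-ν + 1 / 2) + 1)⁻¹ * M) * x ^ (1 / 2 : ℝ) := by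
    rw [abs_mul, abs_of_nonneg (Real.rpow_nonneg hx.1.le _)]
    refine (mul_le_mul_of_nonneg_left b2 (Real.rpow_nonneg hx.1.le _)).trans_eq ?_
    rw [mul_left_comm, ← Real.rpow_add hx.1]
    congr 2; ring
  rw [greenDeriv, greenBound, abs_mul, abs_of_pos (by positivity : 0 < (2 * ν)⁻¹), mul_assoc]
  refine mul_le_mul_of_nonneg_left ?_ (by positivity)
  refine (abs_sub _ _).trans ?_
  rw [abs_mul (-ν + 1 / 2), abs_mul (ν + 1 / 2), abs_of_pos (by linarith : 0 < ν + 1 / 2)]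
  refine (add_le_add (mul_le_mul_of_nonneg_left c1 (abs_nonneg _))
    (mul_le_mul_of_nonneg_left c2 (by linarith))).trans_eq ?_
  ring

/-- Variation of constants: the two terms containing h cancel, both powers of x multiplying to x.
One derivative later, in `hasDerivAt_greenDeriv`, they add up to -h. -/
theorem hasDerivAt_green {x : ℝ} (hx : 0 < x)
    (d1 : HasDerivAt (wprim (ν + 1 / 2) h) (x ^ (ν + 1 / 2) * h x) x)
    (d2 : HasDerivAt (wprim (-ν + 1 / 2) h) (x ^ (-ν + 1 / 2) * h x) x) :
    HasDerivAt (green ν h) (greenDeriv ν h x) x := by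
  have r1 := Real.hasDerivAt_rpow_const (p := ν + 1 / 2) (Or.inl hx.ne')
  have r2 := Real.hasDerivAt_rpow_const (p := -ν + 1 / 2) (Or.inl hx.ne')
  refine (((r2.mul d1).sub (r1.mul d2)).const_mul (2 * ν)⁻¹).congr_deriv ?_
  rw [greenDeriv, show ν + 1 / 2 - 1 = ν - 1 / 2 by ring,
    show -ν + 1 / 2 - 1 = -ν - 1 / 2 by ring]
  ring

theorem hasDerivAt_greenDeriv (hν : 0 < ν) {x : ℝ} (hx : 0 < x)
    (d1 : HasDerivAt (wprim (ν + 1 / 2) h) (x ^ (ν + 1 / 2) * h x) x)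
    (d2 : HasDerivAt (wprim (-ν + 1 / 2) h) (x ^ (-ν + 1 / 2) * h x) x) :
    HasDerivAt (greenDeriv ν h) ((ν ^ 2 - 1 / 4) / x ^ 2 * green ν h x - h x) x := by
  have r1 := Real.hasDerivAt_rpow_const (p := ν - 1 / 2) (Or.inl hx.ne')
  have r2 := Real.hasDerivAt_rpow_const (p := -ν - 1 / 2) (Or.inl hx.ne')
  refine ((((r2.mul d1).const_mul (-ν + 1 / 2)).sub
    ((r1.mul d2).const_mul (ν + 1 / 2))).const_mul (2 * ν)⁻¹).congr_deriv ?_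
  have e1 : x ^ (ν + 1 / 2) = x ^ (ν - 1 / 2 - 1) * x ^ 2 := by
    rw [← Real.rpow_add_natCast hx.ne']; congr 1; push_cast; ring
  have e2 : x ^ (-ν + 1 / 2) = x ^ (-ν - 1 / 2 - 1) * x ^ 2 := by
    rw [← Real.rpow_add_natCast hx.ne']; congr 1; push_cast; ring
  have e3 : x ^ (-ν - 1 / 2) * x ^ (ν + 1 / 2) = 1 := by
    rw [← Real.rpow_add hx]; ring_nf; exact Real.rpow_zero x
  have e4 : x ^ (ν - 1 / 2) * x ^ (-ν + 1 / 2) = 1 := by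
    rw [← Real.rpow_add hx]; ring_nf; exact Real.rpow_zero x
  have e5 : (ν ^ 2 - 1 / 4) / x ^ 2 * green ν h x = (2 * ν)⁻¹ * (ν ^ 2 - 1 / 4) *
      (x ^ (-ν - 1 / 2 - 1) * wprim (ν + 1 / 2) h x
        - x ^ (ν - 1 / 2 - 1) * wprim (-ν + 1 / 2) h x) := by
    rw [green, e1, e2]
    field_simp
  rw [e5]
  have h2 : (2 * ν)⁻¹ * (2 * ν) = 1 := inv_mul_cancel₀ (by positivity)
  linear_combination (2 * ν)⁻¹ * (-ν + 1 / 2) * h x * e3 - (2 * ν)⁻¹ * (ν + 1 / 2) * h x * e4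
    - h x * h2

/-- The pointwise bound x^{3/2}/x² = x^{-1/2} just misses L², so Hardy's inequality is needed:
division by x² turns each half of `green` into x^{-a-1} ∫₀ˣ sᵃ h with a = ±ν + 1/2. -/
theorem memLp_green_rhs (hν : 0 < ν) (hν1 : ν < 1) (hh : MemLp h 2 μH) :
    MemLp (fun x => (ν ^ 2 - 1 / 4) / x ^ 2 * green ν h x - h x) 2 μH := by
  refine MemLp.sub ?_ hh
  have m1 := memLp_hardy (a := ν + 1 / 2) (by linarith) hh
  have m2 := memLp_hardy (a := -ν + 1 / 2) (by linarith) hh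
  refine ((m1.sub m2).const_mul ((2 * ν)⁻¹ * (ν ^ 2 - 1 / 4))).ae_eq ?_
  filter_upwards [ae_restrict_mem measurableSet_Ioo] with x hx
  have e1 : x ^ (ν + 1 / 2) = x ^ (-(-ν + 1 / 2) - 1) * x ^ 2 := by
    rw [← Real.rpow_add_natCast hx.1.ne']; congr 1; push_cast; ring
  have e2 : x ^ (-ν + 1 / 2) = x ^ (-(ν + 1 / 2) - 1) * x ^ 2 := by
    rw [← Real.rpow_add_natCast hx.1.ne']; congr 1; push_cast; ring
  have := hx.1.ne'
  simp only [Pi.sub_apply, green]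
  rw [e1, e2]
  field_simp

theorem green_zero (ν : ℝ) (h : ℝ → ℝ) : green ν h 0 = 0 := by simp [green, wprim]

theorem greenDeriv_zero (ν : ℝ) (h : ℝ → ℝ) : greenDeriv ν h 0 = 0 := by simp [greenDeriv, wprim]

theorem halfReg_green (hν : 0 < ν) (hν1 : ν < 1) (hh : MemLp h 2 μH) :
    HalfReg (green ν h) (greenDeriv ν h)
      (fun x => (ν ^ 2 - 1 / 4) / x ^ 2 * green ν h x - h x) := by
  have hd1 := ae_hasDerivAt_wprim (a := ν + 1 / 2) (by linarith) hh
  have hd2 := ae_hasDerivAt_wprim (a := -ν + 1 / 2) (by linarith) hh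
  have hL := memLp_green_rhs hν hν1 hh
  have w1 : ∀ ε ∈ Ioo (0 : ℝ) 1, AbsolutelyContinuousOnInterval (wprim (ν + 1 / 2) h) ε 1 :=
    fun ε hε => ac_wprim_of_pos (by linarith) hh hε
  have w2 : ∀ ε ∈ Ioo (0 : ℝ) 1, AbsolutelyContinuousOnInterval (wprim (-ν + 1 / 2) h) ε 1 :=
    fun ε hε => ac_wprim_of_pos (by linarith) hh hε
  have hac : ∀ ε ∈ Ioo (0 : ℝ) 1, AbsolutelyContinuousOnInterval (green ν h) ε 1 := fun ε hε =>
    (((ac_rpow _ hε.1).mul (w1 ε hε)).sub ((ac_rpow _ hε.1).mul (w2 ε hε))).const_mul _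
  have hac1 : ∀ ε ∈ Ioo (0 : ℝ) 1, AbsolutelyContinuousOnInterval (greenDeriv ν h) ε 1 :=
    fun ε hε => ((((ac_rpow _ hε.1).mul (w1 ε hε)).const_mul _).sub
      (((ac_rpow _ hε.1).mul (w2 ε hε)).const_mul _)).const_mul _
  have lim1 : Tendsto (greenDeriv ν h) (𝓝[>] 0) (𝓝 0) := by
    have hb : Tendsto (fun x : ℝ => greenBound ν (∫ s, h s ^ 2 ∂μH) * x ^ (1 / 2 : ℝ)) (𝓝[>] 0)
        (𝓝 0) := by
      simpa using (tendsto_rpow_zero (by norm_num : (0 : ℝ) < 1 / 2)).const_mul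
        (greenBound ν (∫ s, h s ^ 2 ∂μH))
    refine squeeze_zero_norm' ?_ hb
    filter_upwards [Ioc_mem_nhdsGT one_pos] with x hx using abs_greenDeriv_le hν hν1 hh le_rfl hx
  have eq1 := eq_integral_of_ac hac1 (by
    filter_upwards [hd1, hd2] with x h1 h2 hx
    exact hasDerivAt_greenDeriv hν hx.1 (h1 hx) (h2 hx)) (intervalIntegrable_of_memLp hL)
    (greenDeriv_zero ν h) lim1
  have lim0 : Tendsto (green ν h) (𝓝[>] 0) (𝓝 0) := by
    have J : ∀ a : ℝ, -(1 / 2) < a → Tendsto (fun x => x ^ (1 - a) * wprim a h x) (𝓝[>] 0) (𝓝 0) := by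
      intro a ha
      have hb : Tendsto (fun x : ℝ => √((2 * a + 1)⁻¹ * ∫ s, h s ^ 2 ∂μH) * x ^ (3 / 2 : ℝ)) (𝓝[>] 0)
          (𝓝 0) := by
        simpa using (tendsto_rpow_zero (by norm_num : (0 : ℝ) < 3 / 2)).const_mul
          (√((2 * a + 1)⁻¹ * ∫ s, h s ^ 2 ∂μH))
      refine squeeze_zero_norm' ?_ hb
      filter_upwards [Ioc_mem_nhdsGT one_pos] with x hx
      rw [norm_mul, Real.norm_of_nonneg (Real.rpow_nonneg hx.1.le _), Real.norm_eq_abs]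
      refine (mul_le_mul_of_nonneg_left (abs_wprim_le ha hh le_rfl ⟨hx.1.le, hx.2⟩)
        (Real.rpow_nonneg hx.1.le _)).trans_eq ?_
      rw [mul_left_comm, ← Real.rpow_add hx.1]
      congr 2; ring
    have := ((J (ν + 1 / 2) (by linarith)).sub (J (-ν + 1 / 2) (by linarith))).const_mul (2 * ν)⁻¹
    rw [show 1 - (ν + 1 / 2) = -ν + 1 / 2 by ring, show 1 - (-ν + 1 / 2) = ν + 1 / 2 by ring,
      sub_zero, mul_zero] at this
    exact this
  have i1 : IntervalIntegrable (greenDeriv ν h) volume 0 1 := by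
    have := ((intervalIntegrable_of_memLp hL).absolutelyContinuousOnInterval_intervalIntegral
      (c := 0) (by simp)).continuousOn
    rw [uIcc_of_le zero_le_one] at this
    refine ContinuousOn.intervalIntegrable ?_
    rw [uIcc_of_le zero_le_one]
    exact this.congr eq1
  exact ⟨hL, eq1, eq_integral_of_ac hac (by
    filter_upwards [hd1, hd2] with x h1 h2 hx
    exact hasDerivAt_green hx.1 (h1 hx) (h2 hx)) i1 (green_zero ν h) lim0⟩

end Green

/-! ### Gluing the two halves: the compact inverse -/

section Inverse

open Filter Topology
open scoped InnerProductSpace BoundedContinuousFunction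

/-- The function equal to `A` on the right half-line and to the reflection of `B` on the left. -/
def glue (A B : ℝ → ℝ) (x : ℝ) : ℝ := if 0 ≤ x then A x else B (-x)

theorem glue_of_nonneg (A B : ℝ → ℝ) {x : ℝ} (hx : 0 ≤ x) : glue A B x = A x := if_pos hx

theorem glue_of_neg (A B : ℝ → ℝ) {x : ℝ} (hx : x < 0) : glue A B x = B (-x) := if_neg hx.not_ge

theorem memLp_of_halves {f : ℝ → ℝ} (h1 : MemLp f 2 μH) (h2 : MemLp (fun x => f (-x)) 2 μH) :
    MemLp f 2 μI := by
  have h3 : MemLp f 2 (volume.restrict (Ioo (-1 : ℝ) 0)) := by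
    have hmp : MeasurePreserving (fun x : ℝ => -x) (volume.restrict (Ioo (-1 : ℝ) 0)) μH := by
      have h := (Measure.measurePreserving_neg (volume : Measure ℝ)).restrict_preimage
        (s := Ioo (0 : ℝ) 1) measurableSet_Ioo
      have e : (Neg.neg : ℝ → ℝ) ⁻¹' Ioo 0 1 = Ioo (-1) 0 := by
        ext x; simp only [mem_preimage, mem_Ioo]; constructor <;> rintro ⟨h1, h2⟩ <;>
          constructor <;> linarith
      rwa [e] at h
    simpa [Function.comp_def] using h2.comp_measurePreserving hmp
  have i1 : MemLp ((Ioo (0 : ℝ) 1).indicator f) 2 volume :=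
    (memLp_indicator_iff_restrict measurableSet_Ioo).2 h1
  have i2 : MemLp ((Ioo (-1 : ℝ) 0).indicator f) 2 volume :=
    (memLp_indicator_iff_restrict measurableSet_Ioo).2 h3
  refine ((i1.add i2).restrict (Ioo (-1 : ℝ) 1)).ae_eq ?_
  filter_upwards [ae_ne_zero, ae_restrict_mem measurableSet_Ioo] with x hx hx'
  rcases hx.lt_or_gt with h | h
  · simp [indicator, h, h.not_gt, hx'.1]
  · simp [indicator, h, h.not_gt, hx'.2]

theorem memLp_glue {A B : ℝ → ℝ} (hA : MemLp A 2 μH) (hB : MemLp B 2 μH) :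
    MemLp (glue A B) 2 μI := by
  refine memLp_of_halves (hA.ae_eq ?_) (hB.ae_eq ?_)
  · filter_upwards [ae_restrict_mem measurableSet_Ioo] with x hx
    rw [glue_of_nonneg _ _ hx.1.le]
  · filter_upwards [ae_restrict_mem measurableSet_Ioo] with x hx
    rw [glue_of_neg _ _ (neg_lt_zero.2 hx.1), neg_neg]

theorem integral_glue_of_nonneg (A B : ℝ → ℝ) {x : ℝ} (hx : 0 ≤ x) :
    ∫ s in (0 : ℝ)..x, glue A B s = ∫ s in (0 : ℝ)..x, A s := by
  refine intervalIntegral.integral_congr fun s hs => ?_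
  rw [uIcc_of_le hx] at hs
  exact glue_of_nonneg _ _ hs.1

theorem integral_glue_of_neg (A B : ℝ → ℝ) {x : ℝ} (hx : x < 0) :
    ∫ s in (0 : ℝ)..x, glue A B s = -∫ s in (0 : ℝ)..(-x), B s := by
  have : ∫ s in (0 : ℝ)..x, glue A B s = ∫ s in (0 : ℝ)..x, B (-s) := by
    refine intervalIntegral.integral_congr_ae ?_
    filter_upwards [Measure.ae_ne volume 0] with s hs hs'
    rw [uIoc_of_ge hx.le] at hs'
    exact glue_of_neg _ _ (lt_of_le_of_ne hs'.2 hs)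
  rw [this, intervalIntegral.integral_comp_neg, neg_zero, intervalIntegral.integral_symm]

/-- Both halves vanish at 0 together with their derivatives, so no jump arises; reflection changes
the sign of the first derivative only. -/
theorem regPart_glue {R R₁ R₂ L L₁ L₂ : ℝ → ℝ} (hR : HalfReg R R₁ R₂) (hL : HalfReg L L₁ L₂) :
    RegPart (glue R L) (glue R₁ (fun x => -L₁ x)) (glue R₂ L₂) := by
  refine ⟨memLp_glue hR.memLp hL.memLp, fun x hx => ?_, fun x hx => ?_⟩
  · rcases lt_or_ge x 0 with h | h
    · rw [glue_of_neg _ _ h, integral_glue_of_neg _ _ h, hL.deriv_eq _ ⟨by linarith, by linarith [hx.1]⟩]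
    · rw [glue_of_nonneg _ _ h, integral_glue_of_nonneg _ _ h, hR.deriv_eq _ ⟨h, hx.2⟩]
  · rcases lt_or_ge x 0 with h | h
    · rw [glue_of_neg _ _ h, integral_glue_of_neg _ _ h, hL.eq _ ⟨by linarith, by linarith [hx.1]⟩,
        intervalIntegral.integral_neg, neg_neg]
    · rw [glue_of_nonneg _ _ h, integral_glue_of_nonneg _ _ h, hR.eq _ ⟨h, hx.2⟩]

theorem RegPart.abs_sub_le {r r₁ r₂ : ℝ → ℝ} (hr : RegPart r r₁ r₂) {C : ℝ}
    (hC : ∀ x ∈ Icc (-1 : ℝ) 1, |r₁ x| ≤ C) {x y : ℝ} (hx : x ∈ Icc (-1 : ℝ) 1)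
    (hy : y ∈ Icc (-1 : ℝ) 1) : |r x - r y| ≤ C * |x - y| := by
  rw [hr.eq x hx, hr.eq y hy, intervalIntegral.integral_interval_sub_left
    (intervalIntegrable_zero hr.intervalIntegrable_deriv hx)
    (intervalIntegrable_zero hr.intervalIntegrable_deriv hy)]
  refine intervalIntegral.norm_integral_le_of_norm_le_const (f := r₁) (C := C) fun s hs => hC s ?_
  have := uIoc_subset_uIcc hs
  exact ⟨(le_min hy.1 hx.1).trans this.1, this.2.trans (max_le hy.2 hx.2)⟩

/-- The set of `C`-Lipschitz functions on `[-1, 1]` bounded by `C`. -/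
def lipschitzSet (C : ℝ) : Set (Icc (-1 : ℝ) 1 →ᵇ ℝ) :=
  {g | (∀ x, |g x| ≤ C) ∧ ∀ x y, |g x - g y| ≤ C * dist x y}

theorem isCompact_lipschitzSet (C : ℝ) : IsCompact (lipschitzSet C) := by
  refine BoundedContinuousFunction.arzela_ascoli₂ (Icc (-C) C) isCompact_Icc _ ?_
    (fun f x hf => abs_le.1 (hf.1 x)) ?_
  · have hev : ∀ x, Continuous fun g : Icc (-1 : ℝ) 1 →ᵇ ℝ => g x := fun x =>
      (BoundedContinuousFunction.lipschitz_eval_const x).continuous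
    rw [lipschitzSet, ofPred_and, ofPred_forall, ofPred_forall]
    refine IsClosed.inter (isClosed_iInter fun x => isClosed_le (hev x).abs continuous_const)
      (isClosed_iInter fun x => ?_)
    rw [ofPred_forall]
    exact isClosed_iInter fun y => isClosed_le ((hev x).sub (hev y)).abs continuous_const
  · refine Metric.equicontinuous_of_continuity_modulus (fun t => C * t) ?_ _ fun x y g => ?_
    · simpa using (continuous_const_mul C).tendsto 0
    · exact g.2.2 x y

/-- The embedding of continuous functions on `[-1, 1]` into `L²(-1, 1)`. -/
def extendLp (g : Icc (-1 : ℝ) 1 →ᵇ ℝ) : L2I :=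
  BoundedContinuousFunction.toLp 2 μI ℝ
    (g.compContinuous ⟨projIcc (-1 : ℝ) 1 (by norm_num), continuous_projIcc⟩)

theorem continuous_extendLp : Continuous extendLp :=
  (ContinuousLinearMap.continuous _).comp (BoundedContinuousFunction.continuous_compContinuous _)

theorem coeFn_extendLp (g : Icc (-1 : ℝ) 1 →ᵇ ℝ) {r : ℝ → ℝ} (hr : ∀ x : Icc (-1 : ℝ) 1, g x = r x) :
    ∀ᵐ x ∂μI, extendLp g x = r x := by
  filter_upwards [BoundedContinuousFunction.coeFn_toLp 2 μI ℝ (g.compContinuous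
    ⟨projIcc (-1 : ℝ) 1 (by norm_num), continuous_projIcc⟩), ae_restrict_mem measurableSet_Ioo]
    with x hx hx'
  refine hx.trans ?_
  rw [BoundedContinuousFunction.compContinuous_apply, ContinuousMap.coe_mk,
    projIcc_of_mem (by norm_num) (Ioo_subset_Icc_self hx'), hr]

theorem memLp_singularPart {ν : ℝ} (hν : 0 < ν) (hν1 : ν < 1) (m₁ m₂ p₁ p₂ : ℝ) :
    MemLp (singularPart ν m₁ m₂ p₁ p₂) 2 μI := by
  have hp : ∀ q₁ q₂, MemLp (profile ν q₁ q₂) 2 μH := fun q₁ q₂ =>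
    ((memLp_rpow (by linarith)).const_mul q₁).add ((memLp_rpow (by linarith)).const_mul q₂)
  refine memLp_of_halves ((hp p₁ p₂).ae_eq ?_) ((hp m₁ m₂).ae_eq ?_)
  · filter_upwards [ae_restrict_mem measurableSet_Ioo] with x hx
    rw [singularPart_of_pos _ _ _ _ _ hx.1]
  · filter_upwards [ae_restrict_mem measurableSet_Ioo] with x hx
    rw [singularPart_of_neg _ _ _ _ _ (neg_lt_zero.2 hx.1), neg_neg]

/-- The weight is the kernel profile x^{ν+1/2} - x^{-ν+1/2}. Orthogonality of h to the kernel vector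
therefore becomes a relation between the boundary values of the two half solutions. -/
theorem green_one {ν : ℝ} (hν : 0 < ν) (hν1 : ν < 1) {h : ℝ → ℝ} (hh : MemLp h 2 μH) :
    2 * ν * green ν h 1 = ∫ x, profile ν 1 (-1) x * h x ∂μH := by
  have e : ∀ g : ℝ → ℝ, ∫ x in (0 : ℝ)..1, g x = ∫ x, g x ∂μH := fun g => by
    rw [intervalIntegral.integral_of_le zero_le_one, integral_Ioc_eq_integral_Ioo]
  have i : ∀ a : ℝ, -(1 / 2) < a → Integrable (fun x => x ^ a * h x) μH := fun a ha =>
    (memLp_rpow ha).integrable_mul hh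
  rw [green, wprim, wprim, Real.one_rpow, Real.one_rpow, one_mul, one_mul, e, e,
    ← integral_sub (i _ (by linarith)) (i _ (by linarith)), mul_inv_cancel_left₀ (by positivity)]
  refine integral_congr_ae (ae_of_all _ fun x => ?_)
  simp only [profile]
  ring

/-- The operator has a compact inverse modulo its kernel. -/
theorem exists_hasCompactInverse {c : ℝ} (hc : c ∈ Ioo (-1 / 4 : ℝ) (3 / 4)) :
    ∃ φ : L2I, HasCompactInverse (graph c) φ := by
  set ν := nu c with hνdef
  have hν : 0 < ν := nu_pos hc
  have hν1 : ν < 1 := nu_lt_one hc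
  have hΦ := memLp_singularPart hν hν1 1 (-1) 1 (-1)
  refine ⟨hΦ.toLp _, inner_graph hc, ?_, eq_zero_of_graph_zero hc, ?_⟩
  -- The even function |x|^{ν+1/2} - |x|^{-ν+1/2} vanishes at ±1 and satisfies both transmission
  -- conditions, so it spans the kernel.
  · refine mem_graph.2 ⟨![1, -1, 1, -1], 0, 0, 0, RegPart.zero, ?_, ?_, ?_, ?_, ?_, ?_⟩
    · simp
    · simp
    · simp
    · simp
    · filter_upwards [hΦ.coeFn_toLp] with x hx
      simpa using hx
    · filter_upwards [Lp.coeFn_zero ℝ 2 μI] with x hx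
      exact hx.trans (by simp)
  -- The odd singular function with value 1 at x = 1, its two coefficients chosen so that (ν +
  -- 1/2)c₁ + (-ν + 1/2)c₂ = 0 on each side. Both transmission conditions then hold.
  set κ : Fin 4 → ℝ := ![-(1 / 2 - 1 / (4 * ν)), -(1 / 2 + 1 / (4 * ν)), 1 / 2 - 1 / (4 * ν),
    1 / 2 + 1 / (4 * ν)] with hκ
  have hσ := memLp_singularPart hν hν1 (κ 0) (κ 1) (κ 2) (κ 3)
  set σ : L2I := hσ.toLp _ with hσdef
  set C := greenBound ν 1 with hC
  have hC0 : 0 ≤ C := greenBound_nonneg hν 1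
  -- The solutions consist of a Lipschitz regular part, compact by Arzelà–Ascoli, plus a bounded
  -- multiple of the single function σ.
  refine ⟨(fun q : (Icc (-1 : ℝ) 1 →ᵇ ℝ) × ℝ => extendLp q.1 + q.2 • σ) ''
    (lipschitzSet C ×ˢ Icc (-C) C), ((isCompact_lipschitzSet C).prod isCompact_Icc).image
      ((continuous_extendLp.comp continuous_fst).add (continuous_snd.smul continuous_const)), ?_⟩
  intro h hh hφ
  have mR : MemLp h 2 μH := memLp_right (Lp.memLp h)
  have mL : MemLp (fun x => h (-x)) 2 μH := memLp_left (Lp.memLp h)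
  have hnorm : (∫ x, h x ^ 2 ∂μH) + ∫ x, h (-x) ^ 2 ∂μH ≤ 1 := by
    rw [← integral_halves (f := fun x => h x ^ 2) (Lp.memLp h).integrable_sq]
    have e := inner_eq_integral h h
    rw [real_inner_self_eq_norm_sq] at e
    simp_rw [sq] at e ⊢
    rw [← e]
    nlinarith [norm_nonneg h]
  have nR : ∫ x, h x ^ 2 ∂μH ≤ 1 := by
    linarith [(integral_nonneg fun x => sq_nonneg (h (-x)) : 0 ≤ ∫ x, h (-x) ^ 2 ∂μH)]
  have nL : ∫ x, h (-x) ^ 2 ∂μH ≤ 1 := by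
    linarith [(integral_nonneg fun x => sq_nonneg (h x) : 0 ≤ ∫ x, h x ^ 2 ∂μH)]
  set α := green ν h 1 with hα
  -- Orthogonality to the kernel vector makes the boundary values at 1 and -1 opposite, so one odd
  -- correction removes both.
  have hαL : green ν (fun x => h (-x)) 1 = -α := by
    have e1 := green_one hν hν1 mR
    have e2 := green_one hν hν1 mL
    rw [inner_eq_integral, integral_halves (integrable_mul _ _)] at hφ
    have e3 : ∫ x, (hΦ.toLp _ : L2I) x * h x ∂μH = ∫ x, profile ν 1 (-1) x * h x ∂μH := by
      refine integral_congr_half ?_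
      filter_upwards [ae_right hΦ.coeFn_toLp] with x hx hx'
      rw [hx hx', singularPart_of_pos _ _ _ _ _ hx'.1]
    have e4 : ∫ x, (hΦ.toLp _ : L2I) (-x) * h (-x) ∂μH
        = ∫ x, profile ν 1 (-1) x * h (-x) ∂μH := by
      refine integral_congr_half ?_
      filter_upwards [ae_left hΦ.coeFn_toLp] with x hx hx'
      rw [hx hx', singularPart_of_neg _ _ _ _ _ (neg_lt_zero.2 hx'.1), neg_neg]
    rw [e3, e4, ← e1, ← e2, ← mul_add] at hφ
    have := (mul_eq_zero.1 hφ).resolve_left (by positivity)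
    linarith
  have hreg := regPart_glue (halfReg_green hν hν1 mR) (halfReg_green hν hν1 mL)
  set r := glue (green ν h) (green ν fun x => h (-x)) with hr
  have hdb : ∀ (g : ℝ → ℝ), MemLp g 2 μH → ∫ x, g x ^ 2 ∂μH ≤ 1 → ∀ x ∈ Icc (0 : ℝ) 1,
      |greenDeriv ν g x| ≤ C := by
    intro g mg ng x hx
    rcases hx.1.eq_or_lt with h0 | h0
    · rw [← h0, greenDeriv_zero, abs_zero]
      exact hC0
    · exact (abs_greenDeriv_le hν hν1 mg ng ⟨h0, hx.2⟩).trans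
        (mul_le_of_le_one_right hC0 (Real.rpow_le_one hx.1 hx.2 (by norm_num)))
  have hr₁ : ∀ x ∈ Icc (-1 : ℝ) 1,
      |glue (greenDeriv ν h) (fun x => -greenDeriv ν (fun x => h (-x)) x) x| ≤ C := by
    intro x hx
    rcases lt_or_ge x 0 with h0 | h0
    · rw [glue_of_neg _ _ h0, abs_neg]
      exact hdb _ mL nL _ ⟨by linarith, by linarith [hx.1]⟩
    · rw [glue_of_nonneg _ _ h0]
      exact hdb _ mR nR _ ⟨h0, hx.2⟩
  have hlip : ∀ x ∈ Icc (-1 : ℝ) 1, ∀ y ∈ Icc (-1 : ℝ) 1, |r x - r y| ≤ C * |x - y| :=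
    fun x hx y hy => hreg.abs_sub_le hr₁ hx hy
  have hr0 : r 0 = 0 := by rw [hr, glue_of_nonneg _ _ le_rfl, green_zero]
  have hbd : ∀ x ∈ Icc (-1 : ℝ) 1, |r x| ≤ C := fun x hx => by
    have := hlip x hx 0 (by norm_num)
    rw [hr0, sub_zero, sub_zero] at this
    exact this.trans (mul_le_of_le_one_right hC0 (abs_le.2 hx))
  have hr1 : r 1 = α := by rw [hr, glue_of_nonneg _ _ zero_le_one]
  have hrm1 : r (-1) = -α := by
    rw [hr, glue_of_neg _ _ (by norm_num), neg_neg, hαL]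
  have hcont : Continuous fun x : Icc (-1 : ℝ) 1 => r x :=
    continuousOn_iff_continuous_domRestrict.1
      (continuousOn_primitive hreg.intervalIntegrable_deriv hreg.eq)
  set g : Icc (-1 : ℝ) 1 →ᵇ ℝ := BoundedContinuousFunction.mkOfCompact ⟨_, hcont⟩ with hg
  have hgr : ∀ x : Icc (-1 : ℝ) 1, g x = r x := fun x => rfl
  -- The solution is r - ασ: it keeps the right-hand side, as σ is annihilated off 0, and vanishes
  -- at ±1.
  refine ⟨_, ⟨(g, -α), ⟨⟨fun x => hbd x x.2, fun x y => hlip x x.2 y y.2⟩, ?_⟩, rfl⟩, ?_⟩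
  · have := hbd 1 (by norm_num)
    rw [hr1, ← abs_neg] at this
    exact abs_le.1 this
  · refine mem_graph.2 ⟨(-α) • κ, r, _, _, hreg, ?_, ?_, ?_, ?_, ?_, ?_⟩
    · simp [hκ, hrm1]; ring
    · simp [hκ, hr1]; ring
    · simp [hκ]; ring
    · simp only [hκ, Pi.smul_apply, smul_eq_mul, ← hνdef]
      simp
      field_simp
      ring
    · filter_upwards [Lp.coeFn_add (extendLp g) ((-α) • σ), Lp.coeFn_smul (-α) σ,
        coeFn_extendLp g hgr, hσ.coeFn_toLp] with x e1 e2 e3 e4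
      rw [singularPart_smul, e1, Pi.add_apply, e2, Pi.smul_apply, e3, smul_eq_mul, hσdef, e4]
    · filter_upwards [ae_ne_zero] with x hx
      rw [hνdef, nu_sq hc] at *
      rcases hx.lt_or_gt with h0 | h0
      · rw [hr, glue_of_neg _ _ h0, glue_of_neg _ _ h0]
        simp
      · rw [hr, glue_of_nonneg _ _ h0.le, glue_of_nonneg _ _ h0.le]
        ring

end Inverse

/-! ### The heat semigroup, reachable states and controllability -/

section Control

open scoped InnerProductSpace

theorem isHeatSemigroup_of_repr {c : ℝ} (hc : c ∈ Ioo (-1 / 4 : ℝ) (3 / 4)) {φ : L2I}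
    (hG : HasCompactInverse (graph c) φ) {ι : Type*} {b : HilbertBasis ι ℝ L2I} {l : ι → ℝ}
    (hb : ∀ i, (b i, l i • b i) ∈ graph c) {m : ℝ} (hm : 0 ≤ m) (hl : ∀ i, -m ≤ l i)
    {S : ℝ → L2I →L[ℝ] L2I}
    (hS : ∀ t, 0 ≤ t → ∀ x i, ⟪b i, S t x⟫_ℝ = Real.exp (-(l i * t)) * ⟪b i, x⟫_ℝ) :
    IsHeatSemigroup c S := by
  intro f0
  obtain ⟨h, hh, hd⟩ := exists_generator_diagonal_semigroup b hl hm hS f0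
  refine ⟨continuousOn_diagonal_semigroup b hl hm hS f0, ext_inner_hilbertBasis b fun i => ?_,
    h, hh, fun t ht => ⟨(opGraph_iff hc).2 (hG.mem_of_repr hb (hd t ht).1), (hd t ht).2⟩⟩
  rw [hS 0 le_rfl, mul_zero, neg_zero, Real.exp_zero, one_mul]

/-- By symmetry the coefficient along an eigenvector satisfies a scalar linear ODE. With an
eigenbasis this determines e^{-tA} for t ≥ 0, which is needed because a mild solution may come with
any semigroup satisfying the definition. -/
theorem IsHeatSemigroup.inner_eq {c : ℝ} (hc : c ∈ Ioo (-1 / 4 : ℝ) (3 / 4))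
    {S : ℝ → L2I →L[ℝ] L2I} (hS : IsHeatSemigroup c S) {e : L2I} {v : ℝ}
    (he : (e, v • e) ∈ graph c) {t : ℝ} (ht : 0 ≤ t) (x : L2I) :
    ⟪e, S t x⟫_ℝ = Real.exp (-(v * t)) * ⟪e, x⟫_ℝ := by
  obtain ⟨hcont, h0, h, -, hh⟩ := hS x
  have := inner_eq_exp_mul (e := e) (v := v) hcont (fun t ht => (hh t ht).2) (fun t ht => ?_) ht
  · rwa [show S 0 x = x from h0] at this
  · rw [← inner_graph hc he ((opGraph_iff hc).1 (hh t ht).1), real_inner_smul_left]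

/-- Multiplication by the characteristic function of a measurable set. -/
def cutoff {ω : Set ℝ} (hω : MeasurableSet ω) (w : L2I) : L2I :=
  ((Lp.memLp w).indicator hω).toLp _

/-- The inner product is the integral of x² over ω. -/
theorem eq_zero_of_inner_cutoff {ω : Set ℝ} (hω : MeasurableSet ω) {x : L2I}
    (h : ⟪cutoff hω x, x⟫_ℝ = 0) : ∀ᵐ y ∂μI, y ∈ ω → x y = 0 := by
  have h1 : ∫ y, ω.indicator (fun y => x y ^ 2) y ∂μI = 0 := by
    rw [← h, inner_eq_integral]
    refine integral_congr_ae ?_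
    filter_upwards [((Lp.memLp x).indicator hω).coeFn_toLp] with y hy
    rw [cutoff, hy]
    by_cases hyω : y ∈ ω <;> simp [hyω, sq]
  rw [integral_eq_zero_iff_of_nonneg
    (fun y => indicator_nonneg (fun z _ => sq_nonneg (x z)) y)
    ((Lp.memLp x).integrable_sq.indicator hω)] at h1
  filter_upwards [h1] with y hy hyω
  simpa [hyω] using hy

/-- A control acting on `ω` whose slices are square integrable and depend continuously on time. -/
structure IsContinuousControl (T : ℝ) (ω : Set ℝ) (S : ℝ → L2I →L[ℝ] L2I) (u : ℝ → ℝ → ℝ) :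
    Prop where
  memLp : MemLp (Function.uncurry u) 2 (volume.restrict (Ioo 0 T ×ˢ ω))
  slice : ∀ t, MemLp (ω.indicator (u t)) 2 μI
  source : Continuous (controlSource ω u)
  orbit : ContinuousOn (fun τ => S (T - τ) (controlSource ω u τ)) (Icc 0 T)

theorem controlSource_of_memLp {ω : Set ℝ} {u : ℝ → ℝ → ℝ} {t : ℝ}
    (h : MemLp (ω.indicator (u t)) 2 μI) : controlSource ω u t = h.toLp _ := dif_pos h

theorem slice_add {ω : Set ℝ} {u v : ℝ → ℝ → ℝ} {t : ℝ} (hu : MemLp (ω.indicator (u t)) 2 μI)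
    (hv : MemLp (ω.indicator (v t)) 2 μI) : MemLp (ω.indicator ((u + v) t)) 2 μI := by
  rw [Pi.add_apply, indicator_add']
  exact hu.add hv

theorem indicator_smul_slice (ω : Set ℝ) (u : ℝ → ℝ → ℝ) (t a : ℝ) :
    ω.indicator ((a • u) t) = a • ω.indicator (u t) := indicator_const_smul ω a (u t)

theorem slice_smul {ω : Set ℝ} {u : ℝ → ℝ → ℝ} {t : ℝ} (hu : MemLp (ω.indicator (u t)) 2 μI)
    (a : ℝ) : MemLp (ω.indicator ((a • u) t)) 2 μI := by
  rw [indicator_smul_slice]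
  exact hu.const_smul a

theorem controlSource_add {ω : Set ℝ} {u v : ℝ → ℝ → ℝ} {t : ℝ}
    (hu : MemLp (ω.indicator (u t)) 2 μI) (hv : MemLp (ω.indicator (v t)) 2 μI) :
    controlSource ω (u + v) t = controlSource ω u t + controlSource ω v t := by
  rw [controlSource_of_memLp hu, controlSource_of_memLp hv,
    controlSource_of_memLp (slice_add hu hv), ← MemLp.toLp_add]
  exact MemLp.toLp_congr _ _ (by rw [Pi.add_apply, indicator_add'])

theorem controlSource_smul {ω : Set ℝ} {u : ℝ → ℝ → ℝ} {t : ℝ}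
    (hu : MemLp (ω.indicator (u t)) 2 μI) (a : ℝ) :
    controlSource ω (a • u) t = a • controlSource ω u t := by
  rw [controlSource_of_memLp hu, controlSource_of_memLp (slice_smul hu a), ← MemLp.toLp_const_smul]
  exact MemLp.toLp_congr _ _ (by rw [indicator_smul_slice])

variable {T : ℝ} {ω : Set ℝ} {S : ℝ → L2I →L[ℝ] L2I}

theorem IsContinuousControl.add {u v : ℝ → ℝ → ℝ} (hu : IsContinuousControl T ω S u)
    (hv : IsContinuousControl T ω S v) : IsContinuousControl T ω S (u + v) := by
  have e : controlSource ω (u + v) = controlSource ω u + controlSource ω v :=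
    funext fun t => controlSource_add (hu.slice t) (hv.slice t)
  refine ⟨hu.memLp.add hv.memLp, fun t => slice_add (hu.slice t) (hv.slice t), ?_, ?_⟩
  · rw [e]
    exact hu.source.add hv.source
  · simp_rw [e, Pi.add_apply, map_add]
    exact hu.orbit.add hv.orbit

theorem IsContinuousControl.smul {u : ℝ → ℝ → ℝ} (hu : IsContinuousControl T ω S u) (a : ℝ) :
    IsContinuousControl T ω S (a • u) := by
  have e : controlSource ω (a • u) = a • controlSource ω u :=
    funext fun t => controlSource_smul (hu.slice t) a
  refine ⟨hu.memLp.const_smul a, fun t => slice_smul (hu.slice t) a, ?_, ?_⟩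
  · rw [e]
    exact hu.source.const_smul a
  · simp_rw [e, Pi.smul_apply, map_smul]
    exact hu.orbit.const_smul a

theorem IsContinuousControl.zero : IsContinuousControl T ω S 0 := by
  have hs : ∀ t, MemLp (ω.indicator ((0 : ℝ → ℝ → ℝ) t)) 2 μI := fun t => by
    rw [Pi.zero_apply, indicator_zero']
    exact MemLp.zero
  have e : controlSource ω 0 = fun _ => 0 := funext fun t => by
    have := controlSource_smul (hs t) 0
    rwa [zero_smul, zero_smul] at this
  refine ⟨MemLp.zero, hs, ?_, ?_⟩
  · rw [e]
    exact continuous_const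
  · simp_rw [e, map_zero]
    exact continuousOn_const

theorem IsContinuousControl.intervalIntegrable {u : ℝ → ℝ → ℝ} (hT : 0 ≤ T)
    (hu : IsContinuousControl T ω S u) :
    IntervalIntegrable (fun τ => S (T - τ) (controlSource ω u τ)) volume 0 T :=
  ContinuousOn.intervalIntegrable_of_Icc hT hu.orbit

/-- The states reached at time `T` from `0` by continuous controls. -/
def reachable (hT : 0 ≤ T) (ω : Set ℝ) (S : ℝ → L2I →L[ℝ] L2I) : Submodule ℝ L2I where
  carrier := {z | ∃ u, IsContinuousControl T ω S u ∧
    ∫ τ in (0 : ℝ)..T, S (T - τ) (controlSource ω u τ) = z}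
  add_mem' := by
    rintro _ _ ⟨u, hu, rfl⟩ ⟨v, hv, rfl⟩
    refine ⟨u + v, hu.add hv, ?_⟩
    simp_rw [fun t => controlSource_add (hu.slice t) (hv.slice t), map_add]
    exact intervalIntegral.integral_add (hu.intervalIntegrable hT) (hv.intervalIntegrable hT)
  zero_mem' := by
    refine ⟨0 • (0 : ℝ → ℝ → ℝ), IsContinuousControl.zero.smul 0, ?_⟩
    simp_rw [fun t => controlSource_smul
      ((IsContinuousControl.zero (T := T) (ω := ω) (S := S)).slice t) 0, zero_smul, map_zero]
    exact intervalIntegral.integral_zero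
  smul_mem' := by
    rintro a _ ⟨u, hu, rfl⟩
    refine ⟨a • u, hu.smul a, ?_⟩
    simp_rw [fun t => controlSource_smul (hu.slice t) a, map_smul]
    exact intervalIntegral.integral_smul a _

theorem controlSource_mul (hω : MeasurableSet ω) (θ : ℝ → ℝ) (w : L2I) (t : ℝ) :
    controlSource ω (fun t x => θ t * w x) t = θ t • cutoff hω w := by
  have e : ω.indicator (fun x => θ t * w x) = θ t • ω.indicator w :=
    indicator_const_smul ω (θ t) w
  have h : MemLp (ω.indicator (fun x => θ t * w x)) 2 μI := by
    rw [e]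
    exact ((Lp.memLp w).indicator hω).const_smul _
  rw [controlSource_of_memLp h, cutoff, ← MemLp.toLp_const_smul]
  exact MemLp.toLp_congr _ _ (by rw [e])

/-- Separated controls θ(t) w(x) with θ continuous are rich enough for the duality argument, and all
their integrals have continuous integrands. -/
theorem isContinuousControl_mul (hω : MeasurableSet ω) (hsub : ω ⊆ Ioo (-1) 1)
    (hS : ∀ x, ContinuousOn (fun t => S t x) (Ici 0)) {θ : ℝ → ℝ} (hθ : Continuous θ) (w : L2I) :
    IsContinuousControl T ω S (fun t x => θ t * w x) := by
  have e : controlSource ω (fun t x => θ t * w x) = fun t => θ t • cutoff hω w :=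
    funext (controlSource_mul hω θ w)
  have hw : MemLp w 2 (volume.restrict ω) :=
    (Lp.memLp w).mono_measure (Measure.restrict_mono hsub le_rfl)
  refine ⟨?_, fun t => ?_, ?_, ?_⟩
  · rw [Measure.volume_eq_prod, ← Measure.prod_restrict, memLp_two_iff_integrable_sq]
    · have h1 : Integrable (fun t => θ t ^ 2) (volume.restrict (Ioo 0 T)) :=
        ((hθ.pow 2).integrableOn_Icc (a := 0) (b := T)).mono_set Ioo_subset_Icc_self
      refine (h1.mul_prod hw.integrable_sq).congr (ae_of_all _ fun q => ?_)
      exact (mul_pow _ _ 2).symm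
    · exact (hθ.aestronglyMeasurable.comp_fst (ν := volume.restrict ω)).mul
        (hw.aestronglyMeasurable.comp_snd (μ := volume.restrict (Ioo 0 T)))
  · have h := ((Lp.memLp w).indicator hω).const_smul (θ t)
    rwa [show θ t • ω.indicator w = ω.indicator (fun x => θ t * w x) from
      (indicator_const_smul ω (θ t) w).symm] at h
  · rw [e]
    exact hθ.smul continuous_const
  · simp_rw [e, map_smul]
    refine hθ.continuousOn.smul ((hS _).comp (continuous_const.sub continuous_id).continuousOn ?_)
    exact fun τ hτ => sub_nonneg.2 hτ.2

/-- A state orthogonal to all reachable ones is orthogonal to the orbits of cut-off functions. -/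
theorem inner_orbit_eq_zero (hT : 0 < T) (hω : MeasurableSet ω) (hsub : ω ⊆ Ioo (-1) 1)
    (hS : ∀ x, ContinuousOn (fun t => S t x) (Ici 0)) {g : L2I}
    (hg : g ∈ (reachable hT.le ω S)ᗮ) (w : L2I) {s : ℝ} (hs : s ∈ Ioo 0 T) :
    ⟪S s (cutoff hω w), g⟫_ℝ = 0 := by
  -- The time profile is the quantity to be annihilated, so that orthogonality to the state reached
  -- reads ∫θ² = 0. The maximum with 0 only extends θ continuously past τ = T.
  set θ : ℝ → ℝ := fun τ => ⟪g, S (max (T - τ) 0) (cutoff hω w)⟫_ℝ with hθdef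
  have hθ : Continuous θ := continuous_const.inner ((hS (cutoff hω w)).comp_continuous
    ((continuous_const.sub continuous_id).max continuous_const) fun τ => mem_Ici.2 (le_max_right _ _))
  have hu : IsContinuousControl T ω S (fun t x => θ t * w x) :=
    isContinuousControl_mul hω hsub hS hθ w
  have h0 : ∫ τ in (0 : ℝ)..T, θ τ ^ 2 = 0 := by
    have h1 := (Submodule.mem_orthogonal' _ _).1 hg _ ⟨_, hu, rfl⟩
    have h2 := (innerSL ℝ g).intervalIntegral_comp_comm (hu.intervalIntegrable hT.le)
    rw [innerSL_apply_apply, h1] at h2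
    refine Eq.trans ?_ h2
    refine intervalIntegral.integral_congr fun τ hτ => ?_
    rw [uIcc_of_le hT.le] at hτ
    simp only [controlSource_mul hω, map_smul, innerSL_apply_apply, smul_eq_mul, hθdef,
      max_eq_left (sub_nonneg.2 hτ.2), sq]
  have hz : θ (T - s) = 0 := by
    by_contra hne
    have := intervalIntegral.integral_pos hT (hθ.pow 2).continuousOn (fun x _ => sq_nonneg (θ x))
      ⟨T - s, ⟨by linarith [hs.2], by linarith [hs.1]⟩, sq_pos_of_ne_zero hne⟩
    exact this.ne' h0
  rw [real_inner_comm]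
  simpa [hθdef, hs.1.le] using hz

/-- The singular heat equation is approximately controllable. -/
theorem approximatelyControllable {c : ℝ} (hc : c ∈ Ioo (-1 / 4 : ℝ) (3 / 4)) (hT : 0 < T)
    (hω : IsOpen ω) (hω_ne : ω.Nonempty) (hω_sub : ω ⊆ Ioo (-1) 1) :
    ApproximatelyControllable c T ω := by
  obtain ⟨φ, hG⟩ := exists_hasCompactInverse hc
  obtain ⟨ι, b, l, hb⟩ := hG.exists_eigenbasis
  obtain ⟨m, hm, hl⟩ := exists_lower_bound hc b.orthonormal hb
  obtain ⟨S, hS⟩ := exists_diagonal_semigroup b hl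
  have hheat : IsHeatSemigroup c S := isHeatSemigroup_of_repr hc hG hb hm hl hS
  -- A subspace with trivial orthogonal complement is dense; a vector of the complement is killed by
  -- unique continuation of orbits.
  have hdense : Dense (reachable hT.le ω S : Set L2I) := by
    rw [Submodule.dense_iff_topologicalClosure_eq_top, Submodule.topologicalClosure_eq_top_iff,
      Submodule.eq_bot_iff]
    intro g hg
    refine eq_zero_of_orbit b hG hb hl hS (Q := cutoff hω.measurableSet) (fun v x hx hQ => ?_) hT
      fun w s hs => inner_orbit_eq_zero hT hω.measurableSet hω_sub
        (continuousOn_diagonal_semigroup b hl hm hS) hg w hs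
    exact eq_zero_of_eigenfunction hc hω hω_ne hω_sub hx
      (eq_zero_of_inner_cutoff hω.measurableSet (hQ x))
  intro f0 fT ε hε
  -- By linearity it suffices to steer from 0 close to what the free evolution of f⁰ leaves missing.
  obtain ⟨z, ⟨u, hu, huz⟩, hz⟩ := Metric.mem_closure_iff.1 (hdense (fT - S T f0)) ε hε
  refine ⟨u, hu.memLp, ⟨fun t => S t f0 + ∫ τ in (0 : ℝ)..t, S (t - τ) (controlSource ω u τ),
    hu.source.intervalIntegrable 0 T, S, hheat, fun t _ => rfl⟩, ?_⟩
  rintro f ⟨-, R, hR, hf⟩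
  -- Any other semigroup has the same coefficients in the eigenbasis, so the estimate holds for
  -- every mild solution.
  have hRS : ∀ t, 0 ≤ t → ∀ x, R t x = S t x := fun t ht x =>
    ext_inner_hilbertBasis b fun i => by rw [hS t ht, hR.inner_eq hc (hb i) ht]
  have hInt : ∫ τ in (0 : ℝ)..T, R (T - τ) (controlSource ω u τ) = z := by
    rw [← huz]
    refine intervalIntegral.integral_congr fun τ hτ => ?_
    rw [uIcc_of_le hT.le] at hτ
    exact hRS _ (sub_nonneg.2 hτ.2) _
  rw [hf T ⟨hT.le, le_rfl⟩, hRS T hT.le, hInt, ← dist_eq_norm]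
  rw [dist_eq_norm] at hz ⊢
  rw [show S T f0 + z - fT = -(fT - S T f0 - z) by abel, norm_neg]
  exact hz.le

end Control

end SingularHeat

end

theorem theorem1p2 (T c : ℝ) (hT : 0 < T) (hc : c ∈ Set.Ioo (-1 / 4 : ℝ) (3 / 4))
    (ω : Set ℝ) (hω : IsOpen ω) (hω_ne : ω.Nonempty) (hω_sub : ω ⊆ Set.Ioo (-1) 1) :
    SingularHeat.ApproximatelyControllable c T ω := by
  exact SingularHeat.approximatelyControllable hc hT hω hω_ne hω_sub
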